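/- Let $n \ge 2$. View $\mathbb{C}S_n$ as a superalgebra in which even permutations are even and odd permutations are odd; superspaces are $\mathbb{Z}/2$-graded complex vector spaces, $\Pi$ is the parity shift, and $\cong$ denotes isomorphism of supermodules by an even map. For a partition $\lambda$ of $m$ let $\lambda'$ be the conjugate partition and $S^\lambda$ the Specht module of $\mathbb{C}S_m$. Write $\mu \prec \lambda$ if the Young diagram of $\mu$ is obtained from that of $\lambda$ by removing one box, and let $\operatorname{res}(\lambda/\mu) = j - i$ if this box lies in row $i$ and column $j$. There exist linear maps $\phi^\lambda : S^\lambda \to S^{\lambda'}$, for all partitions $\lambda$ (of all $m$), such that (i) $\phi^\lambda(\sigma v) = \operatorname{sgn}(\sigma)\, \sigma \phi^\lambda(v)$ for all $\sigma \in S_m$ and $v \in S^\lambda$; (ii) $\phi^{\lambda'} \circ \phi^\lambda = \mathrm{id}$; (iii) if $\mu \prec \lambda$, $\mu = \mu'$ and $\lambda = \lambda'$, then $\phi^\lambda \circ \iota = \iota \circ \phi^\mu$ for each $\mathbb{C}S_{m-1}$-module homomorphism $\iota : S^\mu \to S^\lambda$, where $\lambda$ is a partition of $m$. Fix any such maps and,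 for each $m$, any set $\overline{\mathcal{P}}(m)$ of representatives for the classes $\{\lambda,\lambda'\}$ of partitions of $m$. For $\lambda \in \overline{\mathcal{P}}(m)$ define a $\mathbb{C}S_m$-supermodule $W^\lambda$ as follows, and put $W^{\lambda'} = W^{\lambda}$: - if $\lambda \ne \lambda'$, then $W^\lambda = S^\lambda \oplus S^{\lambda'}$ as a module, with even part $\{u + \phi^\lambda(u) : u \in S^\lambda\}$ and odd part $\{u - \phi^\lambda(u) : u \in S^\lambda\}$; - if $\lambda = \lambda'$, then $W^\lambda = S^\lambda$ as a module, with even and odd parts the $+1$- and $-1$-eigenspaces of $\phi^\lambda$. Then for every $\lambda \in \overline{\mathcal{P}}(n)$ the restriction of $W^\lambda$ to $\mathbb{C}S_{n-1}$ (the sums being over partitions $\mu$ of $n-1$) is $$W^\lambda\big|_{\mathbb{C}S_{n-1}} \cong \begin{cases} \Big[\bigoplus_{\mu \prec \lambda,\ \mu \ne \mu'} W^\mu\Big] \oplus \Big[\bigoplus_{\mu \prec \lambda,\ \mu = \mu'} W^\mu \oplus \Pi(W^\mu)\Big] & \text{if } \lambda \ne \lambda',\\[1ex] \bigoplus_{\mu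 \prec \lambda,\ \operatorname{res}(\lambda/\mu) \ge 0} W^\mu & \text{if } \lambda = \lambda'.\end{cases}$$ In particular the restriction is multiplicity-free when a supermodule is distinguished from its parity shift, that is, it is a direct sum of simple supermodules no two of which are isomorphic by an even isomorphism. If $\lambda = \lambda'$, it is even a direct sum of simple supermodules no two of which are isomorphic by an even or an odd isomorphism. -/

import Mathlib

open scoped DirectSum

noncomputable section

namespace SuperSym

/-! ### Supermodules over the group superalgebra of a finite supergroup

A supergroup is a group `G` with a homomorphism `ε : G →* ℤˣ`; the elements with `ε g = 1` are even
and those with `ε g = -1` are odd. The group algebra `ℂG` is graded accordingly. A `ℂG`-supermodule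
is a `ℂG`-module (a complex representation of `G`) with a decomposition `V = V₀ ⊕ V₁` such that a
group element of parity `p` maps `V_i` into `V_{i+p}`. -/

/-- The parity of a sign: `1 ↦ 0` and `-1 ↦ 1`. -/
def parity (u : ℤˣ) : ZMod 2 := if u = 1 then 0 else 1

/-- A supermodule over the group superalgebra `ℂG`. -/
structure Supermodule {G : Type} [Group G] (ε : G →* ℤˣ) where
  V : Type
  [addCommGroup : AddCommGroup V]
  [module : Module ℂ V]
  ρ : Representation ℂ G V
  grade : ZMod 2 → Submodule ℂ V
  isCompl : IsCompl (grade 0) (grade 1)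
  map_grade : ∀ (g : G) (i : ZMod 2) (v : V), v ∈ grade i → ρ g v ∈ grade (i + parity (ε g))

attribute [instance] Supermodule.addCommGroup Supermodule.module

namespace Supermodule

variable {G : Type} [Group G] {ε : G →* ℤˣ}

/-- An even isomorphism of supermodules. -/
structure Iso (M N : Supermodule ε) where
  toLinearEquiv : M.V ≃ₗ[ℂ] N.V
  map_smul : ∀ (g : G) (v : M.V), toLinearEquiv (M.ρ g v) = N.ρ g (toLinearEquiv v)
  map_grade : ∀ (i : ZMod 2) (v : M.V), v ∈ M.grade i → toLinearEquiv v ∈ N.grade i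

/-- The parity shift `Π(M)`: the same module, with the two homogeneous components exchanged. -/
def shift (M : Supermodule ε) : Supermodule ε where
  V := M.V
  ρ := M.ρ
  grade i := M.grade (i + 1)
  isCompl := by
    have h : (1 + 1 : ZMod 2) = 0 := by decide
    rw [zero_add, h]
    exact M.isCompl.symm
  map_grade g i v hv := by
    have := M.map_grade g _ v hv
    rwa [add_right_comm] at this

/-- The direct sum of two supermodules. -/
def prod (M N : Supermodule ε) : Supermodule ε where
  V := M.V × N.V
  ρ := M.ρ.prod N.ρ
  grade i := (M.grade i).prod (N.grade i)
  isCompl := by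
    have hM := M.isCompl
    have hN := N.isCompl
    constructor
    · rw [disjoint_iff, Submodule.prod_inf_prod, hM.inf_eq_bot, hN.inf_eq_bot, Submodule.prod_bot]
    · rw [codisjoint_iff, Submodule.prod_sup_prod, hM.sup_eq_top, hN.sup_eq_top,
        Submodule.prod_top]
  map_grade g i v hv := ⟨M.map_grade g i _ hv.1, N.map_grade g i _ hv.2⟩

/-- The direct sum of a family of supermodules. -/
def directSum {ι : Type} (M : ι → Supermodule ε) : Supermodule ε where
  V := ⨁ i, (M i).V
  ρ :=
    { toFun := fun g => DirectSum.lmap (fun i => (M i).ρ g)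
      map_one' := by
        classical
        refine LinearMap.ext fun x => DFinsupp.ext fun i => ?_
        simp
      map_mul' := fun g h => by
        classical
        refine LinearMap.ext fun x => DFinsupp.ext fun i => ?_
        simp }
  grade p := ⨅ i, ((M i).grade p).comap (DirectSum.component ℂ ι (fun i => (M i).V) i)
  isCompl := by
    classical
    constructor
    · rw [Submodule.disjoint_def]
      intro x h0 h1
      simp only [Submodule.mem_iInf, Submodule.mem_comap] at h0 h1
      refine DFinsupp.ext fun i => ?_
      exact Submodule.disjoint_def.1 (M i).isCompl.disjoint _ (h0 i) (h1 i)
    · rw [codisjoint_iff, eq_top_iff]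
      intro x _
      induction x using DirectSum.induction_on with
      | zero => exact Submodule.zero_mem _
      | add x y hx hy => exact Submodule.add_mem _ (hx trivial) (hy trivial)
      | of i v =>
        have hv : v ∈ (M i).grade 0 ⊔ (M i).grade 1 := by
          rw [(M i).isCompl.sup_eq_top]; trivial
        obtain ⟨a, ha, b, hb, rfl⟩ := Submodule.mem_sup.1 hv
        have key : ∀ (p : ZMod 2) (c : (M i).V), c ∈ (M i).grade p →
            DirectSum.of (fun i => (M i).V) i c ∈
              ⨅ j, ((M j).grade p).comap (DirectSum.component ℂ ι (fun i => (M i).V) j) := by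
          intro p c hc
          simp only [Submodule.mem_iInf, Submodule.mem_comap]
          intro j
          by_cases hij : i = j
          · subst hij
            have : DirectSum.component ℂ ι (fun i => (M i).V) i
                (DirectSum.of (fun i => (M i).V) i c) = c :=
              DirectSum.of_eq_same (β := fun i => (M i).V) i c
            rwa [this]
          · have : DirectSum.component ℂ ι (fun i => (M i).V) j
                (DirectSum.of (fun i => (M i).V) i c) = 0 :=
              DirectSum.of_eq_of_ne _ _ _ (Ne.symm hij)
            rw [this]
            exact Submodule.zero_mem _
        rw [map_add]
        exact Submodule.add_mem_sup (key 0 a ha) (key 1 b hb)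
  map_grade g p x hx := by
    simp only [Submodule.mem_iInf, Submodule.mem_comap] at hx ⊢
    intro i
    exact (M i).map_grade g p _ (hx i)

/-- Restriction along a homomorphism of supergroups (a parity-preserving homomorphism). -/
def restrict {H : Type} [Group H] {δ : H →* ℤˣ} (f : H →* G) (hf : ∀ h, ε (f h) = δ h)
    (M : Supermodule ε) : Supermodule δ where
  V := M.V
  ρ := M.ρ.comp f
  grade := M.grade
  isCompl := M.isCompl
  map_grade h i v hv := by
    rw [← hf h]
    exact M.map_grade (f h) i v hv

/-- A subspace `U` is a subsupermodule if it is stable under the action and is the sum of its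
intersections with the two homogeneous components. -/
def IsSub (M : Supermodule ε) (U : Submodule ℂ M.V) : Prop :=
  (∀ (g : G) (v : M.V), v ∈ U → M.ρ g v ∈ U) ∧ U = (U ⊓ M.grade 0) ⊔ (U ⊓ M.grade 1)

/-- A nonzero supermodule without proper nonzero subsupermodules. -/
def IsSimple (M : Supermodule ε) : Prop :=
  Nontrivial M.V ∧ ∀ U : Submodule ℂ M.V, M.IsSub U → U = ⊥ ∨ U = ⊤

/-- `M` is a direct sum of simple supermodules, no two of which are isomorphic by an even
isomorphism (a supermodule and its parity shift are thus counted as different). -/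
def IsMultiplicityFree (M : Supermodule ε) : Prop :=
  ∃ (ι : Type) (N : ι → Supermodule ε), (∀ i, (N i).IsSimple) ∧
    (∀ i j, i ≠ j → IsEmpty (Iso (N i) (N j))) ∧ Nonempty (Iso M (directSum N))

/-- `M` is a direct sum of simple supermodules, no two of which are isomorphic by a homogeneous
(even or odd) isomorphism. An odd isomorphism onto `N` is an even isomorphism onto `Π(N)`. -/
def IsHomogeneouslyMultiplicityFree (M : Supermodule ε) : Prop :=
  ∃ (ι : Type) (N : ι → Supermodule ε), (∀ i, (N i).IsSimple) ∧
    (∀ i j, i ≠ j → IsEmpty (Iso (N i) (N j)) ∧ IsEmpty (Iso (N i) (N j).shift)) ∧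
    Nonempty (Iso M (directSum N))

end Supermodule

/-! ### Partitions -/

/-- Partitions of `n`, as Young diagrams with `n` cells; the cell `(i, j)` is in row `i` and
column `j`. -/
abbrev Shape (n : ℕ) : Type := {d : YoungDiagram // d.card = n}

/-- The conjugate partition. -/
def Shape.conj {n : ℕ} (lam : Shape n) : Shape n :=
  ⟨lam.1.transpose, by
    have h : lam.1.transpose.card = lam.1.card := by simp [YoungDiagram.card, YoungDiagram.transpose]
    exact h.trans lam.2⟩

theorem Shape.conj_conj {n : ℕ} (lam : Shape n) : lam.conj.conj = lam :=
  Subtype.ext (YoungDiagram.transpose_transpose _)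

/-- `mu ≺ lam`: the diagram of `mu` is obtained from that of `lam` by removing one cell. -/
def Precedes {n : ℕ} (mu : Shape n) (lam : Shape (n + 1)) : Prop :=
  ∃ c ∈ lam.1.cells, mu.1.cells = lam.1.cells.erase c

/-- The residue `j - i` of the cell removed from `lam` to obtain `mu`, when `mu ≺ lam`. -/
def res {n : ℕ} (mu : Shape n) (lam : Shape (n + 1)) : ℤ :=
  ∑ c ∈ lam.1.cells \ mu.1.cells, ((c.2 : ℤ) - (c.1 : ℤ))

/-- `R` contains exactly one element of each class `{lam, lam'}`. -/
def IsTransversal {n : ℕ} (R : Set (Shape n)) : Prop :=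
  ∀ lam : Shape n, ∃! kap : Shape n, kap ∈ R ∧ (kap = lam ∨ kap = lam.conj)

/-! ### Specht modules -/

/-- The inclusion of `S_n` in `S_{n+1}` as the stabilizer of the last letter. -/
def inclusion (n : ℕ) : Equiv.Perm (Fin n) →* Equiv.Perm (Fin (n + 1)) :=
  Equiv.Perm.viaEmbeddingHom Fin.castSuccEmb

theorem sign_inclusion (n : ℕ) (σ : Equiv.Perm (Fin n)) :
    Equiv.Perm.sign (inclusion n σ) = Equiv.Perm.sign σ := by
  classical
  rw [inclusion, Equiv.Perm.viaEmbeddingHom_apply]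
  unfold Equiv.Perm.viaEmbedding
  convert Equiv.Perm.sign_extendDomain σ
    (Equiv.ofInjective (Fin.castSuccEmb : Fin n ↪ Fin (n + 1)).1 Fin.castSuccEmb.2)

/-- A tableau of shape `lam`: a bijective filling of the cells of `lam` by the letters. -/
abbrev Tableau {n : ℕ} (lam : Shape n) : Type := {c // c ∈ lam.1.cells} ≃ Fin n

/-- The row of `t` that contains a given letter. The function `t.row` is the tabloid of `t`. -/
def Tableau.row {n : ℕ} {lam : Shape n} (t : Tableau lam) (k : Fin n) : ℕ := (t.symm k).1.1

/-- The column of `t` that contains a given letter. -/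
def Tableau.col {n : ℕ} {lam : Shape n} (t : Tableau lam) (k : Fin n) : ℕ := (t.symm k).1.2

/-- The column stabilizer of a tableau. -/
def Tableau.colStab {n : ℕ} {lam : Shape n} (t : Tableau lam) : Finset (Equiv.Perm (Fin n)) :=
  {σ | ∀ k, t.col (σ k) = t.col k}

/-- The space of complex functions on the set of all maps from letters to rows. A tabloid `{t}` is
identified with the map `t.row` that sends each letter to its row, and then with the indicator
function of this map; so this space contains the permutation modules spanned by the tabloids. -/
abbrev TabloidSpace (n : ℕ) : Type := (Fin n → ℕ) → ℂ

/-- The tabloid `{t}`. -/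
def Tableau.tabloid {n : ℕ} {lam : Shape n} (t : Tableau lam) : TabloidSpace n := Pi.single t.row 1

/-- The action of `S_n` on tabloids by permutation of the letters: `σ{t} = {σt}`. -/
def tabloidRep (n : ℕ) : Representation ℂ (Equiv.Perm (Fin n)) (TabloidSpace n) where
  toFun σ := LinearMap.funLeft ℂ ℂ (fun f : Fin n → ℕ => f ∘ ⇑σ)
  map_one' := rfl
  map_mul' _ _ := rfl

theorem tabloidRep_tabloid {n : ℕ} {lam : Shape n} (σ : Equiv.Perm (Fin n)) (t : Tableau lam) :
    tabloidRep n σ t.tabloid = Tableau.tabloid (t.trans σ : Tableau lam) := by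
  classical
  have hrow : Tableau.row (t.trans σ : Tableau lam) = t.row ∘ ⇑σ⁻¹ := rfl
  funext f
  show t.tabloid (f ∘ ⇑σ) = _
  have h : f ∘ ⇑σ = t.row ↔ f = t.row ∘ ⇑σ⁻¹ := by
    constructor
    · intro h
      rw [← h]
      funext k
      simp
    · intro h
      rw [h]
      funext k
      simp
  simp only [Tableau.tabloid, hrow, Pi.single_apply, h]

/-- The polytabloid `e_t`, the sum of `sgn(σ) σ{t}` over the column stabilizer of `t`. -/
def polytabloid {n : ℕ} {lam : Shape n} (t : Tableau lam) : TabloidSpace n :=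
  ∑ σ ∈ t.colStab,
    (((Equiv.Perm.sign σ : ℤˣ) : ℤ) : ℂ) • tabloidRep n σ t.tabloid

/-- The Specht module `S^lam`, spanned by the polytabloids of shape `lam`. -/
def Specht {n : ℕ} (lam : Shape n) : Submodule ℂ (TabloidSpace n) :=
  Submodule.span ℂ (Set.range (polytabloid (lam := lam)))

theorem tabloidRep_polytabloid {n : ℕ} {lam : Shape n} (σ : Equiv.Perm (Fin n)) (t : Tableau lam) :
    tabloidRep n σ (polytabloid t) = polytabloid (t.trans σ : Tableau lam) := by
  have hcol : Tableau.col (t.trans σ : Tableau lam) = t.col ∘ ⇑σ⁻¹ := rfl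
  unfold polytabloid
  rw [map_sum]
  refine Finset.sum_equiv (MulAut.conj σ).toEquiv ?_ ?_
  · intro τ
    simp only [Tableau.colStab, Finset.mem_filter, Finset.mem_univ, true_and, hcol]
    constructor
    · intro h k
      simpa [MulAut.conj_apply] using h (σ⁻¹ k)
    · intro h k
      simpa [MulAut.conj_apply] using h (σ k)
  · intro τ _
    have hs : Equiv.Perm.sign ((MulAut.conj σ).toEquiv τ) = Equiv.Perm.sign τ := by
      simp [MulAut.conj_apply, mul_right_comm]
    rw [hs, map_smul, ← tabloidRep_tabloid, ← Module.End.mul_apply, ← Module.End.mul_apply,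
      ← map_mul, ← map_mul]
    simp [MulAut.conj_apply]

theorem specht_le_comap {n : ℕ} (lam : Shape n) (σ : Equiv.Perm (Fin n)) :
    Specht lam ≤ (Specht lam).comap (tabloidRep n σ) := by
  refine Submodule.span_le.2 ?_
  rintro _ ⟨t, rfl⟩
  show tabloidRep n σ (polytabloid t) ∈ Specht lam
  rw [tabloidRep_polytabloid]
  exact Submodule.subset_span ⟨_, rfl⟩

/-- The action of `S_n` on the Specht module. -/
def spechtRep {n : ℕ} (lam : Shape n) : Representation ℂ (Equiv.Perm (Fin n)) (Specht lam) :=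
  (tabloidRep n).subrepresentation (Specht lam) (specht_le_comap lam)

/-! ### The associators and the supermodules `W^lam` -/

/-- A choice of linear maps `φ^lam : S^lam → S^lam'` for all partitions `lam`, such that
* `φ^lam (σ v) = sgn(σ) σ φ^lam(v)`;
* `φ^lam' ∘ φ^lam = id`;
* whenever `mu ≺ lam` and both are symmetric, `φ^lam` restricts to `φ^mu` on the copy of `S^mu` in
  `S^lam`.
The elements are compared in the space of tabloids because `lam'' = lam` (and `lam' = lam` in the
third condition) are not definitional equalities. -/
structure Associators where
  φ : ∀ {n : ℕ} (lam : Shape n), Specht lam →ₗ[ℂ] Specht lam.conj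
  intertwine : ∀ {n : ℕ} (lam : Shape n) (σ : Equiv.Perm (Fin n)) (v : Specht lam),
    φ lam (spechtRep lam σ v) =
      (((Equiv.Perm.sign σ : ℤˣ) : ℤ) : ℂ) • spechtRep lam.conj σ (φ lam v)
  inverse : ∀ {n : ℕ} (lam : Shape n) (v : Specht lam),
    (φ lam.conj (φ lam v) : TabloidSpace n) = v
  compatible : ∀ {n : ℕ} (mu : Shape n) (lam : Shape (n + 1)),
    Precedes mu lam → mu = mu.conj → lam = lam.conj →
    ∀ j : Specht mu →ₗ[ℂ] Specht lam,
      (∀ σ v, j (spechtRep mu σ v) = spechtRep lam (inclusion n σ) (j v)) →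
      ∀ v w : Specht mu, (φ mu v : TabloidSpace n) = w →
        (φ lam (j v) : TabloidSpace (n + 1)) = j w

/-- The scalar `(-1) ^ i`. -/
def eps (i : ZMod 2) : ℂ := if i = 0 then 1 else -1

theorem eps_add_parity (i : ZMod 2) (u : ℤˣ) : eps (i + parity u) = ((u : ℤ) : ℂ) * eps i := by
  rcases Int.units_eq_one_or u with rfl | rfl
  · simp [parity]
  · have h : parity (-1) = 1 := by decide
    have h1 : ∀ i : ZMod 2, (i + 1 = 0 ↔ ¬ i = 0) := by decide
    rw [h, eps, eps]
    by_cases hi : i = 0 <;> simp [h1, hi]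

namespace Associators

variable (Φ : Associators)

theorem surj {n : ℕ} (lam kap : Shape n) (h : lam.conj = kap) (w : Specht kap) :
    ∃ x : Specht lam, (Φ.φ lam x : TabloidSpace n) = w := by
  subst h
  have key : ∀ nu : Shape n, nu = lam → ∀ y : Specht nu, (Φ.φ nu y : TabloidSpace n) = w →
      ∃ x : Specht lam, (Φ.φ lam x : TabloidSpace n) = w := by
    rintro nu rfl y hy
    exact ⟨y, hy⟩
  exact key _ lam.conj_conj (Φ.φ lam.conj w) (Φ.inverse lam.conj w)

theorem inj {n : ℕ} (lam : Shape n) (v : Specht lam) (h : Φ.φ lam v = 0) : v = 0 := by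
  have := Φ.inverse lam v
  rw [h, map_zero] at this
  exact Subtype.ext this.symm

theorem isCompl_eigenspaces {n : ℕ} (lam : Shape n) (h : lam = lam.conj) :
    IsCompl
      (LinearMap.ker ((Specht lam.conj).subtype ∘ₗ Φ.φ lam - eps 0 • (Specht lam).subtype))
      (LinearMap.ker ((Specht lam.conj).subtype ∘ₗ Φ.φ lam - eps 1 • (Specht lam).subtype)) := by
  constructor
  · rw [Submodule.disjoint_def]
    intro v h0 h1
    simp only [eps, LinearMap.mem_ker, LinearMap.sub_apply, LinearMap.comp_apply,
      Submodule.subtype_apply, LinearMap.smul_apply, sub_eq_zero] at h0 h1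
    rw [h0] at h1
    simp only [if_true, one_smul, one_ne_zero, if_false, neg_smul] at h1
    exact Subtype.ext (self_eq_neg.1 h1)
  · rw [codisjoint_iff, eq_top_iff]
    intro v _
    -- `w` is `φ v`, seen as an element of `S^lam`
    obtain ⟨w, hw⟩ : ∃ w : Specht lam, (w : TabloidSpace n) = Φ.φ lam v :=
      ⟨⟨Φ.φ lam v, (congrArg Specht h).ge (Φ.φ lam v).2⟩, rfl⟩
    have hφw : (Φ.φ lam w : TabloidSpace n) = v := by
      have key : ∀ nu : Shape n, nu = lam → ∀ y : Specht nu, (y : TabloidSpace n) = w →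
          (Φ.φ nu y : TabloidSpace n) = Φ.φ lam w := by
        rintro nu rfl y hy
        rw [Subtype.ext hy]
      rw [← key lam.conj h.symm (Φ.φ lam v) hw.symm]
      exact Φ.inverse lam v
    refine Submodule.mem_sup.2 ⟨(1 / 2 : ℂ) • (v + w), ?_, (1 / 2 : ℂ) • (v - w), ?_, ?_⟩
    · simp only [eps, LinearMap.mem_ker, LinearMap.sub_apply, LinearMap.comp_apply,
        Submodule.subtype_apply, map_smul, map_add, hφw, hw, if_true, one_smul]
      module
    · simp only [eps, LinearMap.mem_ker, LinearMap.sub_apply, LinearMap.comp_apply,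
        Submodule.subtype_apply, LinearMap.smul_apply, map_smul, map_sub,
        Submodule.coe_smul, Submodule.coe_sub, hφw, hw, one_ne_zero, if_false, neg_smul, one_smul]
      module
    · rw [← smul_add]
      have : v + w + (v - w) = (2 : ℂ) • v := by rw [two_smul]; abel
      rw [this, smul_smul]
      norm_num

/-- For `lam = lam'`: the module `S^lam`, whose even and odd components are the eigenspaces of
`φ^lam` for the eigenvalues `1` and `-1`. -/
def typeM {n : ℕ} (lam : Shape n) (h : lam = lam.conj) :
    Supermodule (Equiv.Perm.sign (α := Fin n)) where
  V := Specht lam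
  ρ := spechtRep lam
  grade i := LinearMap.ker ((Specht lam.conj).subtype ∘ₗ Φ.φ lam - eps i • (Specht lam).subtype)
  isCompl := Φ.isCompl_eigenspaces lam h
  map_grade σ i v hv := by
    simp only [LinearMap.mem_ker, LinearMap.sub_apply, LinearMap.comp_apply,
      Submodule.subtype_apply, LinearMap.smul_apply, sub_eq_zero] at hv ⊢
    have h2 : (spechtRep lam.conj σ (Φ.φ lam v) : TabloidSpace n) =
        eps i • (spechtRep lam σ v : TabloidSpace n) := by
      show tabloidRep n σ (Φ.φ lam v : TabloidSpace n) = eps i • tabloidRep n σ (v : TabloidSpace n)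
      rw [hv, map_smul]
    rw [Φ.intertwine, Submodule.coe_smul, h2, smul_smul, eps_add_parity]

theorem isCompl_graphs {n : ℕ} (lam : Shape n) :
    IsCompl (LinearMap.graph (eps 0 • Φ.φ lam)) (LinearMap.graph (eps 1 • Φ.φ lam)) := by
  constructor
  · rw [Submodule.disjoint_def]
    rintro ⟨u, w⟩ h0 h1
    simp only [eps, LinearMap.mem_graph_iff, LinearMap.smul_apply, if_true, one_smul,
      one_ne_zero, if_false, neg_smul] at h0 h1
    have h2 : Φ.φ lam u = 0 := by
      rw [h0] at h1
      exact Subtype.ext (self_eq_neg.1 (congrArg Subtype.val h1))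
    rw [h2] at h0
    rw [h0, Φ.inj lam u h2]
    rfl
  · rw [codisjoint_iff, eq_top_iff]
    rintro ⟨u, w⟩ _
    obtain ⟨x, hx⟩ := Φ.surj lam _ rfl w
    have hx : Φ.φ lam x = w := Subtype.ext hx
    refine Submodule.mem_sup.2 ⟨((1 / 2 : ℂ) • (u + x), (1 / 2 : ℂ) • Φ.φ lam (u + x)), ?_,
      ((1 / 2 : ℂ) • (u - x), -((1 / 2 : ℂ) • Φ.φ lam (u - x))), ?_, ?_⟩
    · simp only [LinearMap.mem_graph_iff, eps, LinearMap.smul_apply, map_smul, if_true, one_smul]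
    · simp only [LinearMap.mem_graph_iff, eps, LinearMap.smul_apply, map_smul, one_ne_zero, if_false,
        neg_smul, one_smul]
      rw [smul_neg]
    · refine Prod.ext ?_ ?_
      · show (1 / 2 : ℂ) • (u + x) + (1 / 2 : ℂ) • (u - x) = u
        module
      · show (1 / 2 : ℂ) • Φ.φ lam (u + x) + -((1 / 2 : ℂ) • Φ.φ lam (u - x)) = w
        rw [map_add, map_sub, hx]
        module

/-- For `lam ≠ lam'`: the module `S^lam ⊕ S^lam'`, whose even component is `{u + φ^lam(u)}` and
whose odd component is `{u - φ^lam(u)}`, for `u` in `S^lam`. -/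
def typeQ {n : ℕ} (lam : Shape n) : Supermodule (Equiv.Perm.sign (α := Fin n)) where
  V := Specht lam × Specht lam.conj
  ρ := (spechtRep lam).prod (spechtRep lam.conj)
  grade i := LinearMap.graph (eps i • Φ.φ lam)
  isCompl := Φ.isCompl_graphs lam
  map_grade σ i v hv := by
    rw [LinearMap.mem_graph_iff] at hv ⊢
    show spechtRep lam.conj σ v.2 = eps (i + parity (Equiv.Perm.sign σ)) •
      Φ.φ lam (spechtRep lam σ v.1)
    rw [hv, Φ.intertwine, LinearMap.smul_apply, map_smul, eps_add_parity, smul_smul]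
    have hs : ((((Equiv.Perm.sign σ : ℤˣ) : ℤ) : ℂ) * eps i *
        (((Equiv.Perm.sign σ : ℤˣ) : ℤ) : ℂ)) = eps i := by
      rcases Int.units_eq_one_or (Equiv.Perm.sign σ) with h | h <;> simp [h]
    rw [hs]

open Classical in
/-- The construction of `W^lam` from the partition `lam`. -/
def ofPartition {n : ℕ} (lam : Shape n) : Supermodule (Equiv.Perm.sign (α := Fin n)) :=
  if h : lam = lam.conj then Φ.typeM lam h else Φ.typeQ lam

open Classical in
/-- The supermodule `W^lam` attached to the class `{lam, lam'}`, constructed from the member of the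
class that lies in the set `R` of representatives. -/
def W {n : ℕ} (R : Set (Shape n)) (lam : Shape n) : Supermodule (Equiv.Perm.sign (α := Fin n)) :=
  if lam ∈ R then Φ.ofPartition lam else Φ.ofPartition lam.conj

end Associators

/-- The restriction of a `ℂS_{n+1}`-supermodule to `ℂS_n`. -/
def down {n : ℕ} (M : Supermodule (Equiv.Perm.sign (α := Fin (n + 1)))) :
    Supermodule (Equiv.Perm.sign (α := Fin n)) :=
  M.restrict (inclusion n) (sign_inclusion n)

end SuperSym

end

/-! The proof rests on the classical branching rule for Specht modules: the restriction of
$S^\lambda$ is the direct sum of the $S^\mu$ with $\mu \prec \lambda$, each occurring once. Given a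
nonzero equivariant $j : S^\mu \to S^\lambda$, conjugation by the associators gives an equivariant
$\phi j \phi : S^{\mu'} \to S^{\lambda'}$, since the two sign characters cancel. All summands of
$W^\lambda$ are built from $j$ and $\phi j\phi$. If $\lambda \ne \lambda'$, then $(u, w) \mapsto
(ju, \phi j \phi w)$ is an even map $W^\mu \to W^\lambda$ for $\mu \ne \mu'$, while for $\mu = \mu'$
the maps $u \mapsto (ju, \pm\phi j \phi u)$ are even on $W^\mu$ and on $\Pi(W^\mu)$ respectively. If
$\lambda = \lambda'$, then $j$ itself is even for $\mu = \mu'$ by condition (iii), and $(u, w)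
\mapsto ju + \phi j \phi w$ is even for $\mu \ne \mu'$; it uses up $\mu$ and $\mu'$ together, and
the condition on the residue picks one of the two. By branching the images span. The sources are
simple (`isSimple_W`) and pairwise nonisomorphic: $W^\mu$ determines $\{\mu, \mu'\}$, both members
of a class with $\mu \ne \mu'$ lie below $\lambda$ only if $\lambda = \lambda'$, and for $\mu =
\mu'$ there is no even isomorphism from $W^\mu$ to $\Pi(W^\mu)$. A Schur-type argument
(`jointly_injective`) then makes the sum direct (`nonempty_iso_directSum`). The branching rule
follows from a dimension count. Specht modules are irreducible (`irreducible_specht`) and determined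
by their shape through dominance (`eq_of_intertwines`). Reading off the position of the last letter
and averaging yields a surjection of $S^\lambda$ onto each $S^\mu$ below it, hence $\sum_{\mu \prec
\lambda} \dim S^\mu \le \dim S^\lambda$ and, by reciprocity, $\sum_{\lambda \succ \mu} \dim
S^\lambda \le (n+1) \dim S^\mu$. The relation $DU - UD = 1$ in Young's lattice forces equality in
both by induction (`sum_dim`). Associators exist because $\{s\} \mapsto \pm e_{s'}$ induces a
nonzero map $S^\lambda \to S^{\lambda'}$ twisted by the sign. A square root normalizes it to satisfy
(ii). Condition (iii) then only fixes a sign for each symmetric $\lambda$, consistently because at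
most one symmetric $\mu$ lies below it. -/

namespace SuperSym

/-! ### Families of operators -/

section Operators

variable {X : Type} {U V W : Type} [AddCommGroup U] [Module ℂ U] [AddCommGroup V] [Module ℂ V]
  [AddCommGroup W] [Module ℂ W]

/-- A family of operators on a nonzero space without common proper nonzero invariant subspaces. -/
def Irreducible (a : X → Module.End ℂ V) : Prop :=
  Nontrivial V ∧ ∀ U : Submodule ℂ V, (∀ x, ∀ v ∈ U, a x v ∈ U) → U = ⊥ ∨ U = ⊤

/-- The linear map `f` commutes with two families of operators. -/
def Intertwines (a : X → Module.End ℂ V) (b : X → Module.End ℂ W) (f : V →ₗ[ℂ] W) : Prop :=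
  ∀ x v, f (a x v) = b x (f v)

theorem Intertwines.comp {a : X → Module.End ℂ U} {b : X → Module.End ℂ V}
    {c : X → Module.End ℂ W} {g : V →ₗ[ℂ] W} {f : U →ₗ[ℂ] V} (hg : Intertwines b c g)
    (hf : Intertwines a b f) : Intertwines a c (g ∘ₗ f) := fun x v => by
  rw [LinearMap.comp_apply, hf, hg, LinearMap.comp_apply]

theorem Irreducible.injective {a : X → Module.End ℂ V} {b : X → Module.End ℂ W}
    (ha : Irreducible a) {f : V →ₗ[ℂ] W} (hf : Intertwines a b f) (h0 : f ≠ 0) :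
    Function.Injective f := by
  rw [← LinearMap.ker_eq_bot]
  refine (ha.2 (LinearMap.ker f) fun x v hv => ?_).resolve_right fun h => ?_
  · rw [LinearMap.mem_ker] at hv ⊢
    rw [hf, hv, map_zero]
  · exact h0 (LinearMap.ker_eq_top.1 h)

theorem Irreducible.surjective {a : X → Module.End ℂ V} {b : X → Module.End ℂ W}
    (hb : Irreducible b) {f : V →ₗ[ℂ] W} (hf : Intertwines a b f) (h0 : f ≠ 0) :
    Function.Surjective f := by
  rw [← LinearMap.range_eq_top]
  refine (hb.2 (LinearMap.range f) ?_).resolve_left fun h => h0 (LinearMap.range_eq_bot.1 h)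
  rintro x _ ⟨v, rfl⟩
  exact ⟨a x v, hf x v⟩

/-- Schur's lemma. -/
theorem Irreducible.exists_equiv {a : X → Module.End ℂ V} {b : X → Module.End ℂ W}
    (ha : Irreducible a) (hb : Irreducible b) {f : V →ₗ[ℂ] W} (hf : Intertwines a b f)
    (h0 : f ≠ 0) : ∃ e : V ≃ₗ[ℂ] W, Intertwines a b e :=
  ⟨LinearEquiv.ofBijective f ⟨ha.injective hf h0, hb.surjective hf h0⟩, hf⟩

/-- Nonzero intertwining maps from pairwise nonisomorphic irreducible spaces to a common space
are jointly injective. -/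
theorem jointly_injective {ι : Type} {V : ι → Type} [∀ i, AddCommGroup (V i)]
    [∀ i, Module ℂ (V i)] (a : ∀ i, X → Module.End ℂ (V i)) (ha : ∀ i, Irreducible (a i))
    (b : X → Module.End ℂ W) (f : ∀ i, V i →ₗ[ℂ] W) (hf : ∀ i, Intertwines (a i) b (f i))
    (h0 : ∀ i, f i ≠ 0)
    (hiso : ∀ i j, i ≠ j → ∀ e : V i ≃ₗ[ℂ] V j, ¬ Intertwines (a i) (a j) e) (s : Finset ι) :
    ∀ v : ∀ i, V i, ∑ i ∈ s, f i (v i) = 0 → ∀ i ∈ s, v i = 0 := by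
  classical
  induction s using Finset.induction_on with
  | empty => simp
  | insert k s hk ih =>
    have huniq : ∀ v w : ∀ i, V i, ∑ i ∈ s, f i (v i) = ∑ i ∈ s, f i (w i) →
        ∀ i ∈ s, v i = w i := fun v w hvw i hi => sub_eq_zero.1 <| ih (fun i => v i - w i)
          (by simp only [map_sub, Finset.sum_sub_distrib, hvw, sub_self]) i hi
    -- `U` consists of the vectors of `V k` whose image lies in the sum of the other images. If `U`
    -- were everything, uniqueness of the expression (the induction hypothesis) would make each of
    -- its coordinates a linear intertwiner; one of them is nonzero, hence an isomorphism by Schur's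
    -- lemma.
    let U : Submodule ℂ (V k) :=
      { carrier := {v | ∃ w : ∀ i, V i, f k v = ∑ i ∈ s, f i (w i)}
        add_mem' := by
          rintro v v' ⟨w, hw⟩ ⟨w', hw'⟩
          exact ⟨fun i => w i + w' i, by simp only [map_add, Finset.sum_add_distrib, hw, hw']⟩
        zero_mem' := ⟨fun _ => 0, by simp⟩
        smul_mem' := by
          rintro c v ⟨w, hw⟩
          exact ⟨fun i => c • w i, by simp only [map_smul, Finset.smul_sum, hw]⟩ }
    have hU : U = ⊥ := by
      refine ((ha k).2 U ?_).resolve_right fun hU => ?_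
      · rintro x v ⟨w, hw⟩
        exact ⟨fun i => a i x (w i), by rw [hf, hw, map_sum]; simp only [hf _ x]⟩
      · have hall : ∀ v : V k, ∃ w : ∀ i, V i, f k v = ∑ i ∈ s, f i (w i) := fun v =>
          (hU.ge trivial : v ∈ U)
        choose w hw using hall
        obtain ⟨v, hv⟩ : ∃ v, f k v ≠ 0 := by
          by_contra! h
          exact h0 k (LinearMap.ext h)
        obtain ⟨i, hi, hwi⟩ : ∃ i ∈ s, w v i ≠ 0 := by
          by_contra! h
          exact hv (by rw [hw, Finset.sum_eq_zero fun i hi => by rw [h i hi, map_zero]])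
        let g : V k →ₗ[ℂ] V i :=
          { toFun := fun v => w v i
            map_add' := fun v v' => huniq (w (v + v')) (fun i => w v i + w v' i)
              (by simp only [map_add, Finset.sum_add_distrib, ← hw]) i hi
            map_smul' := fun c v => huniq (w (c • v)) (fun i => c • w v i)
              (by simp only [map_smul, ← Finset.smul_sum, ← hw]) i hi }
        have hg : Intertwines (a k) (a i) g := fun x v =>
          huniq (w (a k x v)) (fun i => a i x (w v i))
            (by rw [← hw, hf, hw, map_sum]; simp only [hf _ x]) i hi
        have hg0 : g ≠ 0 := fun h => hwi (LinearMap.congr_fun h v)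
        obtain ⟨e, he⟩ := (ha k).exists_equiv (ha i) hg hg0
        exact hiso k i (fun h => hk (h ▸ hi)) e he
    intro v hv
    rw [Finset.sum_insert hk] at hv
    have hvk : v k = 0 := by
      have : v k ∈ U := ⟨fun i => - v i, by
        simp only [map_neg, Finset.sum_neg_distrib]; exact eq_neg_of_add_eq_zero_left hv⟩
      rwa [hU, Submodule.mem_bot] at this
    rw [hvk, map_zero, zero_add] at hv
    intro i hi
    rcases Finset.mem_insert.1 hi with rfl | hi
    · exact hvk
    · exact ih v hv i hi

end Operators

/-! ### Averaging over a finite group -/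

section Average

variable {H : Type} [Group H] [Fintype H] {V W : Type} [AddCommGroup V] [Module ℂ V]
  [AddCommGroup W] [Module ℂ W]

/-- A linear map that is equivariant on an invariant subspace agrees there with an equivariant
linear map. -/
theorem exists_intertwines_eqOn (ρ : Representation ℂ H V) (τ : Representation ℂ H W)
    (f : V →ₗ[ℂ] W) (U : Submodule ℂ V) (hf : ∀ h, ∀ u ∈ U, f (ρ h u) = τ h (f u)) :
    ∃ g : V →ₗ[ℂ] W, Intertwines ρ τ g ∧ ∀ u ∈ U, g u = f u := by
  -- On `U` every term of the average equals `f`, so averaging changes nothing there.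
  refine ⟨(Fintype.card H : ℂ)⁻¹ • ∑ h, τ h⁻¹ ∘ₗ f ∘ₗ ρ h, fun x v => ?_, fun u hu => ?_⟩
  · simp only [LinearMap.smul_apply, LinearMap.sum_apply, LinearMap.comp_apply, map_smul, map_sum]
    congr 1
    refine Fintype.sum_equiv (Equiv.mulRight x) _ _ fun h => ?_
    simp only [Equiv.coe_mulRight, ← Module.End.mul_apply, ← map_mul]
    congr 2
    group
  · simp only [LinearMap.smul_apply, LinearMap.sum_apply, LinearMap.comp_apply]
    have : ∀ h : H, τ h⁻¹ (f (ρ h u)) = f u := fun h => by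
      rw [hf h u hu, ← Module.End.mul_apply, ← map_mul, inv_mul_cancel, map_one]; rfl
    simp only [this, Finset.sum_const, Finset.card_univ, ← Nat.cast_smul_eq_nsmul ℂ, smul_smul]
    rw [inv_mul_cancel₀ (Nat.cast_ne_zero.2 Fintype.card_ne_zero), one_smul]

/-- A surjective equivariant linear map has an equivariant section. -/
theorem exists_intertwines_section (ρ : Representation ℂ H V) (τ : Representation ℂ H W)
    (p : V →ₗ[ℂ] W) (hp : Intertwines ρ τ p) (hs : Function.Surjective p) :
    ∃ j : W →ₗ[ℂ] V, Intertwines τ ρ j ∧ ∀ w, p (j w) = w := by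
  obtain ⟨q, hq⟩ := p.exists_rightInverse_of_surjective (LinearMap.range_eq_top.2 hs)
  have hq : ∀ w, p (q w) = w := fun w => LinearMap.congr_fun hq w
  refine ⟨(Fintype.card H : ℂ)⁻¹ • ∑ h, ρ h⁻¹ ∘ₗ q ∘ₗ τ h, fun x v => ?_, fun u => ?_⟩
  · simp only [LinearMap.smul_apply, LinearMap.sum_apply, LinearMap.comp_apply, map_smul, map_sum]
    congr 1
    refine Fintype.sum_equiv (Equiv.mulRight x) _ _ fun h => ?_
    simp only [Equiv.coe_mulRight, ← Module.End.mul_apply, ← map_mul]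
    congr 2
    group
  · simp only [LinearMap.smul_apply, LinearMap.sum_apply, LinearMap.comp_apply, map_smul, map_sum]
    have : ∀ h : H, p (ρ h⁻¹ (q (τ h u))) = u := fun h => by
      rw [hp, hq, ← Module.End.mul_apply, ← map_mul, inv_mul_cancel, map_one]; rfl
    simp only [this, Finset.sum_const, Finset.card_univ, ← Nat.cast_smul_eq_nsmul ℂ, smul_smul]
    rw [inv_mul_cancel₀ (Nat.cast_ne_zero.2 Fintype.card_ne_zero), one_smul]

end Average

/-! ### Column antisymmetrizers -/

theorem tabloidRep_apply {n : ℕ} (σ : Equiv.Perm (Fin n)) (u : TabloidSpace n) (f : Fin n → ℕ) :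
    tabloidRep n σ u f = u (f ∘ ⇑σ) := rfl

/-- The scalar `sgn(σ)`. -/
abbrev sgn {n : ℕ} (σ : Equiv.Perm (Fin n)) : ℂ := (((Equiv.Perm.sign σ : ℤˣ) : ℤ) : ℂ)

theorem sgn_mul_self {n : ℕ} (σ : Equiv.Perm (Fin n)) : sgn σ * sgn σ = 1 := by
  rcases Int.units_eq_one_or (Equiv.Perm.sign σ) with h | h <;> simp [sgn, h]

theorem sgn_mul {n : ℕ} (σ τ : Equiv.Perm (Fin n)) : sgn (σ * τ) = sgn σ * sgn τ := by
  simp [sgn]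

namespace Tableau

variable {n : ℕ} {lam mu : Shape n}

theorem mem_colStab {t : Tableau lam} {σ : Equiv.Perm (Fin n)} :
    σ ∈ t.colStab ↔ ∀ k, t.col (σ k) = t.col k := by
  simp [colStab]

theorem one_mem_colStab (t : Tableau lam) : 1 ∈ t.colStab := mem_colStab.2 fun _ => rfl

theorem mul_mem_colStab_iff {t : Tableau lam} {σ τ : Equiv.Perm (Fin n)} (hσ : σ ∈ t.colStab) :
    σ * τ ∈ t.colStab ↔ τ ∈ t.colStab := by
  rw [mem_colStab] at hσ
  simp only [mem_colStab, Equiv.Perm.mul_apply, hσ]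

theorem inv_mem_colStab {t : Tableau lam} {σ : Equiv.Perm (Fin n)} (hσ : σ ∈ t.colStab) :
    σ⁻¹ ∈ t.colStab := by
  rw [← mul_mem_colStab_iff hσ, mul_inv_cancel]
  exact t.one_mem_colStab

/-- A letter is determined by its row and its column. -/
theorem ext_letter (t : Tableau lam) {k l : Fin n} (hr : t.row k = t.row l)
    (hc : t.col k = t.col l) : k = l :=
  t.symm.injective (Subtype.ext (Prod.ext hr hc))

theorem mem_cells (t : Tableau lam) (k : Fin n) : (t.row k, t.col k) ∈ lam.1.cells :=
  (t.symm k).2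

theorem row_apply (t : Tableau lam) (c : {c // c ∈ lam.1.cells}) : t.row (t c) = c.1.1 := by
  simp [row]

theorem col_apply (t : Tableau lam) (c : {c // c ∈ lam.1.cells}) : t.col (t c) = c.1.2 := by
  simp [col]

theorem row_trans (t : Tableau lam) (σ : Equiv.Perm (Fin n)) :
    Tableau.row (t.trans σ : Tableau lam) = t.row ∘ ⇑σ⁻¹ := rfl

theorem row_comp (t : Tableau lam) (σ : Equiv.Perm (Fin n)) :
    t.row ∘ ⇑σ = Tableau.row (t.trans σ⁻¹ : Tableau lam) := by
  rw [row_trans, inv_inv]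

instance : Nonempty (Tableau lam) := ⟨Finset.equivFinOfCardEq lam.2⟩

/-- The column antisymmetrizer `κ_t`. -/
noncomputable def antisymmetrizer (t : Tableau lam) : Module.End ℂ (TabloidSpace n) :=
  ∑ σ ∈ t.colStab, sgn σ • tabloidRep n σ

theorem antisymmetrizer_apply (t : Tableau lam) (u : TabloidSpace n) (f : Fin n → ℕ) :
    t.antisymmetrizer u f = ∑ σ ∈ t.colStab, sgn σ * u (f ∘ ⇑σ) := by
  simp [antisymmetrizer, LinearMap.sum_apply, Finset.sum_apply, tabloidRep_apply]

theorem polytabloid_eq (t : Tableau lam) : polytabloid t = t.antisymmetrizer t.tabloid := by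
  simp [polytabloid, antisymmetrizer, LinearMap.sum_apply]

/-- Left multiplication by `σ` permutes the column stabilizer, so functions in the image of `κ_t`
are alternating under it. -/
theorem antisymmetrizer_apply_comp (t : Tableau lam) (u : TabloidSpace n) (f : Fin n → ℕ)
    {σ : Equiv.Perm (Fin n)} (hσ : σ ∈ t.colStab) :
    t.antisymmetrizer u (f ∘ ⇑σ) = sgn σ * t.antisymmetrizer u f := by
  rw [antisymmetrizer_apply, antisymmetrizer_apply, Finset.mul_sum]
  refine Finset.sum_equiv (Equiv.mulLeft σ) (fun τ => ?_) fun τ _ => ?_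
  · exact (mul_mem_colStab_iff hσ).symm
  · rw [Equiv.coe_mulLeft, sgn_mul, ← mul_assoc, ← mul_assoc, sgn_mul_self, one_mul]
    rfl

/-- A function is injective on the columns of `t`. -/
def ColInjective (t : Tableau lam) (f : Fin n → ℕ) : Prop :=
  ∀ k l, t.col k = t.col l → f k = f l → k = l

/-- If two letters of one column had the same value, their transposition would fix `f` and also
negate the value at `f`. -/
theorem colInjective_of_ne_zero (t : Tableau lam) {u : TabloidSpace n} {f : Fin n → ℕ}
    (h : t.antisymmetrizer u f ≠ 0) : t.ColInjective f := by
  intro k l hc hf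
  by_contra hkl
  have hs : Equiv.swap k l ∈ t.colStab := mem_colStab.2 fun m => by
    rcases eq_or_ne m k with rfl | hk
    · rw [Equiv.swap_apply_left, hc]
    rcases eq_or_ne m l with rfl | hl
    · rw [Equiv.swap_apply_right, hc]
    · rw [Equiv.swap_apply_of_ne_of_ne hk hl]
  have hfs : f ∘ ⇑(Equiv.swap k l) = f := by
    funext m
    rcases eq_or_ne m k with rfl | hk
    · rw [Function.comp_apply, Equiv.swap_apply_left, hf]
    rcases eq_or_ne m l with rfl | hl
    · rw [Function.comp_apply, Equiv.swap_apply_right, hf]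
    · rw [Function.comp_apply, Equiv.swap_apply_of_ne_of_ne hk hl]
  have := t.antisymmetrizer_apply_comp u f hs
  rw [hfs, sgn, Equiv.Perm.sign_swap hkl] at this
  simp only [Units.val_neg, Units.val_one, Int.cast_neg, Int.cast_one, neg_mul, one_mul] at this
  exact h (self_eq_neg.1 this)

end Tableau

/-! ### The dominance order -/

/-- The number of cells in the first `r` rows. -/
def Shape.top {n : ℕ} (lam : Shape n) (r : ℕ) : ℕ := (lam.1.cells.filter fun c => c.1 < r).card

theorem Shape.ext_top {n : ℕ} {lam mu : Shape n} (h : ∀ r, lam.top r = mu.top r) : lam = mu := by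
  have key : ∀ (nu : Shape n) (r : ℕ), nu.top (r + 1) = nu.top r + nu.1.rowLen r := fun nu r => by
    rw [YoungDiagram.rowLen_eq_card, YoungDiagram.row, Shape.top, Shape.top,
      ← Finset.card_union_of_disjoint]
    · congr 1
      ext c
      simp only [Finset.mem_filter, Finset.mem_union]
      have : c.1 < r + 1 ↔ c.1 < r ∨ c.1 = r := by omega
      rw [this, and_or_left]
    · rw [Finset.disjoint_left]
      intro c h1 h2
      simp only [Finset.mem_filter] at h1 h2
      omega
  refine Subtype.ext (YoungDiagram.ext (Finset.ext fun c => ?_))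
  have hr : lam.1.rowLen c.1 = mu.1.rowLen c.1 := by
    have h1 := key lam c.1
    have h2 := key mu c.1
    rw [h, h] at h1
    omega
  rw [YoungDiagram.mem_cells, YoungDiagram.mem_cells, ← Prod.mk.eta (p := c),
    YoungDiagram.mem_iff_lt_rowLen, YoungDiagram.mem_iff_lt_rowLen, hr]

namespace Tableau

variable {n : ℕ} {lam mu : Shape n}

theorem card_row_lt (t : Tableau lam) (r : ℕ) :
    (Finset.univ.filter fun k => t.row k < r).card = lam.top r := by
  refine Finset.card_bij (fun k _ => (t.symm k).1) (fun k hk => ?_) (fun k _ l _ h => ?_)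
    fun c hc => ?_
  · rw [Finset.mem_filter] at hk ⊢
    exact ⟨(t.symm k).2, hk.2⟩
  · exact t.symm.injective (Subtype.ext h)
  · rw [Finset.mem_filter] at hc
    refine ⟨t ⟨c, hc.1⟩, ?_, by simp⟩
    simpa [row_apply] using hc.2

/-- An injective `f` has at most `r` letters of column `j` below `r`. The rows of `t` attain this
bound if the column has at least `r` cells; otherwise the right side already counts the whole
column. -/
theorem card_col_row_le (t : Tableau lam) {f : Fin n → ℕ} (hf : t.ColInjective f) (j r : ℕ) :
    (Finset.univ.filter fun k => t.col k = j ∧ f k < r).card ≤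
      (Finset.univ.filter fun k => t.col k = j ∧ t.row k < r).card := by
  rcases le_or_gt r (lam.1.colLen j) with hr | hr
  · calc _ ≤ (Finset.range r).card := by
          refine Finset.card_le_card_of_injOn f (fun k hk => ?_) fun k hk l hl h => ?_
          · simp only [Finset.coe_filter, Finset.mem_univ, true_and, Set.mem_ofPred_eq] at hk
            simpa using hk.2
          · simp only [Finset.coe_filter, Finset.mem_univ, true_and, Set.mem_ofPred_eq] at hk hl
            exact hf k l (hk.1.trans hl.1.symm) h
      _ ≤ _ := by
          have hmem : ∀ i : ℕ, i < r → (i, j) ∈ lam.1.cells := fun i hi =>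
            (YoungDiagram.mem_cells _).2 (YoungDiagram.mem_iff_lt_colLen.2 (hi.trans_le hr))
          rw [← Finset.card_attach]
          refine Finset.card_le_card_of_injOn
            (fun i => t ⟨(i.1, j), hmem _ (Finset.mem_range.1 i.2)⟩) (fun i _ => ?_)
            fun i _ i' _ h => ?_
          · have := Finset.mem_range.1 i.2
            simpa [row_apply, col_apply] using this
          · have := t.injective h
            simp only [Subtype.mk.injEq, Prod.mk.injEq, and_true] at this
            exact Subtype.ext this
  · refine Finset.card_le_card fun k hk => ?_
    simp only [Finset.mem_filter, Finset.mem_univ, true_and] at hk ⊢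
    refine ⟨hk.1, lt_trans ?_ hr⟩
    have := t.mem_cells k
    rwa [hk.1, YoungDiagram.mem_cells, YoungDiagram.mem_iff_lt_colLen] at this

theorem card_lt_eq_sum_col (t : Tableau lam) (f : Fin n → ℕ) (r : ℕ) :
    (Finset.univ.filter fun k => f k < r).card = ∑ j ∈ Finset.univ.image t.col,
      (Finset.univ.filter fun k => t.col k = j ∧ f k < r).card := by
  rw [Finset.card_eq_sum_card_fiberwise (f := t.col) (t := Finset.univ.image t.col)]
  · refine Finset.sum_congr rfl fun j _ => ?_
    rw [Finset.filter_filter]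
    simp only [and_comm]
  · intro k _
    exact Finset.mem_coe.2 (Finset.mem_image_of_mem _ (Finset.mem_univ k))

theorem top_le_top (t : Tableau lam) (s : Tableau mu) (h : t.ColInjective s.row) (r : ℕ) :
    mu.top r ≤ lam.top r := by
  rw [← s.card_row_lt, ← t.card_row_lt, t.card_lt_eq_sum_col, t.card_lt_eq_sum_col t.row]
  exact Finset.sum_le_sum fun j _ => t.card_col_row_le h j r

/-- Both tableaux have the same shape, so the columnwise inequalities behind dominance are all
equalities. Hence `s.row` sends each column of `t` into the rows of that column, and moving each
letter to the row given by `s` within its column is the required permutation. -/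
theorem exists_mem_colStab (t s : Tableau lam) (h : t.ColInjective s.row) :
    ∃ σ ∈ t.colStab, s.row = t.row ∘ ⇑σ := by
  have hlt : ∀ k, s.row k < lam.1.colLen (t.col k) := by
    intro k
    -- With the column length as threshold, the count for `t` is the whole column, so equality puts
    -- every letter of the column below `r` in `s` as well.
    set r := lam.1.colLen (t.col k) with hr
    have hsum : ∑ j ∈ Finset.univ.image t.col,
        (Finset.univ.filter fun k => t.col k = j ∧ s.row k < r).card =
        ∑ j ∈ Finset.univ.image t.col,
          (Finset.univ.filter fun k => t.col k = j ∧ t.row k < r).card := by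
      rw [← t.card_lt_eq_sum_col, ← t.card_lt_eq_sum_col, s.card_row_lt, t.card_row_lt]
    have heq := (Finset.sum_eq_sum_iff_of_le fun j _ => t.card_col_row_le h j r).1 hsum (t.col k)
      (Finset.mem_image_of_mem _ (Finset.mem_univ k))
    have hall : ∀ l, t.col l = t.col k → t.row l < r := fun l hl => by
      have := t.mem_cells l
      rwa [hl, YoungDiagram.mem_cells, YoungDiagram.mem_iff_lt_colLen] at this
    have hsub : (Finset.univ.filter fun l => t.col l = t.col k ∧ s.row l < r) ⊆
        Finset.univ.filter fun l => t.col l = t.col k ∧ t.row l < r := fun l hl => by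
      simp only [Finset.mem_filter, Finset.mem_univ, true_and] at hl ⊢
      exact ⟨hl.1, hall l hl.1⟩
    have hmem : k ∈ Finset.univ.filter fun l => t.col l = t.col k ∧ t.row l < r := by
      simp [hall k rfl]
    rw [← Finset.eq_of_subset_of_card_le hsub heq.ge] at hmem
    simpa using hmem
  have hcell : ∀ k, (s.row k, t.col k) ∈ lam.1.cells := fun k =>
    (YoungDiagram.mem_cells _).2 (YoungDiagram.mem_iff_lt_colLen.2 (hlt k))
  have hinj : Function.Injective fun k => t ⟨_, hcell k⟩ := fun k l hkl => by
    have := t.injective hkl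
    simp only [Subtype.mk.injEq, Prod.mk.injEq] at this
    exact h k l this.2 this.1
  refine ⟨Equiv.ofBijective _ (Finite.injective_iff_bijective.1 hinj),
    mem_colStab.2 fun k => ?_, funext fun k => ?_⟩
  · simp [col_apply]
  · simp [row_apply]

end Tableau

/-! ### Irreducibility of Specht modules -/

/-- The functions supported on the tabloids of shape `lam`. -/
def permModule {n : ℕ} (lam : Shape n) : Submodule ℂ (TabloidSpace n) where
  carrier := {u | ∀ f, u f ≠ 0 → ∃ s : Tableau lam, f = s.row}
  add_mem' {u v} hu hv f h := by
    by_cases hf : u f = 0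
    · exact hv f fun h' => h (by simp [hf, h'])
    · exact hu f hf
  zero_mem' f h := (h rfl).elim
  smul_mem' c u hu f h := hu f fun h' => h (by simp [h'])

section Specht

variable {n : ℕ} {lam mu : Shape n}

open Tableau

theorem tabloidRep_mem_permModule {u : TabloidSpace n} (hu : u ∈ permModule lam)
    (σ : Equiv.Perm (Fin n)) : tabloidRep n σ u ∈ permModule lam := by
  intro f hf
  obtain ⟨s, hs⟩ := hu _ hf
  refine ⟨s.trans σ, ?_⟩
  rw [row_trans, ← hs]
  funext k
  simp

theorem tabloid_mem_permModule (t : Tableau lam) : t.tabloid ∈ permModule lam := by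
  intro f hf
  refine ⟨t, ?_⟩
  by_contra h
  exact hf (Pi.single_eq_of_ne h _)

theorem antisymmetrizer_mem_permModule {u : TabloidSpace n} (hu : u ∈ permModule lam)
    (t : Tableau mu) : t.antisymmetrizer u ∈ permModule lam := by
  rw [antisymmetrizer, LinearMap.sum_apply]
  exact Submodule.sum_mem _ fun σ _ => Submodule.smul_mem _ _ (tabloidRep_mem_permModule hu σ)

theorem polytabloid_mem_permModule (t : Tableau lam) : polytabloid t ∈ permModule lam := by
  rw [polytabloid_eq]
  exact antisymmetrizer_mem_permModule (tabloid_mem_permModule t) t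

theorem specht_le_permModule (lam : Shape n) : Specht lam ≤ permModule lam := by
  refine Submodule.span_le.2 ?_
  rintro _ ⟨t, rfl⟩
  exact polytabloid_mem_permModule t

theorem polytabloid_mem_specht (t : Tableau lam) : polytabloid t ∈ Specht lam :=
  Submodule.subset_span ⟨t, rfl⟩

theorem polytabloid_apply_row (t : Tableau lam) : polytabloid t t.row = 1 := by
  rw [polytabloid_eq, antisymmetrizer_apply, Finset.sum_eq_single 1]
  · simp [tabloid, sgn]
  · intro σ hσ h1
    rw [tabloid, Pi.single_eq_of_ne, mul_zero]
    intro h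
    exact h1 (Equiv.ext fun k => t.ext_letter (congrFun h k) (mem_colStab.1 hσ k))
  · exact fun h => (h t.one_mem_colStab).elim

/-- The image of `κ_t` on the permutation module of the same shape is the line through `e_t`: an
alternating function lives on the tabloids that are injective on the columns of `t`, and these form
the single orbit of `{t}` under the column stabilizer. So its value at `{t}` determines it. -/
theorem antisymmetrizer_eq_smul {u : TabloidSpace n} (hu : u ∈ permModule lam) (t : Tableau lam) :
    t.antisymmetrizer u = t.antisymmetrizer u t.row • polytabloid t := by
  have key : ∀ v ∈ permModule lam, (∃ w, v = t.antisymmetrizer w) → v t.row = 0 → v = 0 := by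
    rintro _ hv ⟨w, rfl⟩ h0
    funext f
    by_contra hf
    obtain ⟨s, rfl⟩ := hv f hf
    obtain ⟨σ, hσ, hs⟩ := t.exists_mem_colStab s (t.colInjective_of_ne_zero hf)
    rw [hs, antisymmetrizer_apply_comp _ _ _ hσ, h0, mul_zero] at hf
    exact hf rfl
  rw [← sub_eq_zero]
  refine key _ (Submodule.sub_mem _ (antisymmetrizer_mem_permModule hu t)
    (Submodule.smul_mem _ _ (polytabloid_mem_permModule t)))
    ⟨u - t.antisymmetrizer u t.row • t.tabloid, ?_⟩ ?_
  · rw [map_sub, map_smul, polytabloid_eq]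
  · simp [polytabloid_apply_row]

theorem antisymmetrizer_polytabloid (t : Tableau lam) :
    t.antisymmetrizer (polytabloid t) = (t.colStab.card : ℂ) • polytabloid t := by
  rw [antisymmetrizer_eq_smul (polytabloid_mem_permModule t), antisymmetrizer_apply]
  congr 1
  have : ∀ σ ∈ t.colStab, sgn σ * polytabloid t (t.row ∘ ⇑σ) = 1 := fun σ hσ => by
    rw [polytabloid_eq, antisymmetrizer_apply_comp _ _ _ hσ, ← polytabloid_eq,
      polytabloid_apply_row, mul_one, sgn_mul_self]
  rw [Finset.sum_congr rfl this]
  simp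

theorem card_colStab_ne_zero (t : Tableau lam) : (t.colStab.card : ℂ) ≠ 0 :=
  Nat.cast_ne_zero.2 (Finset.card_ne_zero_of_mem t.one_mem_colStab)

/-- The polytabloid as an element of the Specht module. -/
noncomputable def spechtPoly (t : Tableau lam) : Specht lam :=
  ⟨polytabloid t, polytabloid_mem_specht t⟩

theorem spechtRep_spechtPoly (σ : Equiv.Perm (Fin n)) (t : Tableau lam) :
    spechtRep lam σ (spechtPoly t) = spechtPoly (t.trans σ : Tableau lam) :=
  Subtype.ext (tabloidRep_polytabloid σ t)

theorem coe_spechtRep (σ : Equiv.Perm (Fin n)) (v : Specht lam) :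
    (spechtRep lam σ v : TabloidSpace n) = tabloidRep n σ v := rfl

theorem span_spechtPoly (lam : Shape n) :
    Submodule.span ℂ (Set.range (spechtPoly (lam := lam))) = ⊤ := by
  refine Submodule.map_injective_of_injective (Specht lam).injective_subtype ?_
  rw [Submodule.map_span, ← Set.range_comp, Submodule.map_top, Submodule.range_subtype]
  rfl

theorem spechtPoly_ext {M : Type} [AddCommGroup M] [Module ℂ M] {f g : Specht lam →ₗ[ℂ] M}
    (h : ∀ t, f (spechtPoly t) = g (spechtPoly t)) : f = g :=
  LinearMap.ext_on_range (span_spechtPoly lam) h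

instance : FiniteDimensional ℂ (Specht lam) :=
  FiniteDimensional.span_of_finite ℂ (Set.finite_range _)

instance : Nontrivial (Specht lam) := by
  obtain ⟨t⟩ := (inferInstance : Nonempty (Tableau lam))
  refine ⟨spechtPoly t, 0, fun h => ?_⟩
  have := congrFun (congrArg Subtype.val h) t.row
  simp only [spechtPoly, polytabloid_apply_row] at this
  exact one_ne_zero this

theorem exists_eq_trans (t s : Tableau lam) : ∃ σ : Equiv.Perm (Fin n), s = t.trans σ :=
  ⟨t.symm.trans s, by ext; simp⟩

/-- `κ_t` is self-adjoint for the Hermitian form with the tabloids as orthonormal basis. This turns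
being killed by all `κ_t` into orthogonality to the Specht module. -/
theorem sum_polytabloid_mul (t : Tableau lam) (u : TabloidSpace n) :
    ∑ f ∈ Finset.univ.image (row (lam := lam)), star (polytabloid t f) * u f =
      t.antisymmetrizer u t.row := by
  classical
  have h1 : ∀ f, star (polytabloid t f) =
      ∑ σ ∈ t.colStab, sgn σ * if f = t.row ∘ ⇑σ then 1 else 0 := by
    intro f
    rw [polytabloid_eq, antisymmetrizer_apply, star_sum]
    refine Finset.sum_bij (fun σ _ => σ⁻¹) (fun σ hσ => inv_mem_colStab hσ)
      (fun _ _ _ _ h => inv_injective h) (fun σ hσ => ⟨σ⁻¹, inv_mem_colStab hσ, inv_inv σ⟩) ?_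
    intro σ _
    have h : f ∘ ⇑σ = t.row ↔ f = t.row ∘ ⇑σ⁻¹ := by
      constructor
      · intro h
        rw [← h]
        funext k
        simp
      · intro h
        rw [h]
        funext k
        simp
    simp only [sgn, Equiv.Perm.sign_inv, tabloid, Pi.single_apply, h]
    split_ifs <;> simp
  simp only [h1, Finset.sum_mul]
  rw [Finset.sum_comm, antisymmetrizer_apply]
  refine Finset.sum_congr rfl fun σ _ => ?_
  rw [Finset.sum_eq_single (t.row ∘ ⇑σ)]
  · simp
  · intro f _ hf
    simp [hf]
  · intro h
    refine (h ?_).elim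
    rw [row_comp]
    exact Finset.mem_image_of_mem _ (Finset.mem_univ _)

/-- James' submodule argument. If some `κ_t` does not kill `U`, then `U` contains `e_t` and so all
its translates. Otherwise `U` is orthogonal to the Specht module, in particular to itself, and
vanishes because the form is positive definite. -/
theorem irreducible_specht (lam : Shape n) : Irreducible (spechtRep lam) := by
  refine ⟨inferInstance, fun U hU => ?_⟩
  have hanti : ∀ u ∈ U, ∀ t : Tableau lam, ∃ v ∈ U,
      (v : TabloidSpace n) = t.antisymmetrizer u := by
    intro u hu t
    refine ⟨∑ σ ∈ t.colStab, sgn σ • spechtRep lam σ u,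
      Submodule.sum_mem _ fun σ _ => Submodule.smul_mem _ _ (hU σ u hu), ?_⟩
    simp [antisymmetrizer, LinearMap.sum_apply, coe_spechtRep]
  by_cases hall : ∀ u ∈ U, ∀ t : Tableau lam, t.antisymmetrizer (u : TabloidSpace n) = 0
  · left
    rw [eq_bot_iff]
    intro u hu
    have horth : ∀ w ∈ Specht lam, ∑ f ∈ Finset.univ.image (row (lam := lam)),
        star (w f) * (u : TabloidSpace n) f = 0 := by
      intro w hw
      induction hw using Submodule.span_induction with
      | mem w hw =>
        obtain ⟨t, rfl⟩ := hw
        rw [sum_polytabloid_mul, hall u hu t]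
        rfl
      | zero => simp
      | add x y _ _ hx hy => simp only [Pi.add_apply, star_add, add_mul, Finset.sum_add_distrib,
          hx, hy, add_zero]
      | smul c x _ hx => simp only [Pi.smul_apply, smul_eq_mul, star_mul', mul_assoc,
          ← Finset.mul_sum, hx, mul_zero]
    have h0 := horth u u.2
    have h0' : ∑ f ∈ Finset.univ.image (row (lam := lam)),
        Complex.normSq ((u : TabloidSpace n) f) = 0 := by
      rw [← Complex.ofReal_inj, Complex.ofReal_sum, Complex.ofReal_zero, ← h0]
      exact Finset.sum_congr rfl fun f _ => Complex.normSq_eq_conj_mul_self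
    rw [Finset.sum_eq_zero_iff_of_nonneg fun f _ => Complex.normSq_nonneg _] at h0'
    rw [Submodule.mem_bot]
    refine Subtype.ext (funext fun f => ?_)
    by_contra hf
    obtain ⟨s, rfl⟩ := specht_le_permModule lam u.2 f hf
    exact hf (Complex.normSq_eq_zero.1
      (h0' _ (Finset.mem_image_of_mem _ (Finset.mem_univ s))))
  · right
    push Not at hall
    obtain ⟨u, hu, t, ht⟩ := hall
    obtain ⟨v, hv, hvt⟩ := hanti u hu t
    rw [antisymmetrizer_eq_smul (specht_le_permModule lam u.2)] at hvt ht
    have hc : t.antisymmetrizer (u : TabloidSpace n) t.row ≠ 0 := fun h => ht (by rw [h, zero_smul])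
    have hp : spechtPoly t ∈ U := by
      have : spechtPoly t = (t.antisymmetrizer (u : TabloidSpace n) t.row)⁻¹ • v := by
        refine Subtype.ext ?_
        rw [Submodule.coe_smul, hvt, smul_smul, inv_mul_cancel₀ hc, one_smul]
        rfl
      rw [this]
      exact Submodule.smul_mem _ _ hv
    rw [eq_top_iff, ← span_spechtPoly, Submodule.span_le]
    rintro _ ⟨s, rfl⟩
    obtain ⟨σ, rfl⟩ := exists_eq_trans t s
    rw [← spechtRep_spechtPoly]
    exact hU σ _ hp

theorem antisymmetrizer_intertwines {T : Specht lam →ₗ[ℂ] Specht mu}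
    (hT : Intertwines (spechtRep lam) (spechtRep mu) T) (t : Tableau lam) :
    t.antisymmetrizer (T (spechtPoly t) : TabloidSpace n) =
      (t.colStab.card : ℂ) • (T (spechtPoly t) : TabloidSpace n) := by
  have h1 : t.antisymmetrizer (T (spechtPoly t) : TabloidSpace n) =
      T (∑ σ ∈ t.colStab, sgn σ • spechtRep lam σ (spechtPoly t)) := by
    rw [map_sum, antisymmetrizer, LinearMap.sum_apply, AddSubmonoidClass.coe_finsetSum]
    refine Finset.sum_congr rfl fun σ _ => ?_
    rw [map_smul, hT]
    rfl
  have h2 : ∑ σ ∈ t.colStab, sgn σ • spechtRep lam σ (spechtPoly t) =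
      (t.colStab.card : ℂ) • spechtPoly t := by
    refine Subtype.ext ?_
    rw [Submodule.coe_smul]
    refine Eq.trans ?_ (antisymmetrizer_polytabloid t)
    simp [antisymmetrizer, LinearMap.sum_apply, coe_spechtRep, spechtPoly]
  rw [h1, h2, map_smul]
  rfl

/-- `T` commutes with `κ_t`, which multiplies `e_t` by a nonzero scalar. So `κ_t` does not vanish on
the permutation module of shape `mu`, and some tabloid of shape `mu` has the letters of each column
of `t` in distinct rows. This forces dominance. -/
theorem top_le_of_intertwines {T : Specht lam →ₗ[ℂ] Specht mu}
    (hT : Intertwines (spechtRep lam) (spechtRep mu) T) (h0 : T ≠ 0) (r : ℕ) :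
    mu.top r ≤ lam.top r := by
  obtain ⟨t, ht⟩ : ∃ t, T (spechtPoly t) ≠ 0 := by
    by_contra! h
    exact h0 (spechtPoly_ext fun t => by rw [h, LinearMap.zero_apply])
  have hne : t.antisymmetrizer (T (spechtPoly t) : TabloidSpace n) ≠ 0 := by
    rw [antisymmetrizer_intertwines hT]
    exact smul_ne_zero (card_colStab_ne_zero t) fun h => ht (Subtype.ext h)
  obtain ⟨f, hf⟩ := Function.ne_iff.1 hne
  obtain ⟨s, rfl⟩ := antisymmetrizer_mem_permModule
    (specht_le_permModule mu (T (spechtPoly t)).2) t f hf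
  exact t.top_le_top s (t.colInjective_of_ne_zero hf) r

/-- Specht modules of different shapes are not isomorphic. -/
theorem eq_of_intertwines {T : Specht lam →ₗ[ℂ] Specht mu}
    (hT : Intertwines (spechtRep lam) (spechtRep mu) T) (h0 : T ≠ 0) : lam = mu := by
  let e := LinearEquiv.ofBijective T
    ⟨(irreducible_specht lam).injective hT h0, (irreducible_specht mu).surjective hT h0⟩
  have he : Intertwines (spechtRep mu) (spechtRep lam) e.symm.toLinearMap := fun σ v => by
    obtain ⟨w, rfl⟩ := e.surjective v
    rw [← show T w = e w from rfl, ← hT]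
    simp only [show ∀ w, T w = e w from fun _ => rfl, LinearEquiv.coe_coe,
      LinearEquiv.symm_apply_apply]
  have he0 : e.symm.toLinearMap ≠ 0 := fun h => by
    obtain ⟨v, hv⟩ := exists_ne (0 : Specht mu)
    exact hv (e.symm.map_eq_zero_iff.1 (LinearMap.congr_fun h v))
  exact Shape.ext_top fun r => le_antisymm (top_le_of_intertwines he he0 r)
    (top_le_of_intertwines hT h0 r)

theorem not_intertwines_of_ne (h : lam ≠ mu) (e : Specht lam ≃ₗ[ℂ] Specht mu) :
    ¬ Intertwines (spechtRep lam) (spechtRep mu) e := fun he => by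
  refine h (eq_of_intertwines he fun h0 => ?_)
  obtain ⟨v, hv⟩ := exists_ne (0 : Specht lam)
  exact hv (e.map_eq_zero_iff.1 (LinearMap.congr_fun h0 v))

/-- Endomorphisms of a Specht module are scalars. -/
theorem exists_scalar {T : Specht lam →ₗ[ℂ] Specht lam}
    (hT : Intertwines (spechtRep lam) (spechtRep lam) T) : ∃ c : ℂ, ∀ v, T v = c • v := by
  obtain ⟨t⟩ := (inferInstance : Nonempty (Tableau lam))
  -- `T e_t` is a nonzero multiple of `κ_t (T e_t)`, which lies on the line through `e_t`.
  obtain ⟨c, hc⟩ : ∃ c : ℂ, T (spechtPoly t) = c • spechtPoly t := by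
    have h := antisymmetrizer_intertwines hT t
    rw [antisymmetrizer_eq_smul (specht_le_permModule lam (T (spechtPoly t)).2)] at h
    refine ⟨(t.colStab.card : ℂ)⁻¹ * t.antisymmetrizer (T (spechtPoly t) : TabloidSpace n) t.row,
      Subtype.ext ?_⟩
    rw [Submodule.coe_smul, mul_smul, show (spechtPoly t : TabloidSpace n) = polytabloid t from rfl,
      h, smul_smul,
      inv_mul_cancel₀ (card_colStab_ne_zero t), one_smul]
  refine ⟨c, fun v => ?_⟩
  have : T = c • LinearMap.id := spechtPoly_ext fun s => by
    obtain ⟨σ, rfl⟩ := exists_eq_trans t s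
    rw [← spechtRep_spechtPoly, hT, hc, map_smul]
    rfl
  rw [this]
  rfl

end Specht

/-! ### Restriction to the stabilizer of the last letter -/

theorem inclusion_castSucc {n : ℕ} (σ : Equiv.Perm (Fin n)) (k : Fin n) :
    inclusion n σ k.castSucc = (σ k).castSucc :=
  Equiv.Perm.viaEmbedding_apply σ Fin.castSuccEmb k

theorem inclusion_last {n : ℕ} (σ : Equiv.Perm (Fin n)) :
    inclusion n σ (Fin.last n) = Fin.last n :=
  Equiv.Perm.viaEmbedding_apply_of_notMem σ Fin.castSuccEmb _ (by
    rintro ⟨k, hk⟩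
    exact Fin.castSucc_ne_last k hk)

theorem exists_inclusion {n : ℕ} (σ : Equiv.Perm (Fin (n + 1))) (h : σ (Fin.last n) = Fin.last n) :
    ∃ τ : Equiv.Perm (Fin n), inclusion n τ = σ := by
  have hne : ∀ k : Fin n, σ k.castSucc ≠ Fin.last n := fun k hk =>
    Fin.castSucc_ne_last k (σ.injective (hk.trans h.symm))
  have hinj : Function.Injective fun k : Fin n => (σ k.castSucc).castPred (hne k) :=
    fun k l hkl => Fin.castSucc_injective n (σ.injective (Fin.castPred_inj.1 hkl))
  refine ⟨Equiv.ofBijective _ (Finite.injective_iff_bijective.1 hinj), Equiv.ext fun k => ?_⟩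
  refine Fin.lastCases ?_ (fun k => ?_) k
  · rw [inclusion_last, h]
  · rw [inclusion_castSucc, Equiv.ofBijective_apply, Fin.castSucc_castPred]

/-- Every permutation is the product of a permutation fixing the last letter and a transposition
that involves the last letter. -/
theorem exists_eq_inclusion_mul_swap {n : ℕ} (σ : Equiv.Perm (Fin (n + 1))) :
    ∃ (τ : Equiv.Perm (Fin n)) (i : Fin (n + 1)),
      σ = inclusion n τ * Equiv.swap i (Fin.last n) := by
  obtain ⟨τ, hτ⟩ := exists_inclusion (σ * Equiv.swap (σ⁻¹ (Fin.last n)) (Fin.last n))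
    (by simp)
  exact ⟨τ, σ⁻¹ (Fin.last n), by rw [hτ, mul_assoc, Equiv.swap_mul_self, mul_one]⟩

/-- Taking the coefficients at the tabloids with the last letter in row `r`. -/
def lastRow (n r : ℕ) : TabloidSpace (n + 1) →ₗ[ℂ] TabloidSpace n :=
  LinearMap.funLeft ℂ ℂ fun f : Fin n → ℕ => (Fin.snoc f r : Fin (n + 1) → ℕ)

theorem lastRow_apply (n r : ℕ) (u : TabloidSpace (n + 1)) (f : Fin n → ℕ) :
    lastRow n r u f = u (Fin.snoc f r : Fin (n + 1) → ℕ) := rfl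

theorem snoc_comp_inclusion {n : ℕ} (f : Fin n → ℕ) (r : ℕ) (σ : Equiv.Perm (Fin n)) :
    (Fin.snoc f r : Fin (n + 1) → ℕ) ∘ ⇑(inclusion n σ) =
      (Fin.snoc (f ∘ ⇑σ) r : Fin (n + 1) → ℕ) := by
  funext k
  refine Fin.lastCases ?_ (fun k => ?_) k
  · rw [Function.comp_apply, inclusion_last, Fin.snoc_last, Fin.snoc_last]
  · rw [Function.comp_apply, inclusion_castSucc, Fin.snoc_castSucc, Fin.snoc_castSucc,
      Function.comp_apply]

theorem lastRow_tabloidRep {n r : ℕ} (σ : Equiv.Perm (Fin n)) (u : TabloidSpace (n + 1)) :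
    lastRow n r (tabloidRep (n + 1) (inclusion n σ) u) = tabloidRep n σ (lastRow n r u) := by
  funext f
  rw [lastRow_apply, tabloidRep_apply, tabloidRep_apply, lastRow_apply, snoc_comp_inclusion]

/-- The extension of a tableau by the last letter in an added cell. -/
noncomputable def extend {n : ℕ} {mu : Shape n} {lam : Shape (n + 1)} (c : ℕ × ℕ)
    (hc : c ∈ lam.1.cells) (h : mu.1.cells = lam.1.cells.erase c) (s : Tableau mu) :
    Tableau lam := by
  classical
  exact Equiv.ofBijective
    (fun d => if hd : d.1 = c then Fin.last n
      else (s ⟨d.1, h.ge (Finset.mem_erase.2 ⟨hd, d.2⟩)⟩).castSucc) <| by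
    have hcard : Fintype.card {d // d ∈ lam.1.cells} = Fintype.card (Fin (n + 1)) := by
      rw [Fintype.card_coe, Fintype.card_fin]
      exact lam.2
    refine (Fintype.bijective_iff_surjective_and_card _).2 ⟨fun k => ?_, hcard⟩
    refine Fin.lastCases ?_ (fun k => ?_) k
    · exact ⟨⟨c, hc⟩, by simp⟩
    · have hk := Finset.mem_erase.1 (h.le (s.symm k).2)
      refine ⟨⟨(s.symm k).1, hk.2⟩, ?_⟩
      simp [hk.1]

section Extend

variable {n : ℕ} {mu : Shape n} {lam : Shape (n + 1)} {c : ℕ × ℕ} (hc : c ∈ lam.1.cells)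
  (h : mu.1.cells = lam.1.cells.erase c) (s : Tableau mu)

theorem extend_symm_last : ((extend c hc h s).symm (Fin.last n)).1 = c := by
  have : (extend c hc h s).symm (Fin.last n) = ⟨c, hc⟩ := by
    rw [Equiv.symm_apply_eq]
    simp [extend]
  rw [this]

theorem extend_symm_castSucc (k : Fin n) :
    ((extend c hc h s).symm k.castSucc).1 = (s.symm k).1 := by
  have hk := Finset.mem_erase.1 (h.le (s.symm k).2)
  have : (extend c hc h s).symm k.castSucc = ⟨(s.symm k).1, hk.2⟩ := by
    rw [Equiv.symm_apply_eq]
    simp [extend, hk.1]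
  rw [this]

theorem extend_row_last : (extend c hc h s).row (Fin.last n) = c.1 := by
  rw [Tableau.row, extend_symm_last]

theorem extend_row_castSucc (k : Fin n) : (extend c hc h s).row k.castSucc = s.row k := by
  rw [Tableau.row, extend_symm_castSucc]
  rfl

theorem extend_col_castSucc (k : Fin n) : (extend c hc h s).col k.castSucc = s.col k := by
  rw [Tableau.col, extend_symm_castSucc]
  rfl

theorem extend_trans (σ : Equiv.Perm (Fin n)) :
    ((extend c hc h s).trans (inclusion n σ) : Tableau lam) =
      extend c hc h (s.trans σ : Tableau mu) := by
  refine Equiv.symm_bijective.injective (Equiv.ext fun k => Subtype.ext ?_)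
  obtain ⟨k, rfl⟩ := (inclusion n σ).surjective k
  rw [Equiv.symm_trans_apply, Equiv.symm_apply_apply]
  refine Fin.lastCases ?_ (fun k => ?_) k
  · rw [inclusion_last, extend_symm_last, extend_symm_last]
  · rw [inclusion_castSucc, extend_symm_castSucc, extend_symm_castSucc, Equiv.symm_trans_apply,
      Equiv.symm_apply_apply]

/-- A column permutation contributes to tabloids with the last letter in the row of `c` only if it
fixes that letter, as a letter is determined by its row and column. The column permutations that fix
it are those of `s`. -/
theorem lastRow_extend : lastRow n c.1 (polytabloid (extend c hc h s)) = polytabloid s := by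
  classical
  funext f
  rw [lastRow_apply, Tableau.polytabloid_eq, Tableau.polytabloid_eq,
    Tableau.antisymmetrizer_apply, Tableau.antisymmetrizer_apply]
  symm
  refine Finset.sum_of_injOn (inclusion n) (fun σ _ τ _ hστ => ?_) (fun τ hτ => ?_)
    (fun σ hσ hne => ?_) fun τ _ => ?_
  · exact Equiv.Perm.viaEmbeddingHom_injective Fin.castSuccEmb hστ
  · rw [Finset.mem_coe, Tableau.mem_colStab] at hτ ⊢
    intro k
    refine Fin.lastCases ?_ (fun k => ?_) k
    · rw [inclusion_last]
    · rw [inclusion_castSucc, extend_col_castSucc, extend_col_castSucc, hτ]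
  · rw [Tableau.tabloid, Pi.single_eq_of_ne, mul_zero]
    intro heq
    apply hne
    have hlast : σ⁻¹ (Fin.last n) = Fin.last n := by
      refine (extend c hc h s).ext_letter ?_ ?_
      · rw [← heq, Function.comp_apply, ← Equiv.Perm.mul_apply, mul_inv_cancel,
          Equiv.Perm.one_apply, Fin.snoc_last, heq,
          extend_row_last]
      · exact Tableau.mem_colStab.1 (Tableau.inv_mem_colStab hσ) _
    obtain ⟨τ, rfl⟩ := exists_inclusion σ (by
      rw [Equiv.Perm.inv_eq_iff_eq] at hlast
      exact hlast.symm)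
    refine ⟨τ, Tableau.mem_colStab.2 fun k => ?_, rfl⟩
    have := Tableau.mem_colStab.1 hσ k.castSucc
    rwa [inclusion_castSucc, extend_col_castSucc, extend_col_castSucc] at this
  · rw [snoc_comp_inclusion, sgn, sgn, sign_inclusion]
    congr 1
    have : (Fin.snoc (f ∘ ⇑τ) c.1 : Fin (n + 1) → ℕ) = (extend c hc h s).row ↔
        f ∘ ⇑τ = s.row := by
      constructor
      · intro heq
        funext k
        have := congrFun heq k.castSucc
        rwa [Fin.snoc_castSucc, extend_row_castSucc] at this
      · intro heq
        funext k
        refine Fin.lastCases ?_ (fun k => ?_) k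
        · rw [Fin.snoc_last, extend_row_last]
        · rw [Fin.snoc_castSucc, extend_row_castSucc, heq]
    simp only [Tableau.tabloid, Pi.single_apply, this]

end Extend

/-- The restriction of a representation of `S_{n+1}` to `S_n`. -/
noncomputable abbrev spechtRes {n : ℕ} (lam : Shape (n + 1)) :
    Representation ℂ (Equiv.Perm (Fin n)) (Specht lam) :=
  (spechtRep lam).comp (inclusion n)

/-- `lastRow` sends the polytabloids of extended tableaux to those of shape `mu`, but need not map
the rest of the Specht module into `Specht mu`. It is therefore restricted to their span `U`,
extended arbitrarily, and averaged over the smaller group, which does not alter it on `U`. -/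
theorem exists_restriction_surjective {n : ℕ} {mu : Shape n} {lam : Shape (n + 1)}
    (hml : Precedes mu lam) : ∃ p : Specht lam →ₗ[ℂ] Specht mu,
      Intertwines (spechtRes lam) (spechtRep mu) p ∧ Function.Surjective p := by
  obtain ⟨c, hc, h⟩ := hml
  let U : Submodule ℂ (Specht lam) :=
    Submodule.span ℂ (Set.range fun s : Tableau mu => spechtPoly (extend c hc h s))
  have hmaps : ∀ u ∈ U, lastRow n c.1 u ∈ Specht mu := by
    intro u hu
    induction hu using Submodule.span_induction with
    | mem u hu =>
      obtain ⟨s, rfl⟩ := hu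
      exact (lastRow_extend hc h s).symm ▸ polytabloid_mem_specht s
    | zero => exact (map_zero (lastRow n c.1)).symm ▸ Submodule.zero_mem _
    | add x y _ _ hx hy =>
      rw [Submodule.coe_add, map_add]
      exact Submodule.add_mem _ hx hy
    | smul a x _ hx =>
      rw [Submodule.coe_smul, map_smul]
      exact Submodule.smul_mem _ _ hx
  have hinv : ∀ σ, ∀ u ∈ U, spechtRes lam σ u ∈ U := by
    intro σ u hu
    induction hu using Submodule.span_induction with
    | mem u hu =>
      obtain ⟨s, rfl⟩ := hu
      refine Submodule.subset_span ⟨(s.trans σ : Tableau mu), ?_⟩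
      exact (congrArg spechtPoly (extend_trans hc h s σ)).symm.trans
        (spechtRep_spechtPoly (inclusion n σ) _).symm
    | zero => rw [map_zero]; exact Submodule.zero_mem _
    | add x y _ _ hx hy => rw [map_add]; exact Submodule.add_mem _ hx hy
    | smul a x _ hx => rw [map_smul]; exact Submodule.smul_mem _ _ hx
  let q : U →ₗ[ℂ] Specht mu :=
    ((lastRow n c.1 ∘ₗ (Specht lam).subtype) ∘ₗ U.subtype).codRestrict (Specht mu)
      fun u => hmaps u u.2
  obtain ⟨f, hf⟩ := q.exists_extend
  have hfq : ∀ u (hu : u ∈ U), f u = q ⟨u, hu⟩ := fun u hu => LinearMap.congr_fun hf ⟨u, hu⟩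
  obtain ⟨p, hp, hpf⟩ := exists_intertwines_eqOn (spechtRes lam) (spechtRep mu) f U (by
    intro σ u hu
    rw [hfq u hu, hfq _ (hinv σ u hu)]
    exact Subtype.ext (lastRow_tabloidRep σ _))
  refine ⟨p, hp, ?_⟩
  rw [← LinearMap.range_eq_top, eq_top_iff, ← span_spechtPoly, Submodule.span_le]
  rintro _ ⟨s, rfl⟩
  have hs : spechtPoly (extend c hc h s) ∈ U := Submodule.subset_span ⟨s, rfl⟩
  refine ⟨spechtPoly (extend c hc h s), ?_⟩
  rw [hpf _ hs, hfq _ hs]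
  exact Subtype.ext (lastRow_extend hc h s)

theorem exists_restriction_embedding {n : ℕ} {mu : Shape n} {lam : Shape (n + 1)}
    (hml : Precedes mu lam) : ∃ j : Specht mu →ₗ[ℂ] Specht lam,
      Intertwines (spechtRep mu) (spechtRes lam) j ∧ j ≠ 0 := by
  obtain ⟨p, hp, hs⟩ := exists_restriction_surjective hml
  obtain ⟨j, hj, hpj⟩ := exists_intertwines_section (spechtRes lam) (spechtRep mu) p hp hs
  refine ⟨j, hj, fun h => ?_⟩
  obtain ⟨v, hv⟩ := exists_ne (0 : Specht mu)
  exact hv (by rw [← hpj v, h, LinearMap.zero_apply, map_zero])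

/-! ### Combinatorics of the branching graph -/

theorem precedes_iff {n : ℕ} {mu : Shape n} {lam : Shape (n + 1)} :
    Precedes mu lam ↔ mu.1.cells ⊆ lam.1.cells := by
  have h1 : mu.1.cells.card = n := mu.2
  have h2 : lam.1.cells.card = n + 1 := lam.2
  constructor
  · rintro ⟨c, _, h⟩
    exact h ▸ Finset.erase_subset _ _
  · intro h
    obtain ⟨c, hc⟩ := Finset.card_eq_one.1 (show (lam.1.cells \ mu.1.cells).card = 1 by
      rw [Finset.card_sdiff_of_subset h]; omega)
    have hcm : c ∈ lam.1.cells \ mu.1.cells := hc ▸ Finset.mem_singleton_self c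
    refine ⟨c, (Finset.mem_sdiff.1 hcm).1, ?_⟩
    rw [Finset.erase_eq, ← hc, Finset.sdiff_sdiff_eq_self h]

instance (n : ℕ) : Finite (Shape n) := by
  refine Finite.of_injective (β := (Finset.range n ×ˢ Finset.range n).powerset)
    (fun lam => ⟨lam.1.cells, ?_⟩) fun lam mu h => ?_
  · rw [Finset.mem_powerset]
    rintro ⟨i, j⟩ hc
    have hi : i < lam.1.colLen j := YoungDiagram.mem_iff_lt_colLen.1 hc
    have hj : j < lam.1.rowLen i := YoungDiagram.mem_iff_lt_rowLen.1 hc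
    have hn : lam.1.cells.card = n := lam.2
    rw [YoungDiagram.colLen_eq_card] at hi
    rw [YoungDiagram.rowLen_eq_card] at hj
    have hi' : (lam.1.col j).card ≤ lam.1.cells.card := Finset.card_filter_le _ _
    have hj' : (lam.1.row i).card ≤ lam.1.cells.card := Finset.card_filter_le _ _
    simp only [Finset.mem_product, Finset.mem_range]
    omega
  · exact Subtype.ext (YoungDiagram.ext (congrArg Subtype.val h))

noncomputable instance (n : ℕ) : Fintype (Shape n) := Fintype.ofFinite _

open Classical in
/-- The partitions obtained by adding a cell. -/
noncomputable def Shape.above {n : ℕ} (mu : Shape n) : Finset (Shape (n + 1)) :=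
  Finset.univ.filter fun lam => Precedes mu lam

open Classical in
/-- The partitions obtained by removing a cell. -/
noncomputable def Shape.below {n : ℕ} (lam : Shape (n + 1)) : Finset (Shape n) :=
  Finset.univ.filter fun mu => Precedes mu lam

theorem Shape.mem_above {n : ℕ} {mu : Shape n} {lam : Shape (n + 1)} :
    lam ∈ mu.above ↔ Precedes mu lam := by
  simp [above]

theorem Shape.mem_below {n : ℕ} {mu : Shape n} {lam : Shape (n + 1)} :
    mu ∈ lam.below ↔ Precedes mu lam := by
  simp [below]

theorem Shape.ext_cells {n : ℕ} {lam mu : Shape n} (h : lam.1.cells = mu.1.cells) : lam = mu :=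
  Subtype.ext (YoungDiagram.ext h)

/-- The rows from which a cell can be removed. -/
def Shape.removableRows {n : ℕ} (mu : Shape n) : Finset ℕ :=
  (Finset.range n).filter fun r => mu.1.rowLen (r + 1) < mu.1.rowLen r

theorem Shape.mem_removableRows {n : ℕ} {mu : Shape n} {r : ℕ} :
    r ∈ mu.removableRows ↔ mu.1.rowLen (r + 1) < mu.1.rowLen r := by
  rw [removableRows, Finset.mem_filter, and_iff_right_iff_imp]
  intro h
  have h0 : (r, 0) ∈ mu.1 := YoungDiagram.mem_iff_lt_rowLen.2 (by omega)
  have hr := YoungDiagram.mem_iff_lt_colLen.1 h0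
  rw [YoungDiagram.colLen_eq_card] at hr
  have : (mu.1.col 0).card ≤ mu.1.cells.card := Finset.card_filter_le _ _
  have hn : mu.1.cells.card = n := mu.2
  rw [Finset.mem_range]
  omega

theorem mem_cells_iff {d : YoungDiagram} {i j : ℕ} : (i, j) ∈ d.cells ↔ j < d.rowLen i := by
  rw [YoungDiagram.mem_cells, YoungDiagram.mem_iff_lt_rowLen]

theorem Shape.card_below {n : ℕ} (mu : Shape (n + 1)) :
    mu.below.card = mu.removableRows.card := by
  symm
  have hlow : ∀ r ∈ mu.removableRows,
      IsLowerSet (mu.1.cells.erase (r, mu.1.rowLen r - 1) : Set (ℕ × ℕ)) := by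
    rintro r hr ⟨i, j⟩ ⟨i', j'⟩ hle hmem
    rw [mem_removableRows] at hr
    obtain ⟨hi, hj⟩ : i' ≤ i ∧ j' ≤ j := hle
    simp only [Finset.mem_coe, Finset.mem_erase, mem_cells_iff, ne_eq, Prod.mk.injEq] at hmem ⊢
    have h1 := mu.1.rowLen_anti i' i hi
    refine ⟨?_, by omega⟩
    rintro ⟨rfl, rfl⟩
    rcases eq_or_lt_of_le hi with rfl | hi
    · omega
    · have := mu.1.rowLen_anti (i' + 1) i hi
      omega
  have hmem : ∀ r ∈ mu.removableRows, (r, mu.1.rowLen r - 1) ∈ mu.1.cells := fun r hr => by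
    rw [mem_removableRows] at hr
    rw [mem_cells_iff]
    omega
  have hn : mu.1.cells.card = n + 1 := mu.2
  refine Finset.card_bij (fun r hr => ⟨⟨mu.1.cells.erase (r, mu.1.rowLen r - 1), hlow r hr⟩, ?_⟩)
    (fun r hr => ?_) (fun r hr r' hr' h => ?_) fun rho hrho => ?_
  · rw [YoungDiagram.card, Finset.card_erase_of_mem (hmem r hr)]
    omega
  · exact mem_below.2 ⟨_, hmem r hr, rfl⟩
  · have h : mu.1.cells.erase (r, mu.1.rowLen r - 1) = mu.1.cells.erase (r', mu.1.rowLen r' - 1) :=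
      congrArg (fun nu : Shape n => nu.1.cells) h
    have := (Finset.erase_inj _ (hmem r hr)).1 h
    exact congrArg Prod.fst this
  · obtain ⟨⟨r, j⟩, hc, hcells⟩ := mem_below.1 hrho
    have hnot : (r, j) ∉ rho.1.cells := by rw [hcells]; exact Finset.notMem_erase _ _
    have hup : ∀ c : ℕ × ℕ, c ∈ mu.1.cells → (r, j) ≤ c → c = (r, j) := fun c hcm hle => by
      by_contra hne
      exact hnot (rho.1.isLowerSet hle (Finset.mem_coe.2 (hcells ▸ Finset.mem_erase.2 ⟨hne, hcm⟩)))
    have hj : j < mu.1.rowLen r := mem_cells_iff.1 hc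
    have h1 : ¬ j + 1 < mu.1.rowLen r := fun h => by
      have := hup (r, j + 1) (mem_cells_iff.2 h) ⟨le_rfl, Nat.le_succ j⟩
      simp at this
    have h2 : ¬ j < mu.1.rowLen (r + 1) := fun h => by
      have := hup (r + 1, j) (mem_cells_iff.2 h) ⟨Nat.le_succ r, le_rfl⟩
      simp at this
    refine ⟨r, mem_removableRows.2 (by omega), ext_cells ?_⟩
    show mu.1.cells.erase (r, mu.1.rowLen r - 1) = rho.1.cells
    rw [hcells, show mu.1.rowLen r - 1 = j by omega]

/-- A cell can be added to row 0 and to each row immediately below a removable one. The extra 1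
becomes the constant in the commutation relation. -/
theorem Shape.card_above {n : ℕ} (mu : Shape n) :
    mu.above.card = 1 + mu.removableRows.card := by
  have hcard : 1 + mu.removableRows.card =
      (insert 0 (mu.removableRows.image Nat.succ)).card := by
    rw [Finset.card_insert_of_notMem (by simp), Finset.card_image_of_injective _
      Nat.succ_injective, add_comm]
  have hA : ∀ r, r ∈ insert 0 (mu.removableRows.image Nat.succ) ↔
      ∀ i < r, mu.1.rowLen r < mu.1.rowLen i := by
    intro r
    rcases r with _ | r
    · simp
    · simp only [Finset.mem_insert, Nat.succ_ne_zero, Finset.mem_image, Nat.succ_inj,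
        exists_eq_right, mem_removableRows, false_or]
      constructor
      · intro h i hi
        exact h.trans_le (mu.1.rowLen_anti i r (by omega))
      · intro h
        exact h r (Nat.lt_succ_self r)
  rw [hcard]
  symm
  have hlow : ∀ r ∈ insert 0 (mu.removableRows.image Nat.succ),
      IsLowerSet ((insert (r, mu.1.rowLen r) mu.1.cells : Finset (ℕ × ℕ)) : Set (ℕ × ℕ)) := by
    rintro r hr ⟨i, j⟩ ⟨i', j'⟩ hle hmem
    rw [hA] at hr
    obtain ⟨hi, hj⟩ : i' ≤ i ∧ j' ≤ j := hle
    simp only [Finset.mem_coe, Finset.mem_insert, mem_cells_iff, Prod.mk.injEq] at hmem ⊢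
    have h1 := mu.1.rowLen_anti i' i hi
    rcases hmem with ⟨rfl, rfl⟩ | hmem
    · rcases eq_or_lt_of_le hi with rfl | hi
      · omega
      · have := hr i' hi
        omega
    · omega
  have hnot : ∀ r, (r, mu.1.rowLen r) ∉ mu.1.cells := fun r => by
    rw [mem_cells_iff]
    exact lt_irrefl _
  have hn : mu.1.cells.card = n := mu.2
  refine Finset.card_bij (fun r hr => ⟨⟨insert (r, mu.1.rowLen r) mu.1.cells, hlow r hr⟩, ?_⟩)
    (fun r hr => ?_) (fun r hr r' hr' h => ?_) fun lam hlam => ?_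
  · rw [YoungDiagram.card, Finset.card_insert_of_notMem (hnot r), hn]
  · exact mem_above.2 (precedes_iff.2 (Finset.subset_insert _ _))
  · have h : insert (r, mu.1.rowLen r) mu.1.cells = insert (r', mu.1.rowLen r') mu.1.cells :=
      congrArg (fun nu : Shape (n + 1) => nu.1.cells) h
    have := (Finset.insert_inj (hnot r)).1 h
    exact congrArg Prod.fst this
  · obtain ⟨⟨r, j⟩, hc, hcells⟩ := mem_above.1 hlam
    have hdown : ∀ c : ℕ × ℕ, c ≤ (r, j) → c ≠ (r, j) → c ∈ mu.1.cells := fun c hle hne => by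
      rw [hcells]
      exact Finset.mem_erase.2 ⟨hne, Finset.mem_coe.1 (lam.1.isLowerSet hle (Finset.mem_coe.2 hc))⟩
    have h1 : ¬ j < mu.1.rowLen r := fun h => by
      have := mem_cells_iff.2 h
      rw [hcells] at this
      exact Finset.notMem_erase _ _ this
    have h2 : ¬ mu.1.rowLen r < j := fun h => by
      have := mem_cells_iff.1 (hdown (r, mu.1.rowLen r) ⟨le_rfl, h.le⟩ (by simp [h.ne]))
      exact lt_irrefl _ this
    have hj : j = mu.1.rowLen r := by omega
    subst hj
    refine ⟨r, (hA r).2 fun i hi => ?_, ext_cells ?_⟩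
    · exact mem_cells_iff.1 (hdown (i, mu.1.rowLen r) ⟨hi.le, le_rfl⟩ (by simp [hi.ne]))
    · show insert (r, mu.1.rowLen r) mu.1.cells = lam.1.cells
      exact (congrArg _ hcells).trans (Finset.insert_erase hc)

/-- A partition is determined by two distinct partitions below it. -/
theorem cells_eq_union {n : ℕ} {mu kap : Shape n} {lam : Shape (n + 1)} (hne : mu ≠ kap)
    (h1 : Precedes mu lam) (h2 : Precedes kap lam) :
    lam.1.cells = mu.1.cells ∪ kap.1.cells := by
  rw [precedes_iff] at h1 h2
  have hm : mu.1.cells.card = n := mu.2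
  have hk : kap.1.cells.card = n := kap.2
  have hl : lam.1.cells.card = n + 1 := lam.2
  have hlt : mu.1.cells.card < (mu.1.cells ∪ kap.1.cells).card :=
    Finset.card_lt_card (Finset.ssubset_iff_subset_ne.2 ⟨Finset.subset_union_left, fun h =>
      hne (Shape.ext_cells (Finset.eq_of_subset_of_card_le
        (h ▸ Finset.subset_union_right) (hm.le.trans hk.ge)).symm)⟩)
  exact (Finset.eq_of_subset_of_card_le (Finset.union_subset h1 h2) (by omega)).symm

open Classical in
-- A common upper neighbour must be the union and a common lower neighbour the intersection. By
-- inclusion-exclusion the union has one cell too many exactly when the intersection has one too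
-- few, so both counts are 1 or both are 0.
theorem Shape.card_above_inter {n : ℕ} {mu kap : Shape (n + 1)} (hne : kap ≠ mu) :
    (mu.above ∩ kap.above).card = (mu.below ∩ kap.below).card := by
  have h1 : mu.1.cells.card = n + 1 := mu.2
  have h2 : kap.1.cells.card = n + 1 := kap.2
  have hui := Finset.card_union_add_card_inter mu.1.cells kap.1.cells
  have hlt : (mu.1.cells ∩ kap.1.cells).card < n + 1 := by
    refine lt_of_lt_of_eq ?_ h2
    refine Finset.card_lt_card (Finset.ssubset_iff_subset_ne.2 ⟨Finset.inter_subset_right,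
      fun h => hne (ext_cells (Finset.eq_of_subset_of_card_le ?_ (h1.le.trans h2.ge)))⟩)
    rw [← h]
    exact Finset.inter_subset_left
  have hsup : ∀ lam ∈ mu.above ∩ kap.above, lam.1.cells = mu.1.cells ∪ kap.1.cells := by
    intro lam hlam
    rw [Finset.mem_inter, mem_above, mem_above] at hlam
    exact cells_eq_union hne.symm hlam.1 hlam.2
  have hinf : ∀ rho ∈ mu.below ∩ kap.below, rho.1.cells = mu.1.cells ∩ kap.1.cells := by
    intro rho hrho
    rw [Finset.mem_inter, mem_below, mem_below, precedes_iff, precedes_iff] at hrho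
    have h3 : rho.1.cells.card = n := rho.2
    exact Finset.eq_of_subset_of_card_le (Finset.subset_inter hrho.1 hrho.2) (by omega)
  refine Finset.card_bij (fun lam hlam => ⟨mu.1 ⊓ kap.1, ?_⟩) (fun lam hlam => ?_)
    (fun lam hlam lam' hlam' _ => ?_) fun rho hrho => ?_
  · have h3 : lam.1.cells.card = n + 1 + 1 := lam.2
    rw [hsup lam hlam] at h3
    rw [YoungDiagram.card, YoungDiagram.cells_inf]
    omega
  · rw [Finset.mem_inter, mem_below, mem_below, precedes_iff, precedes_iff]
    exact ⟨Finset.inter_subset_left, Finset.inter_subset_right⟩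
  · exact ext_cells ((hsup lam hlam).trans (hsup lam' hlam').symm)
  · have h3 : rho.1.cells.card = n := rho.2
    rw [hinf rho hrho] at h3
    refine ⟨⟨mu.1 ⊔ kap.1, ?_⟩, ?_, ext_cells (hinf rho hrho).symm⟩
    · rw [YoungDiagram.card, YoungDiagram.cells_sup]
      omega
    · rw [Finset.mem_inter, mem_above, mem_above, precedes_iff, precedes_iff]
      exact ⟨Finset.subset_union_left, Finset.subset_union_right⟩

/-- The commutation relation between adding and removing cells. -/
theorem Shape.sum_above_sum_below {n : ℕ} (mu : Shape (n + 1)) (d : Shape (n + 1) → ℕ) :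
    ∑ lam ∈ mu.above, ∑ kap ∈ lam.below, d kap =
      d mu + ∑ rho ∈ mu.below, ∑ kap ∈ rho.above, d kap := by
  classical
  have hl : ∑ lam ∈ mu.above, ∑ kap ∈ lam.below, d kap =
      ∑ kap, ∑ _lam ∈ mu.above ∩ kap.above, d kap :=
    Finset.sum_comm' fun lam kap => by simp [mem_above, mem_below]
  have hr : ∑ rho ∈ mu.below, ∑ kap ∈ rho.above, d kap =
      ∑ kap, ∑ _rho ∈ mu.below ∩ kap.below, d kap :=
    Finset.sum_comm' fun lam kap => by simp [mem_above, mem_below]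
  rw [hl, hr, ← Finset.add_sum_erase _ _ (Finset.mem_univ mu),
    ← Finset.add_sum_erase Finset.univ (fun kap => ∑ _rho ∈ mu.below ∩ kap.below, d kap)
      (Finset.mem_univ mu), ← add_assoc]
  congr 1
  -- The diagonal term: one more cell can be added to `mu` than removed from it.
  · simp only [Finset.inter_self, Finset.sum_const, card_above, card_below, smul_eq_mul]
    ring
  · refine Finset.sum_congr rfl fun kap hkap => ?_
    rw [Finset.sum_const, Finset.sum_const, card_above_inter (Finset.mem_erase.1 hkap).1]

theorem Shape.exists_above {n : ℕ} (mu : Shape n) : ∃ lam, Precedes mu lam := by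
  have : mu.above.Nonempty := by
    rw [← Finset.card_pos, card_above]
    omega
  obtain ⟨lam, h⟩ := this
  exact ⟨lam, mem_above.1 h⟩

theorem Shape.exists_below {n : ℕ} (lam : Shape (n + 1)) : ∃ mu, Precedes mu lam := by
  have hn : lam.1.cells.card = n + 1 := lam.2
  obtain ⟨c, hc⟩ := lam.1.cells.exists_maximal (Finset.card_pos.1 (by omega))
  refine ⟨⟨⟨lam.1.cells.erase c, ?_⟩, ?_⟩, c, hc.1, rfl⟩
  · intro d e hle hd
    rw [Finset.mem_coe, Finset.mem_erase] at hd ⊢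
    refine ⟨?_, Finset.mem_coe.1 (lam.1.isLowerSet hle (Finset.mem_coe.2 hd.2))⟩
    rintro rfl
    exact hd.1 (le_antisymm (hc.2 hd.2 hle) hle)
  · rw [YoungDiagram.card, Finset.card_erase_of_mem hc.1]
    omega

/-! ### The branching rule -/

section Branching

variable {n : ℕ}

/-- The sum of a family of maps from the Specht modules below `lam`. -/
noncomputable def sumBelow (lam : Shape (n + 1))
    (j : ∀ mu : {mu // Precedes mu lam}, Specht mu.1 →ₗ[ℂ] Specht lam) :
    (∀ mu : {mu // Precedes mu lam}, Specht mu.1) →ₗ[ℂ] Specht lam :=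
  haveI : Fintype {mu // Precedes mu lam} := Fintype.ofFinite _
  ∑ mu, j mu ∘ₗ LinearMap.proj mu

theorem sumBelow_apply {lam : Shape (n + 1)} [Fintype {mu : Shape n // Precedes mu lam}]
    (j : ∀ mu : {mu // Precedes mu lam}, Specht mu.1 →ₗ[ℂ] Specht lam)
    (v : ∀ mu : {mu // Precedes mu lam}, Specht mu.1) :
    sumBelow lam j v = ∑ mu, j mu (v mu) := by
  rw [sumBelow, LinearMap.sum_apply]
  exact Finset.sum_congr (Finset.ext fun _ => by simp) fun _ _ => rfl

theorem sumBelow_injective {lam : Shape (n + 1)}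
    (j : ∀ mu : {mu // Precedes mu lam}, Specht mu.1 →ₗ[ℂ] Specht lam)
    (hj : ∀ mu : {mu // Precedes mu lam}, Intertwines (spechtRep mu.1) (spechtRes lam) (j mu))
    (h0 : ∀ mu, j mu ≠ 0) :
    Function.Injective (sumBelow lam j) := by
  have : Fintype {mu // Precedes mu lam} := Fintype.ofFinite _
  rw [injective_iff_map_eq_zero]
  intro v hv
  rw [sumBelow_apply] at hv
  funext mu
  exact jointly_injective (fun mu : {mu // Precedes mu lam} => ⇑(spechtRep mu.1))
    (fun mu => irreducible_specht mu.1) (spechtRes lam) j hj h0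
    (fun mu nu h => not_intertwines_of_ne fun h' => h (Subtype.ext h')) Finset.univ v hv mu
    (Finset.mem_univ mu)

/-- The dimension of a Specht module. -/
noncomputable def Shape.dim (lam : Shape n) : ℕ := Module.finrank ℂ (Specht lam)

theorem finrank_pi_below (lam : Shape (n + 1)) :
    Module.finrank ℂ (∀ mu : {mu // Precedes mu lam}, Specht mu.1) = ∑ mu ∈ lam.below, mu.dim := by
  have : Fintype {mu // Precedes mu lam} := Fintype.ofFinite _
  rw [Module.finrank_pi_fintype]
  exact (Finset.sum_subtype lam.below (fun mu => Shape.mem_below) Shape.dim).symm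

theorem sum_below_dim_le (lam : Shape (n + 1)) : ∑ mu ∈ lam.below, mu.dim ≤ lam.dim := by
  choose j hj h0 using fun mu : {mu // Precedes mu lam} => exists_restriction_embedding mu.2
  rw [← finrank_pi_below]
  exact LinearMap.finrank_le_finrank_of_injective (sumBelow_injective j hj h0)

/-- Frobenius reciprocity: each `Specht lam` above `mu` embeds in the module induced from `Specht
mu`, of dimension `(n + 1) * mu.dim`. Pairwise nonisomorphic irreducibles embed jointly. -/
theorem sum_above_dim_le (mu : Shape n) : ∑ lam ∈ mu.above, lam.dim ≤ (n + 1) * mu.dim := by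
  have : Fintype {lam // Precedes mu lam} := Fintype.ofFinite _
  choose p hp hs using fun lam : {lam // Precedes mu lam} => exists_restriction_surjective lam.2
  let b : Equiv.Perm (Fin (n + 1)) → Module.End ℂ (Equiv.Perm (Fin (n + 1)) → Specht mu) :=
    fun h => LinearMap.funLeft ℂ _ fun g => g * h
  let f : ∀ lam : {lam // Precedes mu lam},
      Specht lam.1 →ₗ[ℂ] (Equiv.Perm (Fin (n + 1)) → Specht mu) :=
    fun lam => LinearMap.pi fun g => p lam ∘ₗ spechtRep lam.1 g
  have hf : ∀ lam : {lam // Precedes mu lam},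
      Intertwines (spechtRep lam.1) b (f lam) := fun lam h v => by
    funext g
    show p lam (spechtRep lam.1 g (spechtRep lam.1 h v)) = p lam (spechtRep lam.1 (g * h) v)
    rw [map_mul]
    rfl
  have hf0 : ∀ lam, f lam ≠ 0 := fun lam h => by
    obtain ⟨v, hv⟩ := exists_ne (0 : Specht mu)
    obtain ⟨w, rfl⟩ := hs lam v
    have := congrFun (LinearMap.congr_fun h w) 1
    simp only [f, LinearMap.pi_apply, LinearMap.comp_apply, map_one, Module.End.one_apply] at this
    exact hv this
  -- By equivariance under the subgroup, the functions `f lam v` are determined by their values at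
  -- the coset representatives `swap i last`, so recording only these values remains injective.
  let E : (∀ lam : {lam // Precedes mu lam}, Specht lam.1) →ₗ[ℂ] (Fin (n + 1) → Specht mu) :=
    LinearMap.pi fun i => ∑ lam : {lam // Precedes mu lam},
      (p lam ∘ₗ spechtRep lam.1 (Equiv.swap i (Fin.last n))) ∘ₗ LinearMap.proj lam
  have hE : Function.Injective E := by
    rw [injective_iff_map_eq_zero]
    intro v hv
    have hsum : ∑ lam, f lam (v lam) = 0 := by
      funext g
      obtain ⟨τ, i, rfl⟩ := exists_eq_inclusion_mul_swap g
      have hi := congrFun hv i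
      simp only [E, LinearMap.pi_apply, LinearMap.sum_apply, LinearMap.comp_apply,
        LinearMap.proj_apply, Pi.zero_apply] at hi
      rw [Finset.sum_apply]
      refine Eq.trans ?_ ((congrArg (spechtRep mu τ) hi).trans (map_zero _))
      rw [map_sum]
      refine Finset.sum_congr rfl fun lam _ => ?_
      rw [← hp]
      show p lam (spechtRep lam.1 (inclusion n τ * _) (v lam)) = _
      rw [map_mul]
      rfl
    funext lam
    exact jointly_injective (fun lam : {lam // Precedes mu lam} => ⇑(spechtRep lam.1))
      (fun lam => irreducible_specht lam.1) b f hf hf0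
      (fun mu nu h => not_intertwines_of_ne fun h' => h (Subtype.ext h')) Finset.univ v hsum lam
      (Finset.mem_univ lam)
  have := LinearMap.finrank_le_finrank_of_injective hE
  rw [Module.finrank_pi_fintype, Module.finrank_pi_fintype, Finset.sum_const, Finset.card_univ,
    Fintype.card_fin, smul_eq_mul] at this
  refine le_trans (le_of_eq ?_) this
  exact Finset.sum_subtype mu.above (fun lam => Shape.mem_above) Shape.dim

/-- The hypothesis and the two dimension bounds close up into a cycle of inequalities, so all are
equalities, also term by term. Every `lam` occurs in such a sum, because it has some `mu` below it.
-/
theorem sum_dim_of_le (h : ∀ mu : Shape n, (n + 1) * mu.dim ≤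
    ∑ lam ∈ mu.above, ∑ kap ∈ lam.below, kap.dim) :
    (∀ mu : Shape n, ∑ lam ∈ mu.above, lam.dim = (n + 1) * mu.dim) ∧
      ∀ lam : Shape (n + 1), ∑ mu ∈ lam.below, mu.dim = lam.dim := by
  have h1 : ∀ mu : Shape n, ∑ lam ∈ mu.above, ∑ kap ∈ lam.below, kap.dim ≤
      ∑ lam ∈ mu.above, lam.dim := fun mu =>
    Finset.sum_le_sum fun lam _ => sum_below_dim_le lam
  refine ⟨fun mu => le_antisymm (sum_above_dim_le mu) ((h mu).trans (h1 mu)), fun lam => ?_⟩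
  obtain ⟨mu, hmu⟩ := lam.exists_below
  exact (Finset.sum_eq_sum_iff_of_le fun lam _ => sum_below_dim_le lam).1
    (le_antisymm (h1 mu) ((sum_above_dim_le mu).trans (h mu))) lam (Shape.mem_above.2 hmu)

theorem sum_dim (n : ℕ) : (∀ mu : Shape n, ∑ lam ∈ mu.above, lam.dim = (n + 1) * mu.dim) ∧
    ∀ lam : Shape (n + 1), ∑ mu ∈ lam.below, mu.dim = lam.dim := by
  induction n with
  | zero =>
    refine sum_dim_of_le fun mu => ?_
    -- For `n = 0` the single path from `mu` up to `lam` and back to `mu` already supplies the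
    -- required term.
    obtain ⟨lam, hlam⟩ := mu.exists_above
    refine (le_of_eq (by ring)).trans ((Finset.single_le_sum (f := Shape.dim)
      (fun _ _ => Nat.zero_le _) (Shape.mem_below.2 hlam)).trans ?_)
    exact Finset.single_le_sum (f := fun lam : Shape 1 => ∑ kap ∈ lam.below, kap.dim)
      (fun _ _ => Nat.zero_le _) (Shape.mem_above.2 hlam)
  | succ n ih =>
    refine sum_dim_of_le fun mu => ?_
    -- By commutation and both halves of the induction hypothesis, the double sum equals `mu.dim +
    -- (n + 1) * mu.dim`.
    rw [Shape.sum_above_sum_below, Finset.sum_congr rfl fun rho _ => ih.1 rho, ← Finset.mul_sum,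
      ih.2 mu]
    exact le_of_eq (by ring)

theorem sumBelow_bijective {lam : Shape (n + 1)}
    (j : ∀ mu : {mu // Precedes mu lam}, Specht mu.1 →ₗ[ℂ] Specht lam)
    (hj : ∀ mu : {mu // Precedes mu lam}, Intertwines (spechtRep mu.1) (spechtRes lam) (j mu))
    (h0 : ∀ mu, j mu ≠ 0) :
    Function.Bijective (sumBelow lam j) := by
  have hi := sumBelow_injective j hj h0
  refine ⟨hi, (LinearMap.injective_iff_surjective_of_finrank_eq_finrank ?_).1 hi⟩
  rw [finrank_pi_below]
  exact (sum_dim n).2 lam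

/-- A Specht module is spanned by copies of the Specht modules below it. -/
theorem eq_top_of_range_le {lam : Shape (n + 1)} (U : Submodule ℂ (Specht lam))
    (hU : ∀ mu, Precedes mu lam → ∃ j : Specht mu →ₗ[ℂ] Specht lam,
      Intertwines (spechtRep mu) (spechtRes lam) j ∧ j ≠ 0 ∧ ∀ v, j v ∈ U) : U = ⊤ := by
  have : Fintype {mu // Precedes mu lam} := Fintype.ofFinite _
  choose j hj h0 hjU using fun mu : {mu // Precedes mu lam} => hU mu.1 mu.2
  rw [eq_top_iff]
  intro x _
  obtain ⟨v, rfl⟩ := (sumBelow_bijective j hj h0).2 x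
  rw [sumBelow_apply]
  exact Submodule.sum_mem _ fun mu _ => hjU mu _

/-- The restriction of a Specht module is multiplicity-free. -/
theorem exists_smul_eq {mu : Shape n} {lam : Shape (n + 1)} (hml : Precedes mu lam)
    {j f : Specht mu →ₗ[ℂ] Specht lam} (hj : Intertwines (spechtRep mu) (spechtRes lam) j)
    (h0 : j ≠ 0) (hf : Intertwines (spechtRep mu) (spechtRes lam) f) :
    ∃ c : ℂ, ∀ v, f v = c • j v := by
  classical
  have : Fintype {mu // Precedes mu lam} := Fintype.ofFinite _
  choose k hk hk0 using fun mu : {mu // Precedes mu lam} => exists_restriction_embedding mu.2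
  let E := LinearEquiv.ofBijective _ (sumBelow_bijective k hk hk0)
  have hE : ∀ v, E v = ∑ nu, k nu (v nu) := fun v => sumBelow_apply k v
  -- In the decomposition given by `k`, every component of `g` other than the one at `mu` vanishes,
  -- and that one is a scalar. Thus `j` and `f` are multiples of the same embedding.
  have key : ∀ g : Specht mu →ₗ[ℂ] Specht lam, Intertwines (spechtRep mu) (spechtRes lam) g →
      ∃ c : ℂ, ∀ v, g v = c • k ⟨mu, hml⟩ v := by
    intro g hg
    let q : ∀ nu : {mu // Precedes mu lam}, Specht mu →ₗ[ℂ] Specht nu.1 := fun nu =>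
      LinearMap.proj nu ∘ₗ E.symm.toLinearMap ∘ₗ g
    have hsum : ∀ v, g v = ∑ nu, k nu (q nu v) := fun v => by
      rw [← E.apply_symm_apply (g v), hE]
      rfl
    have hq : ∀ nu : {mu // Precedes mu lam},
      Intertwines (spechtRep mu) (spechtRep nu.1) (q nu) := fun nu σ v => by
      have : E.symm (g (spechtRep mu σ v)) = fun nu => spechtRep nu.1 σ (q nu v) := by
        rw [LinearEquiv.symm_apply_eq, hE, hg, hsum, map_sum]
        exact Finset.sum_congr rfl fun nu _ => (hk nu σ _).symm
      exact congrFun this nu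
    obtain ⟨c, hc⟩ := exists_scalar (hq ⟨mu, hml⟩)
    refine ⟨c, fun v => ?_⟩
    rw [hsum, Finset.sum_eq_single ⟨mu, hml⟩, hc, map_smul]
    · intro nu _ hne
      have : q nu = 0 := by
        by_contra h
        exact hne (Subtype.ext (eq_of_intertwines (hq nu) h).symm)
      rw [this, LinearMap.zero_apply, map_zero]
    · exact fun h => (h (Finset.mem_univ _)).elim
  obtain ⟨c, hc⟩ := key j hj
  obtain ⟨d, hd⟩ := key f hf
  have hc0 : c ≠ 0 := by
    rintro rfl
    exact h0 (LinearMap.ext fun v => by rw [hc, zero_smul, LinearMap.zero_apply])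
  exact ⟨d * c⁻¹, fun v => by rw [hc, hd, smul_smul, inv_mul_cancel_right₀ hc0]⟩

end Branching

/-! ### Existence of associators -/

/-- The linear map `T` is equivariant up to the sign character. -/
def Twisted {n : ℕ} {lam kap : Shape n} (T : Specht lam →ₗ[ℂ] Specht kap) : Prop :=
  ∀ σ v, T (spechtRep lam σ v) = sgn σ • spechtRep kap σ (T v)

theorem Twisted.comp {n : ℕ} {lam kap nu : Shape n} {T : Specht lam →ₗ[ℂ] Specht kap}
    {S : Specht kap →ₗ[ℂ] Specht nu} (hS : Twisted S) (hT : Twisted T) :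
    Intertwines (spechtRep lam) (spechtRep nu) (S ∘ₗ T) := fun σ v => by
  rw [LinearMap.comp_apply, hT, map_smul, hS, smul_smul, sgn_mul_self, one_smul,
    LinearMap.comp_apply]

theorem Twisted.injective {n : ℕ} {lam kap : Shape n} {T : Specht lam →ₗ[ℂ] Specht kap}
    (hT : Twisted T) (h0 : T ≠ 0) : Function.Injective T := by
  rw [← LinearMap.ker_eq_bot]
  refine ((irreducible_specht lam).2 (LinearMap.ker T) fun σ v hv => ?_).resolve_right fun h => ?_
  · rw [LinearMap.mem_ker] at hv ⊢
    rw [hT, hv, map_zero, smul_zero]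
  · exact h0 (LinearMap.ker_eq_top.1 h)

/-! ### Conjugation of shapes as the sign twist of Specht modules -/

section Conjugate

variable {n : ℕ} {lam : Shape n}

theorem Shape.swap_mem_conj {c : ℕ × ℕ} : c.swap ∈ lam.conj.1.cells ↔ c ∈ lam.1.cells := by
  show c.swap ∈ lam.1.transpose ↔ c ∈ lam.1
  rw [YoungDiagram.mem_transpose, Prod.swap_swap]

/-- The conjugate tableau. -/
def Tableau.conj (t : Tableau lam) : Tableau lam.conj :=
  (((Equiv.prodComm ℕ ℕ).subtypeEquiv fun _ => Shape.swap_mem_conj.symm).symm).trans t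

theorem Tableau.conj_trans (t : Tableau lam) (σ : Equiv.Perm (Fin n)) :
    Tableau.conj (t.trans σ : Tableau lam) = (t.conj.trans σ : Tableau lam.conj) := rfl

/-- The sign of the permutation that carries `t` to `s`. -/
noncomputable def Tableau.relSign (t s : Tableau lam) : ℂ := sgn (t.symm.trans s)

theorem Tableau.relSign_trans (t s : Tableau lam) (σ : Equiv.Perm (Fin n)) :
    t.relSign (s.trans σ : Tableau lam) = sgn σ * t.relSign s := by
  rw [relSign, relSign, ← sgn_mul]
  rfl

/-- The map `{s} ↦ ± e_{s'}` from tabloids to polytabloids of the conjugate shape, up to a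
scalar factor. -/
noncomputable def conjMap (t : Tableau lam) : TabloidSpace n →ₗ[ℂ] Specht lam.conj :=
  ∑ s : Tableau lam, t.relSign s •
    (LinearMap.proj (R := ℂ) (φ := fun _ : Fin n → ℕ => ℂ) s.row).smulRight (spechtPoly s.conj)

theorem conjMap_apply (t : Tableau lam) (u : TabloidSpace n) :
    conjMap t u = ∑ s : Tableau lam, t.relSign s • u s.row • spechtPoly s.conj := by
  simp [conjMap, LinearMap.sum_apply]

theorem conjMap_tabloidRep (t : Tableau lam) (σ : Equiv.Perm (Fin n)) (u : TabloidSpace n) :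
    conjMap t (tabloidRep n σ u) = sgn σ • spechtRep lam.conj σ (conjMap t u) := by
  rw [conjMap_apply, conjMap_apply, map_sum, Finset.smul_sum]
  symm
  refine Fintype.sum_equiv (Equiv.equivCongr (Equiv.refl _) σ) _ _ fun s => ?_
  have hs : Equiv.equivCongr (Equiv.refl _) σ s = (s.trans σ : Tableau lam) := by
    ext
    simp
  rw [hs, Tableau.relSign_trans, map_smul, map_smul, spechtRep_spechtPoly, Tableau.conj_trans,
    smul_smul, tabloidRep_apply, Tableau.row_trans]
  congr 3
  funext k
  simp

theorem polytabloid_apply (t : Tableau lam) (f : Fin n → ℕ) :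
    polytabloid t f = ∑ σ ∈ t.colStab, sgn σ * if f ∘ ⇑σ = t.row then 1 else 0 := by
  rw [Tableau.polytabloid_eq, Tableau.antisymmetrizer_apply]
  refine Finset.sum_congr rfl fun σ _ => ?_
  rw [Tableau.tabloid, Pi.single_apply]

/-- `σ` matches the rows of the two tableaux and keeps the columns of `t`, while `τ` matches the
columns and keeps the rows of `s`; rows and columns together locate each letter. It follows that the
relative sign is the product of the signs of `σ` and `τ`. -/
theorem symm_trans_eq (t s : Tableau lam) {σ τ : Equiv.Perm (Fin n)} (hσ : σ ∈ t.colStab)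
    (hτ : τ ∈ s.conj.colStab) (h1 : s.row ∘ ⇑σ = t.row) (h2 : t.col ∘ ⇑τ = s.conj.row) :
    (t.symm.trans s : Equiv.Perm (Fin n)) = τ⁻¹ * σ := by
  refine Equiv.ext fun k => s.ext_letter ?_ ?_
  · calc s.row (s (t.symm k)) = t.row k := s.row_apply _
      _ = s.row (σ k) := (congrFun h1 k).symm
      _ = s.row (τ⁻¹ (σ k)) :=
        (Tableau.mem_colStab.1 (Tableau.inv_mem_colStab hτ) (σ k)).symm
  · calc s.col (s (t.symm k)) = t.col k := s.col_apply _
      _ = t.col (σ k) := (Tableau.mem_colStab.1 hσ k).symm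
      _ = t.col (τ (τ⁻¹ (σ k))) := by rw [← Equiv.Perm.mul_apply τ, mul_inv_cancel]; rfl
      _ = s.col (τ⁻¹ (σ k)) := congrFun h2 _

/-- In the coefficient at the tabloid of the conjugate of `t` all signs cancel. It counts triples
`(s, σ, τ)`, and `(t, 1, 1)` is one of them. -/
theorem conjMap_spechtPoly_ne_zero (t : Tableau lam) : conjMap t (polytabloid t) ≠ 0 := by
  classical
  intro h0
  have h0 : (conjMap t (polytabloid t) : TabloidSpace n) t.col = 0 := by
    rw [h0]
    rfl
  have hsum : (conjMap t (polytabloid t) : TabloidSpace n) t.col =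
      ((∑ s : Tableau lam, ∑ σ ∈ t.colStab, ∑ τ ∈ s.conj.colStab,
        (if s.row ∘ ⇑σ = t.row ∧ t.col ∘ ⇑τ = s.conj.row then 1 else 0 : ℕ) : ℕ) : ℂ) := by
    rw [conjMap_apply, AddSubmonoidClass.coe_finsetSum, Finset.sum_apply, Nat.cast_sum]
    refine Finset.sum_congr rfl fun s _ => ?_
    show t.relSign s * (polytabloid t s.row * polytabloid s.conj t.col) = _
    rw [polytabloid_apply, polytabloid_apply, Finset.sum_mul_sum, Finset.mul_sum, Nat.cast_sum]
    refine Finset.sum_congr rfl fun σ hσ => ?_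
    rw [Finset.mul_sum, Nat.cast_sum]
    refine Finset.sum_congr rfl fun τ hτ => ?_
    by_cases h1 : s.row ∘ ⇑σ = t.row
    · by_cases h2 : t.col ∘ ⇑τ = s.conj.row
      · rw [Tableau.relSign, symm_trans_eq t s hσ hτ h1 h2, sgn_mul,
          show sgn τ⁻¹ = sgn τ by simp [sgn]]
        simp only [h1, h2, and_self, if_true, mul_one, Nat.cast_one]
        linear_combination (sgn τ * sgn τ) * sgn_mul_self σ + sgn_mul_self τ
      · simp [h2]
    · simp [h1]
  rw [hsum, Nat.cast_eq_zero, Finset.sum_eq_zero_iff] at h0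
  have h0 := h0 t (Finset.mem_univ t)
  rw [Finset.sum_eq_zero_iff] at h0
  have h0 := h0 1 t.one_mem_colStab
  rw [Finset.sum_eq_zero_iff] at h0
  have h0 := h0 1 t.conj.one_mem_colStab
  rw [if_pos ⟨rfl, rfl⟩] at h0
  exact one_ne_zero h0

theorem exists_twisted (lam kap : Shape n) (h : kap = lam.conj) :
    ∃ T : Specht lam →ₗ[ℂ] Specht kap, Twisted T ∧ T ≠ 0 := by
  subst h
  obtain ⟨t⟩ := (inferInstance : Nonempty (Tableau lam))
  refine ⟨conjMap t ∘ₗ (Specht lam).subtype, fun σ v => conjMap_tabloidRep t σ v, fun h0 => ?_⟩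
  exact conjMap_spechtPoly_ne_zero t (LinearMap.congr_fun h0 (spechtPoly t))

end Conjugate

/-- A choice of associators for the partitions of `n`, with the conjugate partition as a
parameter. -/
structure LocalAssociators (n : ℕ) where
  φ : ∀ lam kap : Shape n, kap = lam.conj → (Specht lam →ₗ[ℂ] Specht kap)
  twisted : ∀ lam kap h, Twisted (φ lam kap h)
  inverse : ∀ lam kap h h' v, φ kap lam h' (φ lam kap h v) = v

/-- Compatibility of associators with the restriction from `S_{n+1}` to `S_n`. -/
def LocalAssociators.Compatible {n : ℕ} (A : LocalAssociators n) (B : LocalAssociators (n + 1)) :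
    Prop :=
  ∀ (mu : Shape n) (lam : Shape (n + 1)), Precedes mu lam → ∀ (hm : mu = mu.conj)
    (hl : lam = lam.conj) (j : Specht mu →ₗ[ℂ] Specht lam),
    Intertwines (spechtRep mu) (spechtRes lam) j →
    ∀ v, B.φ lam lam hl (j v) = j (A.φ mu mu hm v)

theorem Shape.eq_conj_symm {n : ℕ} {lam kap : Shape n} (h : kap = lam.conj) : lam = kap.conj := by
  rw [h, conj_conj]

/-- The composite of the twisted maps to the conjugate shape and back is a nonzero scalar by Schur's
lemma. The scalar is the same in either order, so both maps can be divided by the same square root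
of it. -/
theorem nonempty_localAssociators (n : ℕ) : Nonempty (LocalAssociators n) := by
  choose T hT hT0 using exists_twisted (n := n)
  have hc : ∀ lam kap h, ∃ c : ℂ, ∀ v, T kap lam (Shape.eq_conj_symm h) (T lam kap h v) = c • v :=
    fun lam kap h => exists_scalar ((hT kap lam _).comp (hT lam kap h))
  choose c hc using hc
  have hinj : ∀ lam kap h, Function.Injective (T lam kap h) := fun lam kap h =>
    (hT lam kap h).injective (hT0 lam kap h)
  have hc0 : ∀ lam kap h, c lam kap h ≠ 0 := fun lam kap h h0 => by
    obtain ⟨v, hv⟩ := exists_ne (0 : Specht lam)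
    have := hc lam kap h v
    rw [h0, zero_smul] at this
    exact hv ((map_eq_zero_iff _ (hinj _ _ _)).1 ((map_eq_zero_iff _ (hinj _ _ _)).1 this))
  have hsymm : ∀ lam kap h h', c kap lam h' = c lam kap h := fun lam kap h h' => by
    obtain ⟨v, hv⟩ := exists_ne (0 : Specht lam)
    have h1 := hc kap lam h' (T lam kap h v)
    rw [hc lam kap h, map_smul] at h1
    exact (smul_left_injective ℂ (fun h0 => hv ((map_eq_zero_iff _ (hinj _ _ _)).1 h0)) h1).symm
  choose r hr using IsAlgClosed.exists_eq_mul_self (k := ℂ)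
  refine ⟨⟨fun lam kap h => (r (c lam kap h))⁻¹ • T lam kap h, fun lam kap h σ v => ?_,
    fun lam kap h h' v => ?_⟩⟩
  · rw [LinearMap.smul_apply, LinearMap.smul_apply, hT, map_smul, smul_comm]
  · rw [LinearMap.smul_apply, LinearMap.smul_apply, map_smul, hc, hsymm lam kap h h', smul_smul,
      smul_smul, ← mul_inv, ← hr, inv_mul_cancel₀ (hc0 _ _ _), one_smul]

/-- The cell removed from a symmetric partition to obtain a symmetric partition is diagonal. -/
theorem swap_eq_of_symmetric {n : ℕ} {mu : Shape n} {lam : Shape (n + 1)} (hm : mu = mu.conj)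
    (hl : lam = lam.conj) {c : ℕ × ℕ} (hc : c ∈ lam.1.cells)
    (h : mu.1.cells = lam.1.cells.erase c) : c.swap = c := by
  by_contra hne
  have h1 : c.swap ∈ lam.1.cells := by
    rw [hl]
    exact Shape.swap_mem_conj.2 hc
  have h2 : c.swap ∈ mu.1.cells := h ▸ Finset.mem_erase.2 ⟨hne, h1⟩
  rw [hm, Shape.swap_mem_conj, h] at h2
  exact Finset.notMem_erase _ _ h2

/-- The two removed cells are diagonal, hence comparable, and removable cells are maximal. -/
theorem eq_of_precedes_symmetric {n : ℕ} {mu nu : Shape n} {lam : Shape (n + 1)}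
    (hl : lam = lam.conj) (hm : mu = mu.conj) (hn : nu = nu.conj) (hml : Precedes mu lam)
    (hnl : Precedes nu lam) : mu = nu := by
  obtain ⟨c, hc, hmc⟩ := hml
  obtain ⟨d, hd, hnd⟩ := hnl
  have h1 := congrArg Prod.fst (swap_eq_of_symmetric hm hl hc hmc)
  have h2 := congrArg Prod.fst (swap_eq_of_symmetric hn hl hd hnd)
  simp only [Prod.fst_swap] at h1 h2
  have key : ∀ (rho : Shape n) (a b : ℕ × ℕ), b ∈ lam.1.cells →
      rho.1.cells = lam.1.cells.erase a → a ≤ b → a = b := fun rho a b hb h hle => by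
    by_contra hne
    have : a ∈ rho.1.cells := rho.1.isLowerSet hle
      (Finset.mem_coe.2 (h ▸ Finset.mem_erase.2 ⟨Ne.symm hne, hb⟩))
    rw [h] at this
    exact Finset.notMem_erase _ _ this
  have hcd : c = d := by
    rcases le_total c.1 d.1 with h | h
    · exact key mu c d hd hmc ⟨h, by omega⟩
    · exact (key nu d c hc hnd ⟨h, by omega⟩).symm
  subst hcd
  exact Shape.ext_cells (hmc.trans hnd.symm)

/-- For symmetric `mu` below a symmetric `lam`, the maps `j` and `φ j φ` are proportional by
multiplicity-freeness, and the factor `s` has square 1 because the associators are involutions.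
Rescaling by `s` repairs the associator on `lam`; since `mu` is unique, no two requirements
conflict. -/
theorem LocalAssociators.exists_compatible {n : ℕ} (A : LocalAssociators n) :
    ∃ B : LocalAssociators (n + 1), A.Compatible B := by
  obtain ⟨B⟩ := nonempty_localAssociators (n + 1)
  have hs : ∀ lam : Shape (n + 1), ∃ s : ℂ, s * s = 1 ∧ (lam ≠ lam.conj → s = 1) ∧
      ∀ (mu : Shape n), Precedes mu lam → ∀ (hm : mu = mu.conj) (hl : lam = lam.conj)
      (j : Specht mu →ₗ[ℂ] Specht lam), Intertwines (spechtRep mu) (spechtRes lam) j →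
      ∀ v, s • B.φ lam lam hl (j v) = j (A.φ mu mu hm v) := by
    intro lam
    by_cases hl : lam = lam.conj
    swap
    · exact ⟨1, one_mul 1, fun _ => rfl, fun _ _ _ h => (hl h).elim⟩
    by_cases hex : ∃ mu : Shape n, Precedes mu lam ∧ mu = mu.conj
    swap
    · exact ⟨1, one_mul 1, fun _ => rfl, fun mu h1 h2 => (hex ⟨mu, h1, h2⟩).elim⟩
    obtain ⟨mu, hml, hm⟩ := hex
    obtain ⟨j, hj, hj0⟩ := exists_restriction_embedding hml
    obtain ⟨s, hs⟩ := exists_smul_eq (f := B.φ lam lam hl ∘ₗ j ∘ₗ A.φ mu mu hm) hml hj hj0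
      (fun σ v => by
        simp only [LinearMap.comp_apply]
        rw [A.twisted, map_smul, hj, map_smul]
        show _ • B.φ lam lam hl (spechtRep lam (inclusion n σ) _) = _
        rw [B.twisted, smul_smul, sgn, sgn, sign_inclusion]
        exact (congrArg (· • _) (sgn_mul_self σ)).trans (one_smul _ _))
    simp only [LinearMap.comp_apply] at hs
    have hs1 : ∀ v, B.φ lam lam hl (j v) = s • j (A.φ mu mu hm v) := fun v => by
      rw [← hs, A.inverse]
    have hss : s * s = 1 := by
      obtain ⟨v, hv⟩ : ∃ v, j v ≠ 0 := by
        by_contra! h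
        exact hj0 (LinearMap.ext h)
      have := B.inverse lam lam hl hl (j v)
      rw [hs1, map_smul, hs1, A.inverse, smul_smul] at this
      exact smul_left_injective ℂ hv (this.trans (one_smul _ _).symm)
    refine ⟨s, hss, fun h => (h hl).elim, fun nu hnl hn _ k hk v => ?_⟩
    obtain rfl := eq_of_precedes_symmetric hl hm hn hml hnl
    obtain ⟨c, hc⟩ := exists_smul_eq hml hj hj0 hk
    rw [hc, hc, map_smul, hs1, smul_comm c, smul_smul s, hss, one_smul]
  choose s hs1 hs2 hs3 using hs
  refine ⟨⟨fun lam kap h => s lam • B.φ lam kap h, fun lam kap h σ v => ?_,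
    fun lam kap h h' v => ?_⟩, fun mu lam hml hm hl j hj v => hs3 lam mu hml hm hl j hj v⟩
  · rw [LinearMap.smul_apply, LinearMap.smul_apply, B.twisted, smul_comm, map_smul]
  · rw [LinearMap.smul_apply, LinearMap.smul_apply, map_smul, B.inverse, smul_smul]
    -- For a nonsymmetric pair both factors are 1; in the symmetric case `kap = lam`, and the factor
    -- squares to 1.
    have : s kap * s lam = 1 := by
      by_cases hl : lam = lam.conj
      · rw [← hl] at h
        rw [h, hs1]
      · rw [hs2 lam hl, hs2 kap fun hk => hl (by rw [← h, h', ← hk]), one_mul]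
    rw [this, one_smul]

/-- A compatible sequence of associators. -/
noncomputable def associatorSequence : ∀ n : ℕ, LocalAssociators n
  | 0 => (nonempty_localAssociators 0).some
  | n + 1 => (associatorSequence n).exists_compatible.choose

theorem associatorSequence_compatible (n : ℕ) :
    (associatorSequence n).Compatible (associatorSequence (n + 1)) :=
  (associatorSequence n).exists_compatible.choose_spec

theorem LocalAssociators.coe_φ {n : ℕ} (A : LocalAssociators n) (lam kap kap' : Shape n)
    (h : kap = lam.conj) (h' : kap' = lam.conj) (v : Specht lam) :
    (A.φ lam kap h v : TabloidSpace n) = A.φ lam kap' h' v := by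
  subst h
  subst h'
  rfl

theorem nonempty_associators : Nonempty Associators := by
  refine ⟨⟨fun {n} lam => (associatorSequence n).φ lam lam.conj rfl, fun {n} lam =>
    (associatorSequence n).twisted lam lam.conj rfl, fun {n} lam v => ?_,
    fun {n} mu lam hml hm hl j hj v w hvw => ?_⟩⟩
  · rw [(associatorSequence n).coe_φ lam.conj lam.conj.conj lam rfl lam.conj_conj.symm,
      LocalAssociators.inverse]
  · rw [(associatorSequence (n + 1)).coe_φ lam lam.conj lam rfl hl,
      associatorSequence_compatible n mu lam hml hm hl j hj v]
    congr 2
    refine Subtype.ext ?_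
    rw [← hvw]
    exact (associatorSequence n).coe_φ mu mu mu.conj hm rfl v

/-- The associators for the partitions of `n`. -/
def Associators.toLocal (Φ : Associators) (n : ℕ) : LocalAssociators n where
  φ lam kap h := (LinearEquiv.ofEq _ _ (congrArg Specht h.symm)).toLinearMap ∘ₗ Φ.φ lam
  twisted lam kap h σ v := by
    subst h
    exact Φ.intertwine lam σ v
  inverse lam kap h h' v := by
    subst h
    exact Subtype.ext (Φ.inverse lam v)

theorem Associators.toLocal_compatible (Φ : Associators) (n : ℕ) :
    (Φ.toLocal n).Compatible (Φ.toLocal (n + 1)) := fun mu lam hml hm hl j hj v =>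
  Subtype.ext (Φ.compatible mu lam hml hm hl j hj v _ rfl)

/-! ### Homomorphisms of supermodules -/

namespace Supermodule

variable {G : Type} [Group G] {ε : G →* ℤˣ}

/-- The action of the group together with the projection onto the even component. -/
noncomputable def op (M : Supermodule ε) : Option G → Module.End ℂ M.V
  | none => (M.grade 0).projection (M.grade 1) M.isCompl
  | some g => M.ρ g

/-- An even homomorphism of supermodules. -/
def IsHom (M N : Supermodule ε) (f : M.V →ₗ[ℂ] N.V) : Prop :=
  (∀ g v, f (M.ρ g v) = N.ρ g (f v)) ∧ ∀ i, ∀ v ∈ M.grade i, f v ∈ N.grade i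

theorem IsHom.comp {M N P : Supermodule ε} {g : N.V →ₗ[ℂ] P.V} {f : M.V →ₗ[ℂ] N.V}
    (hg : IsHom N P g) (hf : IsHom M N f) : IsHom M P (g ∘ₗ f) :=
  ⟨fun x v => by rw [LinearMap.comp_apply, hf.1, hg.1, LinearMap.comp_apply],
    fun i v hv => hg.2 i _ (hf.2 i v hv)⟩

theorem Iso.isHom {M N : Supermodule ε} (e : Iso M N) : IsHom M N e.toLinearEquiv.toLinearMap :=
  ⟨e.map_smul, e.map_grade⟩

theorem exists_add (M : Supermodule ε) (v : M.V) :
    ∃ a ∈ M.grade 0, ∃ b ∈ M.grade 1, a + b = v :=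
  Submodule.mem_sup.1 (M.isCompl.sup_eq_top.ge trivial : v ∈ M.grade 0 ⊔ M.grade 1)

theorem op_none_add (M : Supermodule ε) {a b : M.V} (ha : a ∈ M.grade 0) (hb : b ∈ M.grade 1) :
    M.op none (a + b) = a := by
  show (M.grade 0).projection (M.grade 1) M.isCompl (a + b) = a
  rw [map_add, (Submodule.projection_apply_eq_zero_iff M.isCompl).2 hb, add_zero]
  exact Submodule.projection_apply_left M.isCompl ⟨a, ha⟩

theorem op_none_of_mem_zero (M : Supermodule ε) {a : M.V} (ha : a ∈ M.grade 0) :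
    M.op none a = a := by
  simpa using M.op_none_add ha (Submodule.zero_mem _)

theorem op_none_of_mem_one (M : Supermodule ε) {b : M.V} (hb : b ∈ M.grade 1) :
    M.op none b = 0 := by
  simpa using M.op_none_add (Submodule.zero_mem _) hb

theorem mem_zero_of_op_none (M : Supermodule ε) {v : M.V} (h : M.op none v = v) :
    v ∈ M.grade 0 := by
  obtain ⟨a, ha, b, hb, rfl⟩ := M.exists_add v
  rw [M.op_none_add ha hb] at h
  exact h ▸ ha

theorem mem_one_of_op_none (M : Supermodule ε) {v : M.V} (h : M.op none v = 0) :
    v ∈ M.grade 1 := by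
  obtain ⟨a, ha, b, hb, rfl⟩ := M.exists_add v
  rw [M.op_none_add ha hb] at h
  rwa [h, zero_add]

/-- Counting the even projection among the operators makes even homomorphisms the same as
intertwining maps, so that the ungraded forms of Schur's lemma and of joint injectivity apply to
supermodules. -/
theorem IsHom.intertwines {M N : Supermodule ε} {f : M.V →ₗ[ℂ] N.V} (hf : IsHom M N f) :
    Intertwines M.op N.op f := by
  rintro (_ | g) v
  · obtain ⟨a, ha, b, hb, rfl⟩ := M.exists_add v
    rw [M.op_none_add ha hb, map_add, N.op_none_add (hf.2 0 a ha) (hf.2 1 b hb)]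
  · exact hf.1 g v

theorem isHom_of_intertwines {M N : Supermodule ε} {f : M.V →ₗ[ℂ] N.V}
    (hf : Intertwines M.op N.op f) : IsHom M N f := by
  refine ⟨fun g v => hf (some g) v, fun i v hv => ?_⟩
  have hi : ∀ i : ZMod 2, i = 0 ∨ i = 1 := by decide
  rcases hi i with rfl | rfl
  · exact N.mem_zero_of_op_none (by rw [← hf, M.op_none_of_mem_zero hv])
  · exact N.mem_one_of_op_none (by rw [← hf, M.op_none_of_mem_one hv, map_zero])

/-- An equivalence that is a homomorphism is an isomorphism. -/
def IsHom.iso {M N : Supermodule ε} {e : M.V ≃ₗ[ℂ] N.V} (he : IsHom M N e.toLinearMap) :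
    Iso M N :=
  ⟨e, he.1, he.2⟩

/-- The identity isomorphism. -/
def Iso.refl (M : Supermodule ε) : Iso M M :=
  ⟨LinearEquiv.refl ℂ M.V, fun _ _ => rfl, fun _ _ h => h⟩

theorem Iso.isHom_symm {M N : Supermodule ε} (e : Iso M N) :
    IsHom N M e.toLinearEquiv.symm.toLinearMap := by
  refine isHom_of_intertwines fun x v => ?_
  obtain ⟨w, rfl⟩ := e.toLinearEquiv.surjective v
  have := e.isHom.intertwines x w
  simp only [LinearEquiv.coe_coe] at this
  rw [LinearEquiv.coe_coe, ← this, LinearEquiv.symm_apply_apply, LinearEquiv.symm_apply_apply]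

/-- The inverse isomorphism. -/
def Iso.symm {M N : Supermodule ε} (e : Iso M N) : Iso N M := e.isHom_symm.iso

/-- The composition of isomorphisms. -/
def Iso.trans {M N P : Supermodule ε} (e : Iso M N) (f : Iso N P) : Iso M P :=
  ⟨e.toLinearEquiv.trans f.toLinearEquiv, (f.isHom.comp e.isHom).1, (f.isHom.comp e.isHom).2⟩

theorem IsSimple.irreducible {M : Supermodule ε} (hM : M.IsSimple) : Irreducible M.op := by
  refine ⟨hM.1, fun U hU => hM.2 U ⟨fun g => hU (some g), ?_⟩⟩
  refine le_antisymm (fun v hv => ?_) (sup_le inf_le_left inf_le_left)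
  obtain ⟨a, ha, b, hb, rfl⟩ := M.exists_add v
  have haU : a ∈ U := by
    have := hU none _ hv
    rwa [M.op_none_add ha hb] at this
  have hbU : b ∈ U := (Submodule.add_mem_iff_right U haU).1 hv
  exact Submodule.add_mem_sup ⟨haU, ha⟩ ⟨hbU, hb⟩

theorem mem_grade_directSum {ι : Type} (N : ι → Supermodule ε) (p : ZMod 2)
    (x : ⨁ i, (N i).V) : x ∈ (directSum N).grade p ↔ ∀ i, x i ∈ (N i).grade p := by
  show x ∈ (⨅ i, ((N i).grade p).comap (DirectSum.component ℂ ι (fun i => (N i).V) i)) ↔ _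
  rw [Submodule.mem_iInf]
  rfl

theorem isHom_lof {ι : Type} [DecidableEq ι] (N : ι → Supermodule ε) (i : ι) :
    IsHom (N i) (directSum N) (DirectSum.lof ℂ ι (fun i => (N i).V) i) := by
  refine ⟨fun g v => ?_, fun p v hv => ?_⟩
  · exact (DirectSum.lmap_lof (fun i => (N i).ρ g) i v).symm
  · refine (mem_grade_directSum N p _).2 fun j => ?_
    by_cases hij : j = i
    · subst hij
      have : DirectSum.lof ℂ ι (fun i => (N i).V) j v j = v :=
        DirectSum.of_eq_same (β := fun i => (N i).V) j v
      exact (congrArg (· ∈ (N j).grade p) this).mpr hv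
    · have : DirectSum.lof ℂ ι (fun i => (N i).V) i v j = 0 :=
        DirectSum.of_eq_of_ne (β := fun i => (N i).V) _ _ v hij
      exact (congrArg (· ∈ (N j).grade p) this).mpr (Submodule.zero_mem _)

theorem isHom_inl (M N : Supermodule ε) :
    IsHom M (Supermodule.prod M N) (LinearMap.inl ℂ M.V N.V) :=
  ⟨fun g _ => Prod.ext rfl (map_zero (N.ρ g)).symm, fun _ _ hv => ⟨hv, Submodule.zero_mem _⟩⟩

theorem isHom_inr (M N : Supermodule ε) :
    IsHom N (Supermodule.prod M N) (LinearMap.inr ℂ M.V N.V) :=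
  ⟨fun g _ => Prod.ext (map_zero (M.ρ g)).symm rfl, fun _ _ hv => ⟨Submodule.zero_mem _, hv⟩⟩

/-- A supermodule spanned by the images of pairwise nonisomorphic simple supermodules is their
direct sum. -/
theorem nonempty_iso_directSum {ι : Type} {M : Supermodule ε} {N : ι → Supermodule ε}
    (hN : ∀ i, (N i).IsSimple) (hiso : ∀ i j, i ≠ j → IsEmpty (Iso (N i) (N j)))
    (f : ∀ i, (N i).V →ₗ[ℂ] M.V) (hf : ∀ i, IsHom (N i) M (f i)) (h0 : ∀ i, f i ≠ 0)
    (hspan : ∀ U : Submodule ℂ M.V, (∀ i v, f i v ∈ U) → U = ⊤) :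
    Nonempty (Iso M (directSum N)) := by
  classical
  let F : (⨁ i, (N i).V) →ₗ[ℂ] M.V := DirectSum.toModule ℂ ι M.V f
  have hFof : ∀ i v, F (DirectSum.of (fun i => (N i).V) i v) = f i v := fun i v =>
    DirectSum.toModule_lof ℂ (φ := f) i v
  have hF : ∀ x : ⨁ i, (N i).V, F x = ∑ i ∈ DFinsupp.support x, f i (x i) := fun x => by
    conv_lhs => rw [← DirectSum.sum_support_of x]
    rw [map_sum]
    exact Finset.sum_congr rfl fun i _ => hFof i (x i)
  have hinj : Function.Injective F := by
    rw [injective_iff_map_eq_zero]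
    intro x hx
    rw [hF] at hx
    have := jointly_injective (fun i => (N i).op) (fun i => (hN i).irreducible) M.op f
      (fun i => (hf i).intertwines) h0
      (fun i j hij e he => (hiso i j hij).false (isHom_of_intertwines he).iso) _ _ hx
    refine DFinsupp.ext fun i => ?_
    by_contra hi
    exact hi (this i (DFinsupp.mem_support_toFun x i |>.2 hi))
  have hsurj : Function.Surjective F := by
    rw [← LinearMap.range_eq_top]
    exact hspan _ fun i v => ⟨_, hFof i v⟩
  have hhom : IsHom (directSum N) M F := by
    refine ⟨fun g x => ?_, fun p x hx => ?_⟩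
    · have : F ∘ₗ DirectSum.lmap (fun i => (N i).ρ g) = M.ρ g ∘ₗ F := by
        refine DirectSum.linearMap_ext ℂ fun i => LinearMap.ext fun v => ?_
        simp only [LinearMap.comp_apply, DirectSum.lmap_lof]
        exact (hFof i _).trans (((hf i).1 g v).trans (congrArg _ (hFof i v).symm))
      exact LinearMap.congr_fun this x
    · have hx := (mem_grade_directSum N p x).1 hx
      exact (congrArg (· ∈ M.grade p) (hF x)).mpr
        (Submodule.sum_mem _ fun i _ => (hf i).2 p _ (hx i))
  exact ⟨(IsHom.iso (e := LinearEquiv.ofBijective F ⟨hinj, hsurj⟩) hhom).symm⟩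

end Supermodule

/-! ### The supermodules attached to partitions -/

theorem Precedes.conj {n : ℕ} {mu : Shape n} {lam : Shape (n + 1)} (h : Precedes mu lam) :
    Precedes mu.conj lam.conj := by
  rw [precedes_iff] at h ⊢
  intro c hc
  rw [← c.swap_swap, Shape.swap_mem_conj] at hc ⊢
  exact h hc

/-- The diagram of `lam` is the union of those of `mu` and its conjugate, which is symmetric. -/
theorem eq_conj_of_precedes {n : ℕ} {mu : Shape n} {lam : Shape (n + 1)} (hne : mu ≠ mu.conj)
    (h1 : Precedes mu lam) (h2 : Precedes mu.conj lam) : lam = lam.conj := by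
  have h3 := h1.conj
  have h4 := h2.conj
  rw [Shape.conj_conj] at h4
  exact Shape.ext_cells ((cells_eq_union hne h1 h2).trans (cells_eq_union hne h4 h3).symm)

namespace Associators

variable (Φ : Associators) {n : ℕ}

section Twist

variable {lam kap : Shape n}

/-- The associator from `S^lam` to `S^kap` for conjugate partitions `lam` and `kap`. -/
def twist (lam kap : Shape n) (h : kap = lam.conj) : Specht lam →ₗ[ℂ] Specht kap :=
  (Φ.toLocal n).φ lam kap h

theorem twist_spechtRep (h : kap = lam.conj) (σ : Equiv.Perm (Fin n)) (v : Specht lam) :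
    Φ.twist lam kap h (spechtRep lam σ v) = sgn σ • spechtRep kap σ (Φ.twist lam kap h v) :=
  (Φ.toLocal n).twisted lam kap h σ v

theorem twist_twist (h : kap = lam.conj) (h' : lam = kap.conj) (v : Specht lam) :
    Φ.twist kap lam h' (Φ.twist lam kap h v) = v :=
  (Φ.toLocal n).inverse lam kap h h' v

theorem mem_grade_typeM (h : lam = lam.conj) (i : ZMod 2) (v : Specht lam) :
    v ∈ (Φ.typeM lam h).grade i ↔ Φ.twist lam lam h v = eps i • v := by
  show v ∈ LinearMap.ker _ ↔ _
  rw [LinearMap.mem_ker, LinearMap.sub_apply, sub_eq_zero]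
  exact ⟨fun h => Subtype.ext h, fun h => congrArg Subtype.val h⟩

theorem mem_grade_typeQ (i : ZMod 2) (v : Specht lam × Specht lam.conj) :
    v ∈ (Φ.typeQ lam).grade i ↔ v.2 = eps i • Φ.twist lam lam.conj rfl v.1 :=
  LinearMap.mem_graph_iff (eps i • Φ.φ lam) v

theorem eps_zero_smul (v : Specht lam) : eps 0 • v = v := one_smul ℂ v

theorem eps_one_smul (v : Specht lam) : eps 1 • v = -v := by
  rw [eps, if_neg one_ne_zero]
  exact neg_one_smul ℂ v

theorem eps_mul_self (i : ZMod 2) : eps i * eps i = 1 := by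
  rw [eps]
  split_ifs <;> norm_num

theorem eps_add_one (i : ZMod 2) : eps (i + 1) = -eps i := by
  have h : ∀ i : ZMod 2, (i + 1 = 0 ↔ ¬ i = 0) := by decide
  rw [eps, eps]
  by_cases hi : i = 0 <;> simp [h, hi]

/-! ### Simplicity and isomorphism classes of the $W^\lambda$ -/

theorem isSimple_typeM (h : lam = lam.conj) : (Φ.typeM lam h).IsSimple :=
  ⟨inferInstanceAs (Nontrivial (Specht lam)), fun U hU =>
    (irreducible_specht lam).2 U fun σ v hv => hU.1 σ v hv⟩

/-- A subsupermodule is stable under the parity involution $a + b \mapsto a - b$, which here is $(u,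
w) \mapsto (\phi w, \phi u)$ and exchanges the two Specht modules. -/
theorem fst_mem_iff_snd_mem {U : Submodule ℂ (Specht lam × Specht lam.conj)}
    (hU : (Φ.typeQ lam).IsSub U) (u : Specht lam) :
    (u, 0) ∈ U ↔ (0, Φ.twist lam lam.conj rfl u) ∈ U := by
  have hsub : ∀ a b : Specht lam × Specht lam.conj,
      a.2 = eps 0 • Φ.twist lam lam.conj rfl a.1 → b.2 = eps 1 • Φ.twist lam lam.conj rfl b.1 →
      (Φ.twist lam.conj lam lam.conj_conj.symm (a + b).2,
        Φ.twist lam lam.conj rfl (a + b).1) = a - b := by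
    intro a b ha hb
    refine Prod.ext ?_ ?_
    · show Φ.twist lam.conj lam lam.conj_conj.symm (a.2 + b.2) = a.1 - b.1
      rw [ha, hb, eps_zero_smul, eps_one_smul, map_add, map_neg, twist_twist, twist_twist,
        sub_eq_add_neg]
    · show Φ.twist lam lam.conj rfl (a.1 + b.1) = a.2 - b.2
      rw [ha, hb, eps_zero_smul, eps_one_smul, map_add, sub_neg_eq_add]
  have key : ∀ x ∈ U, (Φ.twist lam.conj lam lam.conj_conj.symm x.2,
      Φ.twist lam lam.conj rfl x.1) ∈ U := by
    intro x hx
    have hx' : x ∈ (U ⊓ (Φ.typeQ lam).grade 0) ⊔ (U ⊓ (Φ.typeQ lam).grade 1) := hU.2.le hx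
    obtain ⟨a, ⟨haU, ha⟩, b, ⟨hbU, hb⟩, rfl⟩ := Submodule.mem_sup.1 hx'
    have := hsub a b ((Φ.mem_grade_typeQ 0 a).1 ha) ((Φ.mem_grade_typeQ 1 b).1 hb)
    exact (congrArg (· ∈ U) this).mpr (Submodule.sub_mem _ haU hbU)
  constructor
  · intro h
    simpa using key _ h
  · intro h
    simpa [twist_twist] using key _ h

/-- By the parity involution a subsupermodule containing one Specht module contains both. So if `U`
is proper, both map nontrivially to the quotient by `U`; being nonisomorphic irreducibles, they
inject jointly, and `U` is zero. -/
theorem isSimple_typeQ (h : lam ≠ lam.conj) : (Φ.typeQ lam).IsSimple := by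
  refine ⟨inferInstanceAs (Nontrivial (Specht lam × Specht lam.conj)), fun U hU => ?_⟩
  let V := Specht lam × Specht lam.conj
  let U' : Submodule ℂ V := U
  let ρ : Representation ℂ (Equiv.Perm (Fin n)) V := (spechtRep lam).prod (spechtRep lam.conj)
  have hinv : ∀ σ, U' ≤ U'.comap (ρ σ) := fun σ v hv => hU.1 σ v hv
  let b : Equiv.Perm (Fin n) → Module.End ℂ (V ⧸ U') := fun σ => U'.mapQ U' (ρ σ) (hinv σ)
  let s : Bool → Shape n := fun t => cond t lam.conj lam
  let f : ∀ t, Specht (s t) →ₗ[ℂ] (V ⧸ U') := fun t => match t with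
    | false => U'.mkQ ∘ₗ LinearMap.inl ℂ (Specht lam) (Specht lam.conj)
    | true => U'.mkQ ∘ₗ LinearMap.inr ℂ (Specht lam) (Specht lam.conj)
  have hf : ∀ t, Intertwines (spechtRep (s t)) b (f t) := by
    rintro (_ | _) σ v
    · exact congrArg U'.mkQ (Prod.ext rfl (map_zero (spechtRep lam.conj σ)).symm)
    · exact congrArg U'.mkQ (Prod.ext (map_zero (spechtRep lam σ)).symm rfl)
  have hfst : (∀ u, (u, 0) ∈ U') → U' = ⊤ := fun h0 => by
    rw [eq_top_iff]
    rintro ⟨u, w⟩ _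
    have h1 := (Φ.fst_mem_iff_snd_mem hU _).1 (h0 (Φ.twist lam.conj lam lam.conj_conj.symm w))
    rw [twist_twist] at h1
    have := Submodule.add_mem _ (h0 u) h1
    rwa [Prod.mk_add_mk, add_zero, zero_add] at this
  have hf0 : U' ≠ ⊤ → ∀ t, f t ≠ 0 := by
    rintro htop (_ | _) h0
    · exact htop (hfst fun u => (Submodule.Quotient.mk_eq_zero U').1 (LinearMap.congr_fun h0 u))
    · refine htop (hfst fun u => (Φ.fst_mem_iff_snd_mem hU u).2 ?_)
      exact (Submodule.Quotient.mk_eq_zero U').1 (LinearMap.congr_fun h0 _)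
  by_cases htop : U' = ⊤
  · exact Or.inr htop
  left
  have hs : ∀ t t', t ≠ t' → s t ≠ s t' := by
    rintro (_ | _) (_ | _) htt
    · exact (htt rfl).elim
    · exact h
    · exact h.symm
    · exact (htt rfl).elim
  refine (Submodule.eq_bot_iff _).2 fun x hx => ?_
  obtain ⟨u, w⟩ := x
  let v : ∀ t, Specht (s t) := fun t => match t with
    | false => u
    | true => w
  have hsum : ∑ t, f t (v t) = 0 := by
    rw [Fintype.sum_bool]
    refine Eq.trans ?_ ((Submodule.Quotient.mk_eq_zero U').2 hx)
    show U'.mkQ (0, w) + U'.mkQ (u, 0) = U'.mkQ (u, w)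
    rw [← map_add, Prod.mk_add_mk, add_zero, zero_add]
  have := jointly_injective (fun t => ⇑(spechtRep (s t))) (fun t => irreducible_specht (s t)) b f
    hf (hf0 htop) (fun t t' htt => not_intertwines_of_ne (hs t t' htt)) Finset.univ v hsum
  exact Prod.ext (this false (Finset.mem_univ _)) (this true (Finset.mem_univ _))

theorem ofPartition_of_eq (h : lam = lam.conj) : Φ.ofPartition lam = Φ.typeM lam h := dif_pos h

theorem ofPartition_of_ne (h : lam ≠ lam.conj) : Φ.ofPartition lam = Φ.typeQ lam := dif_neg h

theorem isSimple_ofPartition (lam : Shape n) : (Φ.ofPartition lam).IsSimple := by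
  by_cases h : lam = lam.conj
  · rw [Φ.ofPartition_of_eq h]
    exact Φ.isSimple_typeM h
  · rw [Φ.ofPartition_of_ne h]
    exact Φ.isSimple_typeQ h

theorem isSimple_W (R : Set (Shape n)) (lam : Shape n) : (Φ.W R lam).IsSimple := by
  unfold W
  split_ifs
  · exact Φ.isSimple_ofPartition lam
  · exact Φ.isSimple_ofPartition lam.conj

/-- `W^lam` does not depend on the choice of representatives. -/
theorem nonempty_iso_ofPartition_conj (lam : Shape n) :
    Nonempty (Supermodule.Iso (Φ.ofPartition lam) (Φ.ofPartition lam.conj)) := by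
  by_cases h : lam = lam.conj
  · rw [← h]
    exact ⟨Supermodule.Iso.refl _⟩
  have h' : lam.conj ≠ lam.conj.conj := by
    rw [Shape.conj_conj]
    exact Ne.symm h
  rw [Φ.ofPartition_of_ne h, Φ.ofPartition_of_ne h']
  let c : Specht lam ≃ₗ[ℂ] Specht lam.conj.conj :=
    LinearEquiv.ofEq _ _ (congrArg Specht lam.conj_conj.symm)
  let e : (Specht lam × Specht lam.conj) ≃ₗ[ℂ] (Specht lam.conj × Specht lam.conj.conj) :=
    (LinearEquiv.prodComm ℂ _ _).trans (LinearEquiv.prodCongr (LinearEquiv.refl ℂ _) c)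
  have he : Supermodule.IsHom (Φ.typeQ lam) (Φ.typeQ lam.conj) e.toLinearMap := by
    refine ⟨fun σ v => rfl, fun i v hv => ?_⟩
    have hv := (Φ.mem_grade_typeQ i v).1 hv
    refine (Φ.mem_grade_typeQ i (e v)).2 ?_
    show c v.1 = eps i • Φ.twist lam.conj lam.conj.conj rfl v.2
    rw [hv, map_smul, smul_smul, eps_mul_self, one_smul]
    exact Subtype.ext (Φ.inverse lam v.1).symm
  exact ⟨he.iso⟩

theorem nonempty_iso_W (R : Set (Shape n)) (lam : Shape n) :
    Nonempty (Supermodule.Iso (Φ.W R lam) (Φ.ofPartition lam)) := by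
  unfold W
  split_ifs
  · exact ⟨Supermodule.Iso.refl _⟩
  · obtain ⟨e⟩ := Φ.nonempty_iso_ofPartition_conj lam
    exact ⟨e.symm⟩

theorem exists_specht_embedding (lam : Shape n) : ∃ j : Specht lam →ₗ[ℂ] (Φ.ofPartition lam).V,
    Intertwines (spechtRep lam) (Φ.ofPartition lam).ρ j ∧ j ≠ 0 := by
  by_cases h : lam = lam.conj
  · rw [Φ.ofPartition_of_eq h]
    refine ⟨LinearMap.id, fun _ _ => rfl, fun h0 => ?_⟩
    obtain ⟨v, hv⟩ := exists_ne (0 : Specht lam)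
    exact hv (LinearMap.congr_fun h0 v)
  · rw [Φ.ofPartition_of_ne h]
    refine ⟨LinearMap.inl ℂ (Specht lam) (Specht lam.conj), fun σ v =>
      Prod.ext rfl (map_zero (spechtRep lam.conj σ)).symm, fun h0 => ?_⟩
    obtain ⟨v, hv⟩ := exists_ne (0 : Specht lam)
    exact hv (congrArg Prod.fst (LinearMap.congr_fun h0 v))

theorem exists_specht_projection (lam : Shape n) (x : (Φ.ofPartition lam).V) (hx : x ≠ 0) :
    ∃ nu : Shape n, (nu = lam ∨ nu = lam.conj) ∧ ∃ p : (Φ.ofPartition lam).V →ₗ[ℂ] Specht nu,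
      Intertwines (Φ.ofPartition lam).ρ (spechtRep nu) p ∧ p x ≠ 0 := by
  by_cases h : lam = lam.conj
  · revert x
    rw [Φ.ofPartition_of_eq h]
    intro x hx
    exact ⟨lam, Or.inl rfl, LinearMap.id, fun _ _ => rfl, hx⟩
  · revert x
    rw [Φ.ofPartition_of_ne h]
    intro x hx
    by_cases h1 : Prod.fst x = 0
    · refine ⟨lam.conj, Or.inr rfl, LinearMap.snd ℂ (Specht lam) (Specht lam.conj), fun _ _ => rfl,
        fun h2 => hx (Prod.ext h1 h2)⟩
    · exact ⟨lam, Or.inl rfl, LinearMap.fst ℂ (Specht lam) (Specht lam.conj), fun _ _ => rfl, h1⟩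

/-- The class `{lam, lam'}` is determined by the module `W^lam`. -/
theorem eq_or_eq_conj_of_W (R : Set (Shape n)) {lam kap : Shape n}
    (e : (Φ.W R lam).V ≃ₗ[ℂ] (Φ.W R kap).V)
    (he : ∀ σ v, e ((Φ.W R lam).ρ σ v) = (Φ.W R kap).ρ σ (e v)) : lam = kap ∨ lam = kap.conj := by
  obtain ⟨f⟩ := Φ.nonempty_iso_W R lam
  obtain ⟨g⟩ := Φ.nonempty_iso_W R kap
  obtain ⟨j, hj, hj0⟩ := Φ.exists_specht_embedding lam
  let F : (Φ.ofPartition lam).V ≃ₗ[ℂ] (Φ.ofPartition kap).V :=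
    (f.symm.toLinearEquiv.trans e).trans g.toLinearEquiv
  have hF : Intertwines (Φ.ofPartition lam).ρ (Φ.ofPartition kap).ρ F.toLinearMap := fun σ v => by
    show g.toLinearEquiv (e (f.symm.toLinearEquiv _)) =
      (Φ.ofPartition kap).ρ σ (g.toLinearEquiv (e (f.symm.toLinearEquiv v)))
    rw [f.symm.map_smul, he, g.map_smul]
  obtain ⟨v, hv⟩ : ∃ v, j v ≠ 0 := by
    by_contra! h
    exact hj0 (LinearMap.ext h)
  obtain ⟨nu, hnu, p, hp, hp0⟩ := Φ.exists_specht_projection kap (F (j v))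
    fun h0 => hv (F.map_eq_zero_iff.1 h0)
  have := eq_of_intertwines ((hp.comp hF).comp hj) fun h0 => hp0 (LinearMap.congr_fun h0 v)
  rw [this]
  exact hnu

/-- Such an isomorphism would be a nonzero scalar, which preserves the homogeneous components
instead of exchanging them. -/
theorem isEmpty_iso_shift (R : Set (Shape n)) (h : lam = lam.conj) :
    IsEmpty (Supermodule.Iso (Φ.W R lam) (Φ.W R lam).shift) := by
  have hW : Φ.W R lam = Φ.typeM lam h := by
    rw [W, ← h, ite_self, Φ.ofPartition_of_eq h]
  rw [hW]
  refine ⟨fun e => ?_⟩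
  let T : Specht lam →ₗ[ℂ] Specht lam := e.toLinearEquiv.toLinearMap
  obtain ⟨c, hc⟩ := exists_scalar (T := T) fun σ v => e.map_smul σ v
  have hc0 : c ≠ 0 := by
    rintro rfl
    obtain ⟨v, hv⟩ := exists_ne (0 : Specht lam)
    exact hv (e.toLinearEquiv.map_eq_zero_iff.1 ((hc v).trans (zero_smul ℂ v)))
  have key : ∀ i, ∀ v : Specht lam, v ∈ (Φ.typeM lam h).grade i → v = 0 := by
    intro i v hv
    have h1 : Φ.twist lam lam h (T v) = eps (i + 1) • T v :=
      (Φ.mem_grade_typeM h (i + 1) (T v)).1 (e.map_grade i v hv)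
    have hv : Φ.twist lam lam h v = eps i • v := (Φ.mem_grade_typeM h i v).1 hv
    rw [hc, map_smul, hv, smul_smul, smul_smul] at h1
    by_contra hv0
    have h2 : c * eps i = eps (i + 1) * c := smul_left_injective ℂ hv0 h1
    have h3 : c = 0 := by
      linear_combination (eps i / 2) * h2 + (eps i * c / 2) * eps_add_one i - c * eps_mul_self i
    exact hc0 h3
  obtain ⟨v, hv⟩ := exists_ne (0 : Specht lam)
  obtain ⟨a, ha, b, hb, hab⟩ := (Φ.typeM lam h).exists_add v
  exact hv (hab.symm.trans ((congrArg₂ (· + ·) (key 0 a ha) (key 1 b hb)).trans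
    (add_zero (0 : Specht lam))))

end Twist

end Associators

/-! ### Homomorphisms to restricted supermodules -/

theorem Supermodule.IsSimple.shift {G : Type} [Group G] {ε : G →* ℤˣ}
    {M : Supermodule ε} (hM : M.IsSimple) : M.shift.IsSimple := by
  refine ⟨hM.1, fun U hU => hM.2 U ⟨hU.1, hU.2.trans ?_⟩⟩
  show U ⊓ M.grade (0 + 1) ⊔ U ⊓ M.grade (1 + 1) = _
  rw [show (1 + 1 : ZMod 2) = 0 by decide, zero_add]
  exact sup_comm _ _

theorem Supermodule.IsHom.shift {G : Type} [Group G] {ε : G →* ℤˣ} {M N : Supermodule ε}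
    {f : M.V →ₗ[ℂ] N.V} (hf : IsHom M N f) : IsHom M.shift N.shift f :=
  ⟨hf.1, fun i => hf.2 (i + 1)⟩

theorem exists_apply_ne_zero {V W : Type} [AddCommGroup V] [Module ℂ V] [AddCommGroup W]
    [Module ℂ W] {f : V →ₗ[ℂ] W} (h : f ≠ 0) : ∃ v, f v ≠ 0 := by
  by_contra! h'
  exact h (LinearMap.ext h')

namespace Associators

open Supermodule

variable (Φ : Associators) {n : ℕ} {mu : Shape n} {lam : Shape (n + 1)}

theorem intertwines_twist {j : Specht mu →ₗ[ℂ] Specht lam}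
    (hj : Intertwines (spechtRep mu) (spechtRes lam) j) (kap : Shape n) (nu : Shape (n + 1))
    (h : mu = kap.conj) (h' : nu = lam.conj) :
    Intertwines (spechtRep kap) (spechtRes nu)
      (Φ.twist lam nu h' ∘ₗ j ∘ₗ Φ.twist kap mu h) := fun σ v => by
  simp only [LinearMap.comp_apply]
  rw [twist_spechtRep, map_smul, hj, map_smul]
  show _ • Φ.twist lam nu h' (spechtRep lam (inclusion n σ) _) = _
  rw [twist_spechtRep, smul_smul, sgn, sgn, sign_inclusion]
  exact (congrArg (· • _) (sgn_mul_self σ)).trans (one_smul _ _)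

theorem twist_ne_zero {j : Specht mu →ₗ[ℂ] Specht lam} (hj : j ≠ 0) (kap : Shape n)
    (nu : Shape (n + 1)) (h : mu = kap.conj) (h' : nu = lam.conj) :
    Φ.twist lam nu h' ∘ₗ j ∘ₗ Φ.twist kap mu h ≠ 0 := fun h0 => by
  obtain ⟨v, hv⟩ := exists_apply_ne_zero hj
  apply hv
  have := LinearMap.congr_fun h0 (Φ.twist mu kap (Shape.eq_conj_symm h) v)
  simp only [LinearMap.comp_apply, twist_twist, LinearMap.zero_apply] at this
  rw [← Φ.twist_twist h' (Shape.eq_conj_symm h') (j v), this, map_zero]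

theorem isHom_typeQ_typeQ {j : Specht mu →ₗ[ℂ] Specht lam}
    (hj : Intertwines (spechtRep mu) (spechtRes lam) j) :
    IsHom (Φ.typeQ mu) (down (Φ.typeQ lam)) (LinearMap.prodMap j
      (Φ.twist lam lam.conj rfl ∘ₗ j ∘ₗ Φ.twist mu.conj mu mu.conj_conj.symm)) := by
  refine ⟨fun σ v => Prod.ext (hj σ v.1)
    (Φ.intertwines_twist hj mu.conj lam.conj mu.conj_conj.symm rfl σ v.2), fun i v hv => ?_⟩
  have hv := (Φ.mem_grade_typeQ i v).1 hv
  refine (Φ.mem_grade_typeQ i _).2 ?_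
  show Φ.twist lam lam.conj rfl (j (Φ.twist mu.conj mu mu.conj_conj.symm v.2)) =
    eps i • Φ.twist lam lam.conj rfl (j v.1)
  rw [hv, map_smul, map_smul, map_smul, twist_twist]

/-- The map `u ↦ (j u, ± φ j φ u)`. -/
def toTypeQ (hm : mu = mu.conj) (j : Specht mu →ₗ[ℂ] Specht lam) (p : ZMod 2) :
    Specht mu →ₗ[ℂ] Specht lam × Specht lam.conj :=
  LinearMap.prod j (eps p • (Φ.twist lam lam.conj rfl ∘ₗ j ∘ₗ Φ.twist mu mu hm))

theorem toTypeQ_apply (hm : mu = mu.conj) (j : Specht mu →ₗ[ℂ] Specht lam) (p : ZMod 2)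
    (v : Specht mu) : Φ.toTypeQ hm j p v =
      (j v, eps p • Φ.twist lam lam.conj rfl (j (Φ.twist mu mu hm v))) := rfl

theorem toTypeQ_rho (hm : mu = mu.conj) {j : Specht mu →ₗ[ℂ] Specht lam}
    (hj : Intertwines (spechtRep mu) (spechtRes lam) j) (p : ZMod 2) (σ : Equiv.Perm (Fin n))
    (v : Specht mu) : Φ.toTypeQ hm j p (spechtRep mu σ v) =
      (down (Φ.typeQ lam)).ρ σ (Φ.toTypeQ hm j p v) := by
  refine Prod.ext (hj σ v) ?_
  refine (congrArg (eps p • ·) (Φ.intertwines_twist hj mu lam.conj hm rfl σ v)).trans ?_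
  exact (map_smul (spechtRes lam.conj σ) (eps p) _).symm

/-- On the eigenspace of sign `eps i`, the second coordinate is `eps p * eps i` times $\phi j v$. So
`p = 0` preserves parity and `p = 1` reverses it. -/
theorem toTypeQ_grade (hm : mu = mu.conj) (j : Specht mu →ₗ[ℂ] Specht lam) (p i : ZMod 2)
    (v : Specht mu) (hv : v ∈ (Φ.typeM mu hm).grade i) (k : ZMod 2) (hk : eps p * eps i = eps k) :
    Φ.toTypeQ hm j p v ∈ (down (Φ.typeQ lam)).grade k := by
  have hv := (Φ.mem_grade_typeM hm i v).1 hv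
  refine (Φ.mem_grade_typeQ k _).2 ?_
  rw [toTypeQ_apply, hv, map_smul, map_smul, smul_smul, hk]

theorem isHom_typeM_typeQ (hm : mu = mu.conj) {j : Specht mu →ₗ[ℂ] Specht lam}
    (hj : Intertwines (spechtRep mu) (spechtRes lam) j) :
    IsHom (Φ.typeM mu hm) (down (Φ.typeQ lam)) (Φ.toTypeQ hm j 0) :=
  ⟨Φ.toTypeQ_rho hm hj 0, fun i v hv => Φ.toTypeQ_grade hm j 0 i v hv i (one_mul _)⟩

theorem isHom_shift_typeM_typeQ (hm : mu = mu.conj) {j : Specht mu →ₗ[ℂ] Specht lam}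
    (hj : Intertwines (spechtRep mu) (spechtRes lam) j) :
    IsHom (Φ.typeM mu hm).shift (down (Φ.typeQ lam)) (Φ.toTypeQ hm j 1) :=
  ⟨Φ.toTypeQ_rho hm hj 1, fun i v hv => Φ.toTypeQ_grade hm j 1 (i + 1) v hv i (by
    rw [eps_add_one, eps, if_neg one_ne_zero]
    ring)⟩

/-- This depends on condition (iii): with the opposite sign of $\phi^\lambda$, the map `j` would be
odd. -/
theorem isHom_typeM_typeM (hml : Precedes mu lam) (hm : mu = mu.conj) (hl : lam = lam.conj)
    {j : Specht mu →ₗ[ℂ] Specht lam} (hj : Intertwines (spechtRep mu) (spechtRes lam) j) :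
    IsHom (Φ.typeM mu hm) (down (Φ.typeM lam hl)) j := by
  refine ⟨hj, fun i v hv => ?_⟩
  have hv := (Φ.mem_grade_typeM hm i v).1 hv
  refine (Φ.mem_grade_typeM hl i _).2 ?_
  exact (Φ.toLocal_compatible n mu lam hml hm hl j hj v).trans
    ((congrArg j hv).trans (map_smul j (eps i) _))

theorem isHom_typeQ_typeM (hl : lam = lam.conj) {j : Specht mu →ₗ[ℂ] Specht lam}
    (hj : Intertwines (spechtRep mu) (spechtRes lam) j) :
    IsHom (Φ.typeQ mu) (down (Φ.typeM lam hl)) (LinearMap.coprod j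
      (Φ.twist lam lam hl ∘ₗ j ∘ₗ Φ.twist mu.conj mu mu.conj_conj.symm)) := by
  refine ⟨fun σ v => ?_, fun i v hv => ?_⟩
  · refine (congrArg₂ (· + ·) (hj σ v.1)
      (Φ.intertwines_twist hj mu.conj lam mu.conj_conj.symm hl σ v.2)).trans ?_
    exact (map_add (spechtRes lam σ) _ _).symm
  · have hv := (Φ.mem_grade_typeQ i v).1 hv
    refine (Φ.mem_grade_typeM hl i _).2 ?_
    show Φ.twist lam lam hl
      (j v.1 + Φ.twist lam lam hl (j (Φ.twist mu.conj mu mu.conj_conj.symm v.2))) =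
      eps i • (j v.1 + Φ.twist lam lam hl (j (Φ.twist mu.conj mu mu.conj_conj.symm v.2)))
    rw [hv]
    simp only [map_smul, map_add, twist_twist, smul_add, smul_smul, eps_mul_self, one_smul]
    exact add_comm _ _

/-! ### Restriction of `W^lam` for `lam ≠ lam'` -/

/-- The clause about `U` says that the image of $W^\mu$ contains the copies of $S^\mu$ and
$S^{\mu'}$ in the two components; it feeds the spanning argument. -/
theorem exists_isHom_W_typeQ (R : Set (Shape n)) (hne : mu ≠ mu.conj)
    {j : Specht mu →ₗ[ℂ] Specht lam} (hj : Intertwines (spechtRep mu) (spechtRes lam) j)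
    (hj0 : j ≠ 0) : ∃ f : (Φ.W R mu).V →ₗ[ℂ] Specht lam × Specht lam.conj,
      IsHom (Φ.W R mu) (down (Φ.typeQ lam)) f ∧ f ≠ 0 ∧
      ∀ U : Submodule ℂ (Specht lam × Specht lam.conj), (∀ v, f v ∈ U) →
        ∀ u, (j u, 0) ∈ U ∧ (0, Φ.twist lam lam.conj rfl (j u)) ∈ U := by
  obtain ⟨e⟩ := Φ.nonempty_iso_W R mu
  rw [Φ.ofPartition_of_ne hne] at e
  have key : ∀ U : Submodule ℂ (Specht lam × Specht lam.conj),
      (∀ v : Specht mu × Specht mu.conj, LinearMap.prodMap j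
        (Φ.twist lam lam.conj rfl ∘ₗ j ∘ₗ Φ.twist mu.conj mu mu.conj_conj.symm) v ∈ U) →
        ∀ u, (j u, 0) ∈ U ∧ (0, Φ.twist lam lam.conj rfl (j u)) ∈ U := by
    intro U hU u
    constructor
    · simpa using hU (u, 0)
    · simpa [twist_twist] using hU (0, Φ.twist mu mu.conj rfl u)
  have hsurj : ∀ v : Specht mu × Specht mu.conj, ∃ w, e.toLinearEquiv w = v :=
    e.toLinearEquiv.surjective
  refine ⟨_, (Φ.isHom_typeQ_typeQ hj).comp e.isHom, fun h0 => ?_, fun U hU => key U fun v => ?_⟩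
  · obtain ⟨v, hv⟩ := exists_apply_ne_zero hj0
    obtain ⟨w, hw⟩ := hsurj (v, 0)
    have h1 : j (e.toLinearEquiv w).1 = 0 := congrArg Prod.fst (LinearMap.congr_fun h0 w)
    exact hv ((congrArg (fun x : Specht mu × Specht mu.conj => j x.1) hw).symm.trans h1)
  · obtain ⟨w, rfl⟩ := hsurj v
    exact hU w

theorem exists_isHom_W_shift_typeQ (R : Set (Shape n)) (hm : mu = mu.conj)
    {j : Specht mu →ₗ[ℂ] Specht lam} (hj : Intertwines (spechtRep mu) (spechtRes lam) j)
    (hj0 : j ≠ 0) : ∃ f g : (Φ.W R mu).V →ₗ[ℂ] Specht lam × Specht lam.conj,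
      (IsHom (Φ.W R mu) (down (Φ.typeQ lam)) f ∧ f ≠ 0) ∧
      (IsHom (Φ.W R mu).shift (down (Φ.typeQ lam)) g ∧ g ≠ 0) ∧
      ∀ U : Submodule ℂ (Specht lam × Specht lam.conj), (∀ v, f v ∈ U) → (∀ v, g v ∈ U) →
        ∀ u, (j u, 0) ∈ U ∧ (0, Φ.twist lam lam.conj rfl (j u)) ∈ U := by
  obtain ⟨e⟩ := Φ.nonempty_iso_W R mu
  rw [Φ.ofPartition_of_eq hm] at e
  have hsurj : ∀ v : Specht mu, ∃ w, e.toLinearEquiv w = v := e.toLinearEquiv.surjective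
  have hne : ∀ p, Φ.toTypeQ hm j p ∘ₗ e.toLinearEquiv.toLinearMap ≠ 0 := fun p h0 => by
    obtain ⟨v, hv⟩ := exists_apply_ne_zero hj0
    obtain ⟨w, rfl⟩ := hsurj v
    exact hv (congrArg Prod.fst (LinearMap.congr_fun h0 w))
  refine ⟨_, _, ⟨(Φ.isHom_typeM_typeQ hm hj).comp e.isHom, hne 0⟩,
    ⟨(Φ.isHom_shift_typeM_typeQ hm hj).comp e.isHom.shift, hne 1⟩, fun U hf hg u => ?_⟩
  have h0 : ∀ v, Φ.toTypeQ hm j 0 v ∈ U := fun v => by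
    obtain ⟨w, rfl⟩ := hsurj v
    exact hf w
  have h1 : ∀ v, Φ.toTypeQ hm j 1 v ∈ U := fun v => by
    obtain ⟨w, rfl⟩ := hsurj v
    exact hg w
  constructor
  -- Half the sum of the even and the shifted map isolates the first component; half the difference,
  -- taken at $\phi u$, isolates the second.
  · have := U.smul_mem (1 / 2 : ℂ) (U.add_mem (h0 u) (h1 u))
    rw [toTypeQ_apply, toTypeQ_apply, eps_zero_smul, eps_one_smul, Prod.mk_add_mk, add_neg_cancel,
      ← two_smul ℂ (j u), Prod.smul_mk, smul_smul, smul_zero] at this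
    norm_num at this
    exact this
  · have := U.smul_mem (1 / 2 : ℂ) (U.sub_mem (h0 (Φ.twist mu mu hm u)) (h1 (Φ.twist mu mu hm u)))
    rw [toTypeQ_apply, toTypeQ_apply, eps_zero_smul, eps_one_smul, Prod.mk_sub_mk, sub_self,
      sub_neg_eq_add, ← two_smul ℂ, Prod.smul_mk, smul_smul, smul_zero, twist_twist] at this
    norm_num at this
    exact this

end Associators

namespace Associators

open Supermodule

variable (Φ : Associators) {n : ℕ} {lam : Shape (n + 1)}

/-- The index set of the summands of the restriction of `W^lam` for `lam ≠ lam'`. -/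
abbrev SummandIndex (lam : Shape (n + 1)) : Type :=
  {mu : Shape n // Precedes mu lam ∧ mu ≠ mu.conj} ⊕
    {mu : Shape n // Precedes mu lam ∧ mu = mu.conj} ⊕
      {mu : Shape n // Precedes mu lam ∧ mu = mu.conj}

/-- The summands of the restriction of `W^lam` for `lam ≠ lam'`. -/
noncomputable def summand (R : Set (Shape n)) (lam : Shape (n + 1)) :
    SummandIndex lam → Supermodule (Equiv.Perm.sign (α := Fin n))
  | Sum.inl mu => Φ.W R mu.1
  | Sum.inr (Sum.inl mu) => Φ.W R mu.1
  | Sum.inr (Sum.inr mu) => (Φ.W R mu.1).shift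

theorem isSimple_summand (R : Set (Shape n)) (lam : Shape (n + 1)) (i : SummandIndex lam) :
    (Φ.summand R lam i).IsSimple := by
  rcases i with mu | mu | mu
  · exact Φ.isSimple_W R mu.1
  · exact Φ.isSimple_W R mu.1
  · exact (Φ.isSimple_W R mu.1).shift

theorem not_equivariant_of_ne (R : Set (Shape n)) (hl : lam ≠ lam.conj) {mu nu : Shape n}
    (h1 : Precedes mu lam) (h2 : Precedes nu lam) (hne : mu ≠ nu)
    (e : (Φ.W R mu).V ≃ₗ[ℂ] (Φ.W R nu).V) :
    ¬ ∀ σ v, e ((Φ.W R mu).ρ σ v) = (Φ.W R nu).ρ σ (e v) := fun he => by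
  obtain h | rfl := Φ.eq_or_eq_conj_of_W R e he
  · exact hne h
  · exact hl (eq_conj_of_precedes hne.symm h2 h1)

theorem isEmpty_iso_summand (R : Set (Shape n)) (hl : lam ≠ lam.conj) (i j : SummandIndex lam)
    (hij : i ≠ j) : IsEmpty (Iso (Φ.summand R lam i) (Φ.summand R lam j)) := by
  refine ⟨fun e => ?_⟩
  rcases i with ⟨mu, h1, hm⟩ | ⟨mu, h1, hm⟩ | ⟨mu, h1, hm⟩ <;>
    rcases j with ⟨nu, h2, hn⟩ | ⟨nu, h2, hn⟩ | ⟨nu, h2, hn⟩ <;>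
    have key := Φ.not_equivariant_of_ne R hl h1 h2
  · exact key (fun h => hij (by subst h; rfl)) e.toLinearEquiv e.map_smul
  · exact key (by rintro rfl; exact hm hn) e.toLinearEquiv e.map_smul
  · exact key (by rintro rfl; exact hm hn) e.toLinearEquiv e.map_smul
  · exact key (by rintro rfl; exact hn hm) e.toLinearEquiv e.map_smul
  · exact key (fun h => hij (by subst h; rfl)) e.toLinearEquiv e.map_smul
  · by_cases h : mu = nu
    · subst h
      exact (Φ.isEmpty_iso_shift R hm).false e
    · exact key h e.toLinearEquiv e.map_smul
  · exact key (by rintro rfl; exact hn hm) e.toLinearEquiv e.map_smul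
  · by_cases h : mu = nu
    · subst h
      exact (Φ.isEmpty_iso_shift R hm).false e.symm
    · exact key h e.toLinearEquiv e.map_smul
  · exact key (fun h => hij (by subst h; rfl)) e.toLinearEquiv e.map_smul

theorem nonempty_iso_typeQ_directSum (R : Set (Shape n)) (hl : lam ≠ lam.conj) :
    Nonempty (Iso (down (Φ.typeQ lam)) (directSum (Φ.summand R lam))) := by
  choose j hj hj0 using fun mu : {mu // Precedes mu lam} => exists_restriction_embedding mu.2
  choose f hf hf0 hfU using fun mu : {mu : Shape n // Precedes mu lam ∧ mu ≠ mu.conj} =>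
    Φ.exists_isHom_W_typeQ R mu.2.2 (hj ⟨mu.1, mu.2.1⟩)
      (hj0 ⟨mu.1, mu.2.1⟩)
  choose g k hg hk hgkU using fun mu : {mu : Shape n // Precedes mu lam ∧ mu = mu.conj} =>
    Φ.exists_isHom_W_shift_typeQ R mu.2.2 (hj ⟨mu.1, mu.2.1⟩)
      (hj0 ⟨mu.1, mu.2.1⟩)
  let F : ∀ i : SummandIndex lam,
      (Φ.summand R lam i).V →ₗ[ℂ] (Specht lam × Specht lam.conj) := fun i => match i with
    | Sum.inl mu => f mu
    | Sum.inr (Sum.inl mu) => g mu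
    | Sum.inr (Sum.inr mu) => k mu
  refine nonempty_iso_directSum (Φ.isSimple_summand R lam) (Φ.isEmpty_iso_summand R hl) F ?_ ?_ ?_
  · rintro (mu | mu | mu)
    · exact hf mu
    · exact (hg mu).1
    · exact (hk mu).1
  · rintro (mu | mu | mu)
    · exact hf0 mu
    · exact (hg mu).2
    · exact (hk mu).2
  · intro U hU
    have hmem : ∀ (mu : {mu // Precedes mu lam}) (u : Specht mu.1),
        (j mu u, 0) ∈ U ∧ (0, Φ.twist lam lam.conj rfl (j mu u)) ∈ U := by
      intro mu
      by_cases hm : mu.1 = mu.1.conj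
      · exact hgkU ⟨mu.1, mu.2, hm⟩ U (hU (Sum.inr (Sum.inl ⟨mu.1, mu.2, hm⟩)))
          (hU (Sum.inr (Sum.inr ⟨mu.1, mu.2, hm⟩)))
      · exact hfU ⟨mu.1, mu.2, hm⟩ U (hU (Sum.inl ⟨mu.1, mu.2, hm⟩))
    -- Branching is applied to $S^\lambda$ only; the component $S^{\lambda'}$ is reached by pulling
    -- back along $\phi^\lambda$.
    have h1 : Submodule.comap (LinearMap.inl ℂ (Specht lam) (Specht lam.conj)) U = ⊤ :=
      eq_top_of_range_le _ fun mu hml =>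
        ⟨j ⟨mu, hml⟩, hj ⟨mu, hml⟩, hj0 ⟨mu, hml⟩, fun v => (hmem ⟨mu, hml⟩ v).1⟩
    have h2 : Submodule.comap (LinearMap.inr ℂ (Specht lam) (Specht lam.conj) ∘ₗ
        Φ.twist lam lam.conj rfl) U = ⊤ :=
      eq_top_of_range_le _ fun mu hml =>
        ⟨j ⟨mu, hml⟩, hj ⟨mu, hml⟩, hj0 ⟨mu, hml⟩, fun v => (hmem ⟨mu, hml⟩ v).2⟩
    refine eq_top_iff.2 fun x _ => ?_
    obtain ⟨u, w⟩ := x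
    have hu : (u, 0) ∈ U := h1.ge (Submodule.mem_top (x := u))
    have hw : (0, Φ.twist lam lam.conj rfl (Φ.twist lam.conj lam lam.conj_conj.symm w)) ∈ U :=
      h2.ge Submodule.mem_top
    rw [twist_twist] at hw
    exact (congrArg (· ∈ U) (Prod.ext (add_zero _) (zero_add _))).mp (U.add_mem hu hw)

theorem lof_ne_zero {G : Type} [Group G] {ε : G →* ℤˣ} {ι : Type} [DecidableEq ι]
    (N : ι → Supermodule ε) (i : ι) {v : (N i).V} (hv : v ≠ 0) :
    DirectSum.lof ℂ ι (fun i => (N i).V) i v ≠ 0 := fun h =>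
  hv (DirectSum.of_injective (β := fun i => (N i).V) i (h.trans (map_zero _).symm))

/-- The right-hand side of the branching rule for `lam ≠ lam'` as one direct sum. -/
theorem nonempty_iso_prod_directSum (R : Set (Shape n)) (hl : lam ≠ lam.conj) :
    Nonempty (Iso (Supermodule.prod
      (directSum fun mu : {mu : Shape n // Precedes mu lam ∧ mu ≠ mu.conj} => Φ.W R mu.1)
      (directSum fun mu : {mu : Shape n // Precedes mu lam ∧ mu = mu.conj} =>
        Supermodule.prod (Φ.W R mu.1) (shift (Φ.W R mu.1))))
      (directSum (Φ.summand R lam))) := by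
  classical
  set A := fun mu : {mu : Shape n // Precedes mu lam ∧ mu ≠ mu.conj} => Φ.W R mu.1 with hA
  set B := fun mu : {mu : Shape n // Precedes mu lam ∧ mu = mu.conj} =>
    Supermodule.prod (Φ.W R mu.1) (shift (Φ.W R mu.1)) with hB
  let F : ∀ i : SummandIndex lam,
      (Φ.summand R lam i).V →ₗ[ℂ] (Supermodule.prod (directSum A) (directSum B)).V :=
    fun i => match i with
    | Sum.inl mu => LinearMap.inl ℂ (directSum A).V (directSum B).V ∘ₗ
        DirectSum.lof ℂ _ (fun i => (A i).V) mu
    | Sum.inr (Sum.inl mu) => (LinearMap.inr ℂ (directSum A).V (directSum B).V ∘ₗ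
        DirectSum.lof ℂ _ (fun i => (B i).V) mu) ∘ₗ
          LinearMap.inl ℂ (Φ.W R mu.1).V (Φ.W R mu.1).shift.V
    | Sum.inr (Sum.inr mu) => (LinearMap.inr ℂ (directSum A).V (directSum B).V ∘ₗ
        DirectSum.lof ℂ _ (fun i => (B i).V) mu) ∘ₗ
          LinearMap.inr ℂ (Φ.W R mu.1).V (Φ.W R mu.1).shift.V
  have hnt : ∀ mu, ∃ v : (Φ.W R mu).V, v ≠ 0 := fun mu =>
    haveI := (Φ.isSimple_W R mu).1
    exists_ne 0
  refine nonempty_iso_directSum (Φ.isSimple_summand R lam) (Φ.isEmpty_iso_summand R hl) F ?_ ?_ ?_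
  · rintro (mu | mu | mu)
    · exact (isHom_inl (directSum A) (directSum B)).comp (isHom_lof A mu)
    · exact ((isHom_inr (directSum A) (directSum B)).comp (isHom_lof B mu)).comp (isHom_inl _ _)
    · exact ((isHom_inr (directSum A) (directSum B)).comp (isHom_lof B mu)).comp (isHom_inr _ _)
  · rintro (mu | mu | mu) h0 <;> obtain ⟨v, hv⟩ := hnt mu.1
    · exact lof_ne_zero A mu hv (congrArg Prod.fst (LinearMap.congr_fun h0 v))
    · exact lof_ne_zero B mu (v := (v, 0)) (fun h => hv (congrArg Prod.fst h))
        (congrArg Prod.snd (LinearMap.congr_fun h0 v))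
    · exact lof_ne_zero B mu (v := (0, v)) (fun h => hv (congrArg Prod.snd h))
        (congrArg Prod.snd (LinearMap.congr_fun h0 v))
  · intro U hU
    have h1 : ∀ x : ⨁ i, (A i).V, ((x, 0) : (directSum A).V × (directSum B).V) ∈ U := by
      have : Submodule.comap (LinearMap.inl ℂ (directSum A).V (directSum B).V) U = ⊤ := by
        refine eq_top_iff.2 fun x _ => ?_
        induction x using DirectSum.induction_on with
        | zero => exact Submodule.zero_mem _
        | add x y hx hy => exact Submodule.add_mem _ (hx trivial) (hy trivial)
        | of i v => exact hU (Sum.inl i) v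
      exact fun x => this.ge (Submodule.mem_top (x := x))
    have h2 : ∀ x : ⨁ i, (B i).V, ((0, x) : (directSum A).V × (directSum B).V) ∈ U := by
      have : Submodule.comap (LinearMap.inr ℂ (directSum A).V (directSum B).V) U = ⊤ := by
        refine eq_top_iff.2 fun x _ => ?_
        induction x using DirectSum.induction_on with
        | zero => exact Submodule.zero_mem _
        | add x y hx hy => exact Submodule.add_mem _ (hx trivial) (hy trivial)
        | of i v =>
          have h := U.add_mem (hU (Sum.inr (Sum.inl i)) v.1) (hU (Sum.inr (Sum.inr i)) v.2)
          have hv : F (Sum.inr (Sum.inl i)) v.1 + F (Sum.inr (Sum.inr i)) v.2 =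
              LinearMap.inr ℂ (directSum A).V (directSum B).V
                (DirectSum.of (fun i => (B i).V) i v) :=
            Prod.ext (add_zero _) ((map_add (DirectSum.of (fun i => (B i).V) i) _ _).symm.trans
              (congrArg (DirectSum.of (fun i => (B i).V) i) (Prod.ext (add_zero _) (zero_add _))))
          exact (congrArg (· ∈ U) hv).mp h
      exact fun x => this.ge (Submodule.mem_top (x := x))
    refine eq_top_iff.2 fun x _ => ?_
    exact (congrArg (· ∈ U) (Prod.ext (add_zero _) (zero_add _))).mp
      (U.add_mem (h1 x.1) (h2 x.2))

/-! ### Restriction of `W^lam` for `lam = lam'` -/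

theorem res_eq {mu : Shape n} {c : ℕ × ℕ} (hc : c ∈ lam.1.cells)
    (h : mu.1.cells = lam.1.cells.erase c) : res mu lam = (c.2 : ℤ) - c.1 := by
  have : lam.1.cells \ mu.1.cells = {c} := by
    rw [h, Finset.erase_eq,
      Finset.sdiff_sdiff_eq_self (Finset.singleton_subset_iff.2 hc)]
  rw [res, this, Finset.sum_singleton]

theorem conj_cells_erase {mu : Shape n} (hl : lam = lam.conj) {c : ℕ × ℕ}
    (hc : c ∈ lam.1.cells) (h : mu.1.cells = lam.1.cells.erase c) :
    c.swap ∈ lam.1.cells ∧ mu.conj.1.cells = lam.1.cells.erase c.swap := by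
  have hsw : ∀ d : ℕ × ℕ, d.swap ∈ lam.1.cells ↔ d ∈ lam.1.cells := fun d => by
    conv_lhs => rw [hl]
    exact Shape.swap_mem_conj
  refine ⟨(hsw c).2 hc, Finset.ext fun d => ?_⟩
  rw [← d.swap_swap, Shape.swap_mem_conj, h, Finset.mem_erase, Finset.mem_erase, hsw,
    Ne, Ne, Prod.swap_inj, Prod.swap_swap]

theorem res_conj {mu : Shape n} (hl : lam = lam.conj) (h : Precedes mu lam) :
    res mu.conj lam = -res mu lam := by
  obtain ⟨c, hc, h⟩ := h
  obtain ⟨hc', h'⟩ := conj_cells_erase hl hc h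
  rw [res_eq hc h, res_eq hc' h', Prod.fst_swap, Prod.snd_swap]
  ring

theorem eq_conj_of_res_eq_zero {mu : Shape n} (hl : lam = lam.conj) (h : Precedes mu lam)
    (h0 : res mu lam = 0) : mu = mu.conj := by
  obtain ⟨c, hc, h⟩ := h
  rw [res_eq hc h] at h0
  have hcc : c.swap = c := Prod.ext (by rw [Prod.fst_swap]; omega) (by rw [Prod.snd_swap]; omega)
  have h' := (conj_cells_erase hl hc h).2
  rw [hcc, ← h] at h'
  exact Shape.ext_cells h'.symm

/-- The last clause places in the image also the copy of the Specht module of the conjugate of `mu`,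
which supplies the constituents of negative residue. -/
theorem exists_isHom_W_typeM (R : Set (Shape n)) {mu : Shape n} (hml : Precedes mu lam)
    (hl : lam = lam.conj) {j : Specht mu →ₗ[ℂ] Specht lam}
    (hj : Intertwines (spechtRep mu) (spechtRes lam) j) (hj0 : j ≠ 0) :
    ∃ f : (Φ.W R mu).V →ₗ[ℂ] Specht lam, IsHom (Φ.W R mu) (down (Φ.typeM lam hl)) f ∧ f ≠ 0 ∧
      ∀ U : Submodule ℂ (Specht lam), (∀ v, f v ∈ U) → (∀ u, j u ∈ U) ∧
        ∀ kap (h : mu = kap.conj) (w : Specht kap),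
          Φ.twist lam lam hl (j (Φ.twist kap mu h w)) ∈ U := by
  obtain ⟨e⟩ := Φ.nonempty_iso_W R mu
  by_cases hm : mu = mu.conj
  · rw [Φ.ofPartition_of_eq hm] at e
    have hsurj : ∀ v : Specht mu, ∃ w, e.toLinearEquiv w = v := e.toLinearEquiv.surjective
    refine ⟨_, (Φ.isHom_typeM_typeM hml hm hl hj).comp e.isHom, fun h0 => ?_, fun U hU => ?_⟩
    · obtain ⟨v, hv⟩ := exists_apply_ne_zero hj0
      obtain ⟨w, rfl⟩ := hsurj v
      exact hv (LinearMap.congr_fun h0 w)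
    · have hU : ∀ u, j u ∈ U := fun u => by
        obtain ⟨w, rfl⟩ := hsurj u
        exact hU w
      refine ⟨hU, fun kap h w => ?_⟩
      have := Φ.toLocal_compatible n mu lam hml hm hl j hj (Φ.twist kap mu h w)
      exact (congrArg (· ∈ U) this).mpr (hU _)
  · rw [Φ.ofPartition_of_ne hm] at e
    have hsurj : ∀ v : Specht mu × Specht mu.conj, ∃ w, e.toLinearEquiv w = v :=
      e.toLinearEquiv.surjective
    let f := LinearMap.coprod j
      (Φ.twist lam lam hl ∘ₗ j ∘ₗ Φ.twist mu.conj mu mu.conj_conj.symm)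
    have hf1 : ∀ u, f (u, 0) = j u := fun u => by simp [f]
    refine ⟨f ∘ₗ e.toLinearEquiv.toLinearMap, (Φ.isHom_typeQ_typeM hl hj).comp e.isHom,
      fun h0 => ?_, fun U hU => ?_⟩
    · obtain ⟨v, hv⟩ := exists_apply_ne_zero hj0
      obtain ⟨w, hw⟩ := hsurj (v, 0)
      exact hv ((hf1 v).symm.trans ((congrArg f hw).symm.trans (LinearMap.congr_fun h0 w)))
    · have hU : ∀ x, f x ∈ U := fun x => by
        obtain ⟨w, rfl⟩ := hsurj x
        exact hU w
      refine ⟨fun u => hf1 u ▸ hU (u, 0), fun kap h w => ?_⟩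
      obtain rfl : kap = mu.conj := Shape.eq_conj_symm h
      simpa [f] using hU (0, w)

/-- Conjugation negates the residue, so two conjugate shapes with nonnegative residues both have
residue 0; then the removed cell is diagonal and the shapes coincide. No grading is involved, so
even and odd isomorphisms are excluded alike. -/
theorem not_equivariant_of_res (R : Set (Shape n)) (hl : lam = lam.conj)
    (mu nu : {mu : Shape n // Precedes mu lam ∧ 0 ≤ res mu lam}) (hne : mu ≠ nu)
    (e : (Φ.W R mu.1).V ≃ₗ[ℂ] (Φ.W R nu.1).V) :
    ¬ ∀ σ v, e ((Φ.W R mu.1).ρ σ v) = (Φ.W R nu.1).ρ σ (e v) := fun he => by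
  rcases Φ.eq_or_eq_conj_of_W R e he with h | h
  · exact hne (Subtype.ext h)
  · have h1 := res_conj hl nu.2.1
    rw [← h] at h1
    have h2 := mu.2.2
    have h3 := nu.2.2
    exact hne (Subtype.ext (h.trans (eq_conj_of_res_eq_zero hl nu.2.1 (by omega)).symm))

theorem nonempty_iso_typeM_directSum (R : Set (Shape n)) (hl : lam = lam.conj) :
    Nonempty (Iso (down (Φ.typeM lam hl))
      (directSum fun mu : {mu : Shape n // Precedes mu lam ∧ 0 ≤ res mu lam} => Φ.W R mu.1)) := by
  choose j hj hj0 using fun mu : {mu // Precedes mu lam} => exists_restriction_embedding mu.2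
  choose f hf hf0 hfU using fun mu : {mu : Shape n // Precedes mu lam ∧ 0 ≤ res mu lam} =>
    Φ.exists_isHom_W_typeM R mu.2.1 hl (hj ⟨mu.1, mu.2.1⟩)
      (hj0 ⟨mu.1, mu.2.1⟩)
  refine nonempty_iso_directSum (fun mu => Φ.isSimple_W R mu.1)
    (fun mu nu hne => ⟨fun e => Φ.not_equivariant_of_res R hl mu nu hne e.toLinearEquiv
      e.map_smul⟩) f hf hf0 fun U hU => ?_
  refine eq_top_of_range_le U fun nu hnl => ?_
  by_cases hr : 0 ≤ res nu lam
  · exact ⟨j ⟨nu, hnl⟩, hj ⟨nu, hnl⟩, hj0 ⟨nu, hnl⟩, (hfU ⟨nu, hnl, hr⟩ U (hU ⟨nu, hnl, hr⟩)).1⟩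
  -- A shape of negative residue is reached through its conjugate, whose residue is positive.
  · have hml : Precedes nu.conj lam := by
      have := hnl.conj
      rwa [← hl] at this
    have hr' : 0 ≤ res nu.conj lam := by
      rw [res_conj hl hnl]
      omega
    exact ⟨_, Φ.intertwines_twist (hj ⟨nu.conj, hml⟩) nu lam rfl hl,
      Φ.twist_ne_zero (hj0 ⟨nu.conj, hml⟩) nu lam rfl hl,
      (hfU ⟨nu.conj, hml, hr'⟩ U (hU ⟨nu.conj, hml, hr'⟩)).2 nu rfl⟩

end Associators

end SuperSym

/-! ### The restriction theorem -/

open SuperSym SuperSym.Supermodule in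
theorem mainTheorem5 :
    Nonempty Associators ∧
    ∀ (Φ : Associators) (R : ∀ n : ℕ, Set (Shape n)) (_hR : ∀ n, IsTransversal (R n))
      (n : ℕ) (_hn : 2 ≤ n + 1) (lam : Shape (n + 1)) (_hlam : lam ∈ R (n + 1)),
      (lam ≠ lam.conj →
        Nonempty (Iso (down (Φ.W (R (n + 1)) lam))
          (Supermodule.prod
            (directSum fun mu : {mu : Shape n // Precedes mu lam ∧ mu ≠ mu.conj} =>
              Φ.W (R n) mu.1)
            (directSum fun mu : {mu : Shape n // Precedes mu lam ∧ mu = mu.conj} =>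
              Supermodule.prod (Φ.W (R n) mu.1) (shift (Φ.W (R n) mu.1)))))) ∧
      (lam = lam.conj →
        Nonempty (Iso (down (Φ.W (R (n + 1)) lam))
          (directSum fun mu : {mu : Shape n // Precedes mu lam ∧ 0 ≤ res mu lam} =>
            Φ.W (R n) mu.1))) ∧
      IsMultiplicityFree (down (Φ.W (R (n + 1)) lam)) ∧
      (lam = lam.conj →
        IsHomogeneouslyMultiplicityFree (down (Φ.W (R (n + 1)) lam))) := by
  refine ⟨nonempty_associators, fun Φ R _ n _ lam hlam => ?_⟩
  have hW : Φ.W (R (n + 1)) lam = Φ.ofPartition lam := if_pos hlam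
  rw [hW]
  have hQ : lam ≠ lam.conj →
      Nonempty (Iso (down (Φ.ofPartition lam)) (directSum (Φ.summand (R n) lam))) := fun hl => by
    rw [Φ.ofPartition_of_ne hl]
    exact Φ.nonempty_iso_typeQ_directSum (R n) hl
  have hM : lam = lam.conj → Nonempty (Iso (down (Φ.ofPartition lam))
      (directSum fun mu : {mu : Shape n // Precedes mu lam ∧ 0 ≤ res mu lam} =>
        Φ.W (R n) mu.1)) := fun hl => by
    rw [Φ.ofPartition_of_eq hl]
    exact Φ.nonempty_iso_typeM_directSum (R n) hl
  refine ⟨fun hl => ?_, hM, ?_, fun hl => ?_⟩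
  · obtain ⟨e⟩ := hQ hl
    obtain ⟨f⟩ := Φ.nonempty_iso_prod_directSum (R n) hl
    exact ⟨e.trans f.symm⟩
  · by_cases hl : lam = lam.conj
    · exact ⟨_, _, fun mu => Φ.isSimple_W (R n) mu.1, fun mu nu hne => ⟨fun e =>
        Φ.not_equivariant_of_res (R n) hl mu nu hne e.toLinearEquiv e.map_smul⟩, hM hl⟩
    · exact ⟨_, _, Φ.isSimple_summand (R n) lam, Φ.isEmpty_iso_summand (R n) hl, hQ hl⟩
  -- The parity shift has the same underlying module, so one ungraded argument excludes both kinds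
  -- of isomorphism.
  · exact ⟨_, _, fun mu => Φ.isSimple_W (R n) mu.1, fun mu nu hne => ⟨⟨fun e =>
      Φ.not_equivariant_of_res (R n) hl mu nu hne e.toLinearEquiv e.map_smul⟩, ⟨fun e =>
      Φ.not_equivariant_of_res (R n) hl mu nu hne e.toLinearEquiv e.map_smul⟩⟩, hM hl⟩
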